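/- **Setting.** Let $k$ be a field of characteristic $0$, $\otimes=\otimes_k$, and let $H$ be a Hopf algebra over $k$ with comultiplication $h\mapsto h_{(1)}\otimes h_{(2)}$ and counit $\varepsilon$. Let $A$ be a (unital, associative) $H$-module algebra, that is, $h(ab)=h_{(1)}(a)\,h_{(2)}(b)$ and $h(1)=\varepsilon(h)1$; let $C$ be an $H$-module coalgebra, that is, $\Delta(h(c))=h_{(1)}(c_{(1)})\otimes h_{(2)}(c_{(2)})$ and $\varepsilon(h(c))=\varepsilon(h)\varepsilon(c)$; and let $M$ be a left $H$-module which is also a left $H$-comodule, $m\mapsto m_{(-1)}\otimes m_{(0)}$, with no compatibility assumed between the two structures. Let $C$ act $H$-equivariantly on $A$, that is, let $C\otimes A\to A$, $c\otimes a\mapsto c\triangleright a$, be a linear map with $$c\triangleright(ab)=(c_{(1)}\triangleright a)(c_{(2)}\triangleright b),\qquad c\triangleright 1=\varepsilon(c)1,\qquad h(c\triangleright a)=h(c)\triangleright a .$$ **Cyclic modules.** Let $\Lambda$ be Connes' cyclic category, with objects $[n]$, $n\ge 0$, and generators the cofaces $\partial_j$, the codegeneracies $\sigma_j$ and the cyclic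 operators $\tau_n$. Left (right) $\Lambda$-modules, also called cocyclic (cyclic) modules, are the covariant (contravariant) functors from $\Lambda$ to $k$-vector spaces; $k_\bullet$ is the constant functor $k$, and $\mathrm{Ext}_\Lambda$ is taken in these abelian categories. For a left module $X_\bullet$ and a right module $Y_\bullet$ let $\mathrm{diag}_\bullet\mathrm{Hom}_k(X_\bullet,Y_\bullet)$ be the right module $[n]\mapsto\mathrm{Hom}_k(X_n,Y_n)$ on which an arrow $f:[m]\to[n]$ acts by $\psi\mapsto Y_f\circ\psi\circ X_f$. * $\mathrm{Cyc}_\bullet(A)$ is the usual cyclic module of $A$, $\mathrm{Cyc}_n(A)=A^{\otimes n+1}$, with $\tau_n$ acting by $a_0\otimes\cdots\otimes a_n\mapsto a_n\otimes a_0\otimes\cdots\otimes a_{n-1}$, and $HC^n(A)=\mathrm{Ext}^n_\Lambda(\mathrm{Cyc}_\bullet(A),k_\bullet)$. * For $Z=C$ or $Z=A$ consider the spaces $Z^{\otimes n+1}\otimes M$ with the diagonal action of $H$ and with $t(z_0\otimes\cdots\otimes z_n\otimes m)=z_1\otimes\cdots\otimes z_n\otimes m_{(-1)}(z_0)\otimes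 m_{(0)}$. For $Z=C$, let $\partial_j$ ($j\le n$) apply $\Delta$ to the $j$-th factor, $\sigma_j$ apply $\varepsilon$ to the $(j+1)$-st factor, $\tau=t$ and $\partial_{n+1}=\tau\partial_0$. For $Z=A$, let $\partial_j$ ($j\le n$) multiply the factors $j$ and $j+1$, $\sigma_j$ insert $1$ after the $j$-th factor, $\tau=t^{-1}$, and let $\partial_{n+1}$ be $\tau$ followed by $\partial_0$. Then $C_\bullet(Z,M)$ is the largest graded quotient on which the operators $\partial_j$ ($j\le n$), $\sigma_j$ and $t$ are defined, $H$ acts through $\varepsilon$, and $t^{n+1}=\mathrm{id}$ in degree $n$. It is a cocyclic module for $Z=C$ and a cyclic module for $Z=A$, and $$HC^p_{\rm Hopf}(C,M)=\mathrm{Ext}^p_\Lambda(k_\bullet,C_\bullet(C,M)),\qquad HC^q_{\rm Hopf}(A,M)=\mathrm{Ext}^q_\Lambda(C_\bullet(A,M),k_\bullet).$$ **External pairing.** Over the field $k$ the double functor $F=\mathrm{diag}_\bullet\mathrm{Hom}_k$ is exact in both variables. The external pairing induced by $F$ is the family of $k$-linear maps $$\eta^{p,q}_{X,Y}:\mathrm{Ext}^p_\Lambda(k_\bullet,X_\bullet)\otimes\mathrm{Ext}^q_\Lambda(Y_\bullet,k_\bullet)\to\mathrm{Ext}^{p+q}_\Lambda(F(X_\bullet,Y_\bullet),k_\bullet),\qquad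 p,q\ge 0,$$ which is natural in $X_\bullet$ and in $Y_\bullet$, is compatible with connecting homomorphisms in both variables, where the one in the second variable carries the sign $(-1)^p$, that is, with products of $\mathrm{Ext}$ classes written in the order of the arrows, $\eta(\alpha\cdot[S],\beta)=[F(S,Y)]\cdot\eta(\alpha,\beta)$ and $\eta(\alpha,[T]\cdot\beta)=(-1)^p[F(X,T)]\cdot\eta(\alpha,\beta)$ for short exact sequences $S$ of left and $T$ of right modules and $\alpha$ of degree $p$, and which for $p=q=0$ sends $f\otimes g$ to the morphism $\psi\mapsto g(\psi(f(1)))$. **Theorem.** There is a unique morphism of cyclic modules $$\phi_\bullet:\mathrm{Cyc}_\bullet(A)\to\mathrm{diag}_\bullet\mathrm{Hom}_k(C_\bullet(C,M),C_\bullet(A,M))$$ with $$\phi_n(a_0\otimes\cdots\otimes a_n)(c_0\otimes\cdots\otimes c_n\otimes m)=c_0\triangleright a_0\otimes\cdots\otimes c_n\triangleright a_n\otimes m$$ for all $n\ge 0$, and it induces a well-defined pairing $$(\,\cdot\smile\cdot\,):HC^p_{\rm Hopf}(C,M)\otimes HC^q_{\rm Hopf}(A,M)\to HC^{p+q}(A),\qquad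 x\smile y=\phi^*\bigl(\eta^{p,q}(x\otimes y)\bigr),$$ for all $p,q\ge 0$: an external pairing $\eta$ as above exists, and the $k$-linear maps $\smile$ do not depend on its choice. -/

import Mathlib

open CategoryTheory Opposite TensorProduct

universe v u

/-- The `m`-fold iterate of an endomorphism in a category. -/
def endoIter {D : Type*} [Category D] {X : D} (f : X ⟶ X) : ℕ → (X ⟶ X)
  | 0 => 𝟙 X
  | m + 1 => endoIter f m ≫ f

/-- The vertices `[n]`, `n ≥ 0`, of the quiver of generators of Connes' cyclic category. -/
def CyclicQuiver : Type := ℕ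

/-- The generating arrows `∂_j : [n] ⟶ [n+1]` for `0 ≤ j ≤ n+1`, `σ_j : [n+1] ⟶ [n]` for
`0 ≤ j ≤ n` and `τ_n : [n] ⟶ [n]`. -/
inductive CyclicQuiver.Hom : CyclicQuiver → CyclicQuiver → Type
  | δ (n j : ℕ) (h : j ≤ n + 1) : Hom n (n + 1 : ℕ)
  | σ (n j : ℕ) (h : j ≤ n) : Hom (n + 1 : ℕ) n
  | τ (n : ℕ) : Hom n n

instance : Quiver CyclicQuiver where
  Hom := CyclicQuiver.Hom

namespace CyclicQuiver

/-- The vertex `[n]` in the free category on the generators. -/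
def pt (n : ℕ) : Paths CyclicQuiver := (Paths.of CyclicQuiver).obj n

/-- The generator `∂_j : [n] ⟶ [n+1]` in the free category on the generators. -/
def d (n j : ℕ) (h : j ≤ n + 1) : pt n ⟶ pt (n + 1) :=
  (Paths.of CyclicQuiver).map (Hom.δ n j h)

/-- The generator `σ_j : [n+1] ⟶ [n]` in the free category on the generators. -/
def s (n j : ℕ) (h : j ≤ n) : pt (n + 1) ⟶ pt n :=
  (Paths.of CyclicQuiver).map (Hom.σ n j h)

/-- The generator `τ_n : [n] ⟶ [n]` in the free category on the generators. -/
def t (n : ℕ) : pt n ⟶ pt n :=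
  (Paths.of CyclicQuiver).map (Hom.τ n)

/-- The defining relations of Connes' cyclic category. The composite `f ≫ g` (first `f`, then `g`)
is what is written `g f` in the usual form of the relations, which is recalled on each line. -/
inductive Rel : HomRel (Paths CyclicQuiver)
  /-- `∂_i ∂_j = ∂_{j+1} ∂_i` for `i ≤ j` -/
  | δδ (n i j : ℕ) (hij : i ≤ j) (hj : j ≤ n + 1) :
      Rel (d n j hj ≫ d (n + 1) i (by omega)) (d n i (by omega) ≫ d (n + 1) (j + 1) (by omega))
  /-- `σ_j σ_i = σ_i σ_{j+1}` for `i ≤ j` -/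
  | σσ (n i j : ℕ) (hij : i ≤ j) (hj : j ≤ n) :
      Rel (s (n + 1) i (by omega) ≫ s n j hj) (s (n + 1) (j + 1) (by omega) ≫ s n i (by omega))
  /-- `∂_i σ_j = σ_{j+1} ∂_i` for `i ≤ j` -/
  | σδ_le (n i j : ℕ) (hij : i ≤ j) (hj : j ≤ n) :
      Rel (s n j hj ≫ d n i (by omega)) (d (n + 1) i (by omega) ≫ s (n + 1) (j + 1) (by omega))
  /-- `∂_i σ_j = σ_j ∂_{i+1}` for `i > j` -/
  | σδ_gt (n i j : ℕ) (hij : j < i) (hi : i ≤ n + 1) :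
      Rel (s n j (by omega) ≫ d n i hi) (d (n + 1) (i + 1) (by omega) ≫ s (n + 1) j (by omega))
  /-- `σ_i ∂_i = id` -/
  | δσ_self (n i : ℕ) (hi : i ≤ n) : Rel (d n i (by omega) ≫ s n i hi) (𝟙 (pt n))
  /-- `σ_i ∂_{i+1} = id` -/
  | δσ_succ (n i : ℕ) (hi : i ≤ n) : Rel (d n (i + 1) (by omega) ≫ s n i hi) (𝟙 (pt n))
  /-- `τ_n ^ (n+1) = id` -/
  | τ_pow (n : ℕ) : Rel (endoIter (t n) (n + 1)) (𝟙 (pt n))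
  /-- `∂_j τ_n = τ_{n+1} ∂_{j+1}` for `j ≤ n` -/
  | τδ (n j : ℕ) (hj : j ≤ n) :
      Rel (t n ≫ d n j (by omega)) (d n (j + 1) (by omega) ≫ t (n + 1))
  /-- `∂_{n+1} = τ_{n+1} ∂_0` -/
  | δ_last (n : ℕ) : Rel (d n (n + 1) le_rfl) (d n 0 (by omega) ≫ t (n + 1))
  /-- `σ_j τ_{n+1} = τ_n σ_{j+1}` for `j < n` -/
  | τσ (n j : ℕ) (hj : j < n) :
      Rel (t (n + 1) ≫ s n j (by omega)) (s n (j + 1) (by omega) ≫ t n)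
  /-- `σ_n τ_{n+1}^2 = τ_n σ_0` -/
  | τσ_last (n : ℕ) : Rel (t (n + 1) ≫ t (n + 1) ≫ s n n le_rfl) (s n 0 (by omega) ≫ t n)

end CyclicQuiver

/-- Connes' cyclic category `Λ`, presented by generators and relations. -/
abbrev Lam : Type := CategoryTheory.Quotient CyclicQuiver.Rel

/-- The object `[n]` of `Λ`. -/
def Lam.mk (n : ℕ) : Lam := ⟨CyclicQuiver.pt n⟩

/-- Objects and arrows of a category with which one can build a functor on `Λ`: the arrow `δ n j`
is used for `j ≤ n` only, since `∂_{n+1} = τ_{n+1} ∂_0`. -/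
structure CocyclicData (D : Type u) [Category.{v} D] where
  X : ℕ → D
  δ : ∀ n : ℕ, ℕ → (X n ⟶ X (n + 1))
  σ : ∀ n : ℕ, ℕ → (X (n + 1) ⟶ X n)
  τ : ∀ n : ℕ, X n ⟶ X n
  δδ : ∀ n i j, i ≤ j → j ≤ n → δ n j ≫ δ (n + 1) i = δ n i ≫ δ (n + 1) (j + 1)
  σσ : ∀ n i j, i ≤ j → j ≤ n → σ (n + 1) i ≫ σ n j = σ (n + 1) (j + 1) ≫ σ n i
  σδ_le : ∀ n i j, i ≤ j → j ≤ n → σ n j ≫ δ n i = δ (n + 1) i ≫ σ (n + 1) (j + 1)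
  σδ_gt : ∀ n i j, j < i → i ≤ n → σ n j ≫ δ n i = δ (n + 1) (i + 1) ≫ σ (n + 1) j
  δσ_self : ∀ n i, i ≤ n → δ n i ≫ σ n i = 𝟙 _
  δσ_succ : ∀ n i, i < n → δ n (i + 1) ≫ σ n i = 𝟙 _
  δτσ : ∀ n, δ n 0 ≫ τ (n + 1) ≫ σ n n = 𝟙 _
  τ_pow : ∀ n, endoIter (τ n) (n + 1) = 𝟙 _
  τδ : ∀ n j, j < n → τ n ≫ δ n j = δ n (j + 1) ≫ τ (n + 1)
  τδ_last : ∀ n, τ n ≫ δ n n = δ n 0 ≫ τ (n + 1) ≫ τ (n + 1)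
  τσ : ∀ n j, j < n → τ (n + 1) ≫ σ n j = σ n (j + 1) ≫ τ n
  τσ_last : ∀ n, τ (n + 1) ≫ τ (n + 1) ≫ σ n n = σ n 0 ≫ τ n

namespace CocyclicData

variable {D : Type u} [Category.{v} D] (E : CocyclicData D)

/-- The arrows of `D` assigned to all the coface generators. -/
def face (n j : ℕ) : E.X n ⟶ E.X (n + 1) :=
  if j ≤ n then E.δ n j else E.δ n 0 ≫ E.τ (n + 1)

/-- The assignment on generators. -/
def prefunctor : CyclicQuiver ⥤q D where
  obj n := E.X n
  map f := match f with
    | .δ n j _ => E.face n j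
    | .σ n j _ => E.σ n j
    | .τ n => E.τ n

/-- The functor on the free category. -/
def pathFunctor : Paths CyclicQuiver ⥤ D := Paths.lift E.prefunctor

lemma pathFunctor_d (n j : ℕ) (h : j ≤ n + 1) :
    E.pathFunctor.map (CyclicQuiver.d n j h) = E.face n j :=
  Paths.lift_toPath _ _

lemma pathFunctor_s (n j : ℕ) (h : j ≤ n) :
    E.pathFunctor.map (CyclicQuiver.s n j h) = E.σ n j :=
  Paths.lift_toPath _ _

lemma pathFunctor_t (n : ℕ) :
    E.pathFunctor.map (CyclicQuiver.t n) = E.τ n :=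
  Paths.lift_toPath _ _

lemma map_endoIter {C : Type*} [Category C] (F : C ⥤ D) {X : C} (f : X ⟶ X) (m : ℕ) :
    F.map (endoIter f m) = endoIter (F.map f) m := by
  induction m with
  | zero => simp [endoIter]
  | succ m ih => simp [endoIter, ih]

lemma face_of_le {n j : ℕ} (h : j ≤ n) : E.face n j = E.δ n j := if_pos h

lemma face_last (n : ℕ) : E.face n (n + 1) = E.δ n 0 ≫ E.τ (n + 1) := if_neg (by omega)

lemma face_τ (n j : ℕ) (hj : j ≤ n) :
    E.τ n ≫ E.face n j = E.face n (j + 1) ≫ E.τ (n + 1) := by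
  rw [face_of_le _ hj]
  rcases hj.lt_or_eq with h | rfl
  · rw [face_of_le _ (by omega : j + 1 ≤ n), E.τδ n j h]
  · rw [face_last, E.τδ_last, Category.assoc]

lemma face_face (n i j : ℕ) (hij : i ≤ j) (hj : j ≤ n + 1) :
    E.face n j ≫ E.face (n + 1) i = E.face n i ≫ E.face (n + 1) (j + 1) := by
  rcases hj.lt_or_eq with h | rfl
  · rw [face_of_le _ (by omega : j ≤ n), face_of_le _ (by omega : i ≤ n),
      face_of_le _ (by omega : i ≤ n + 1), face_of_le _ (by omega : j + 1 ≤ n + 1)]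
    exact E.δδ n i j hij (by omega)
  · rw [face_last, face_last, Category.assoc, E.face_τ _ _ hij]
    rcases hij.lt_or_eq with h | rfl
    · rw [face_of_le _ (by omega : i ≤ n), face_of_le _ (by omega : i + 1 ≤ n + 1),
        ← Category.assoc, ← Category.assoc, E.δδ n 0 i (by omega) (by omega)]
    · have h₁ := E.τδ (n + 1) 0 (by omega)
      have h₂ := E.δδ n 0 0 le_rfl (by omega)
      simp only [face_last, Category.assoc, reassoc_of% h₁, reassoc_of% h₂]

lemma σ_face_gt (n i j : ℕ) (hij : j < i) (hi : i ≤ n + 1) :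
    E.σ n j ≫ E.face n i = E.face (n + 1) (i + 1) ≫ E.σ (n + 1) j := by
  rcases hi.lt_or_eq with h | rfl
  · rw [face_of_le _ (by omega), face_of_le _ (by omega)]
    exact E.σδ_gt n i j hij (by omega)
  · rw [face_last, face_last, Category.assoc, E.τσ _ _ hij, ← Category.assoc,
      ← Category.assoc, E.σδ_le n 0 j (by omega) (by omega)]

lemma face_succ_σ (n i : ℕ) (hi : i ≤ n) : E.face n (i + 1) ≫ E.σ n i = 𝟙 _ := by
  rcases hi.lt_or_eq with h | rfl
  · rw [face_of_le _ (by omega)]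
    exact E.δσ_succ n i h
  · rw [face_last, Category.assoc]
    exact E.δτσ i

/-- The functor on `Λ` given by cocyclic data. -/
def toFunctor : Lam ⥤ D :=
  CategoryTheory.Quotient.lift _ E.pathFunctor (by
    intro x y f g h
    induction h with
    | δδ n i j hij hj =>
      simp only [Functor.map_comp, pathFunctor_d]
      exact E.face_face n i j hij hj
    | σσ n i j hij hj =>
      simp only [Functor.map_comp, pathFunctor_s]
      exact E.σσ n i j hij hj
    | σδ_le n i j hij hj =>
      simp only [Functor.map_comp, pathFunctor_s, pathFunctor_d]
      rw [face_of_le _ (by omega), face_of_le _ (by omega)]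
      exact E.σδ_le n i j hij hj
    | σδ_gt n i j hij hi =>
      simp only [Functor.map_comp, pathFunctor_s, pathFunctor_d]
      exact E.σ_face_gt n i j hij hi
    | δσ_self n i hi =>
      simp only [Functor.map_comp, pathFunctor_s, pathFunctor_d]
      rw [face_of_le _ hi]
      exact (E.δσ_self n i hi).trans (E.pathFunctor.map_id _).symm
    | δσ_succ n i hi =>
      simp only [Functor.map_comp, pathFunctor_s, pathFunctor_d]
      exact (E.face_succ_σ n i hi).trans (E.pathFunctor.map_id _).symm
    | τ_pow n =>
      rw [map_endoIter, pathFunctor_t]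
      exact (E.τ_pow n).trans (E.pathFunctor.map_id _).symm
    | τδ n j hj =>
      simp only [Functor.map_comp, pathFunctor_t, pathFunctor_d]
      exact E.face_τ n j hj
    | δ_last n =>
      simp only [Functor.map_comp, pathFunctor_t, pathFunctor_d]
      rw [face_last, face_of_le _ (by omega)]
      rfl
    | τσ n j hj =>
      simp only [Functor.map_comp, pathFunctor_t, pathFunctor_s]
      exact E.τσ n j hj
    | τσ_last n =>
      simp only [Functor.map_comp, pathFunctor_t, pathFunctor_s]
      exact E.τσ_last n)

end CocyclicData

/-! ### Iterated tensor products and the operators on them -/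

section Words

variable (k : Type u) [Field k] (Z M : Type u) [AddCommGroup Z] [Module k Z]
  [AddCommGroup M] [Module k M]

/-- The space `Z ⊗ Z ⊗ ⋯ ⊗ Z ⊗ M` (over `k`) with `n` factors `Z`, bracketed to the right. -/
noncomputable def Words : ℕ → ModuleCat.{u} k
  | 0 => ModuleCat.of k M
  | n + 1 => ModuleCat.of k (Z ⊗[k] Words n)

variable {Z M}

/-- The elementary tensor `z₀ ⊗ ⋯ ⊗ z_{n-1} ⊗ m`. -/
noncomputable def word : ∀ n : ℕ, (Fin n → Z) → M → Words k Z M n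
  | 0, _, m => m
  | n + 1, z, m => (z 0 ⊗ₜ[k] word n (fun i => z i.succ) m : Z ⊗[k] Words k Z M n)

variable (Z M)

/-- `z ⊗ x ⊗ w ↦ x ⊗ ρ (z ⊗ w)`. -/
noncomputable def rotStep {Z W V : Type u} [AddCommGroup Z] [Module k Z] [AddCommGroup W]
    [Module k W] [AddCommGroup V] [Module k V] (ρ : Z ⊗[k] W →ₗ[k] V) :
    Z ⊗[k] (Z ⊗[k] W) →ₗ[k] Z ⊗[k] V :=
  LinearMap.lTensor Z ρ ∘ₗ (TensorProduct.leftComm k Z Z W).toLinearMap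

/-- For an endomorphism `R` of `Z ⊗ M`, the rotation of `Z ⊗ ⋯ ⊗ Z ⊗ M` (with `n + 1` factors `Z`)
which moves `z₀` to the right past `z₁, …, z_n` and then applies `R` to `z₀ ⊗ m`. -/
noncomputable def rot {Z M : Type u} [AddCommGroup Z] [Module k Z] [AddCommGroup M] [Module k M]
    (R : Z ⊗[k] M →ₗ[k] Z ⊗[k] M) :
    ∀ n : ℕ, Words k Z M (n + 1) →ₗ[k] Words k Z M (n + 1)
  | 0 => R
  | n + 1 => rotStep k (rot R n)

end Words

lemma lTensor_rotStep {k Z W W' V V' : Type u} [Field k] [AddCommGroup Z] [Module k Z]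
    [AddCommGroup W] [Module k W] [AddCommGroup W'] [Module k W']
    [AddCommGroup V] [Module k V] [AddCommGroup V'] [Module k V'] {f : V →ₗ[k] V'} {ρ : Z ⊗[k] W →ₗ[k] V} {g : W →ₗ[k] W'}
    {ρ' : Z ⊗[k] W' →ₗ[k] V'} (h : f ∘ₗ ρ = ρ' ∘ₗ g.lTensor Z) :
    f.lTensor Z ∘ₗ rotStep k ρ = rotStep k ρ' ∘ₗ (g.lTensor Z).lTensor Z := by
  ext z x w
  have := LinearMap.congr_fun h (z ⊗ₜ w)
  simp only [LinearMap.comp_apply, LinearMap.lTensor_tmul] at this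
  simp [rotStep, this]

section CoalgebraOperators

variable (k : Type u) [Field k] (Z : Type u) [AddCommGroup Z] [Module k Z] [Coalgebra k Z]

/-- `z ⊗ w ↦ z₍₁₎ ⊗ z₍₂₎ ⊗ w`. -/
noncomputable def splitHead (W : Type u) [AddCommGroup W] [Module k W] :
    Z ⊗[k] W →ₗ[k] Z ⊗[k] (Z ⊗[k] W) :=
  (TensorProduct.assoc k Z Z W).toLinearMap ∘ₗ LinearMap.rTensor W Coalgebra.comul

/-- `z ⊗ w ↦ ε(z) w`. -/
noncomputable def dropHead (W : Type u) [AddCommGroup W] [Module k W] :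
    Z ⊗[k] W →ₗ[k] W :=
  (TensorProduct.lid k W).toLinearMap ∘ₗ LinearMap.rTensor W Coalgebra.counit

variable (M : Type u) [AddCommGroup M] [Module k M]

/-- `z₀ ⊗ ⋯ ⊗ z_n ⊗ m ↦ z₀ ⊗ ⋯ ⊗ z_{j(1)} ⊗ z_{j(2)} ⊗ ⋯ ⊗ z_n ⊗ m` for `j ≤ n`
(and zero for `j > n`, a value that is never used). -/
noncomputable def splitAt :
    ∀ n : ℕ, ℕ → (Words k Z M (n + 1) →ₗ[k] Words k Z M (n + 2))
  | n, 0 => splitHead k Z (Words k Z M n)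
  | 0, _ + 1 => 0
  | n + 1, j + 1 => LinearMap.lTensor Z (splitAt n j)

/-- `z₀ ⊗ ⋯ ⊗ z_n ⊗ m ↦ ε(z_j) z₀ ⊗ ⋯ ⊗ z_{j-1} ⊗ z_{j+1} ⊗ ⋯ ⊗ z_n ⊗ m` for `j ≤ n`
(and zero for `j > n`, a value that is never used). -/
noncomputable def dropAt :
    ∀ n : ℕ, ℕ → (Words k Z M (n + 1) →ₗ[k] Words k Z M n)
  | n, 0 => dropHead k Z (Words k Z M n)
  | 0, _ + 1 => 0
  | n + 1, j + 1 => LinearMap.lTensor Z (dropAt n j)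

variable {k Z M}

section

variable {W W' : Type u} [AddCommGroup W] [Module k W] [AddCommGroup W'] [Module k W']

lemma splitHead_tmul {ι : Type*} {z : Z} (r : Coalgebra.Repr k z ι) (w : W) :
    splitHead k Z W (z ⊗ₜ w) = ∑ i ∈ r.index, r.left i ⊗ₜ[k] (r.right i ⊗ₜ[k] w) := by
  simp [splitHead, ← r.eq, TensorProduct.sum_tmul]

@[simp] lemma dropHead_tmul (z : Z) (w : W) :
    dropHead k Z W (z ⊗ₜ w) = Coalgebra.counit (R := k) z • w := by
  simp [dropHead]

lemma splitHead_natural (f : W →ₗ[k] W') :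
    splitHead k Z W' ∘ₗ f.lTensor Z = (f.lTensor Z).lTensor Z ∘ₗ splitHead k Z W := by
  refine TensorProduct.ext' fun z w => ?_
  simp [splitHead_tmul (Coalgebra.Repr.arbitrary k z)]

lemma dropHead_natural (f : W →ₗ[k] W') :
    dropHead k Z W' ∘ₗ f.lTensor Z = f ∘ₗ dropHead k Z W := by
  refine TensorProduct.ext' fun z w => ?_
  simp

lemma splitHead_splitHead :
    splitHead k Z (Z ⊗[k] W) ∘ₗ splitHead k Z W =
      (splitHead k Z W).lTensor Z ∘ₗ splitHead k Z W := by
  refine TensorProduct.ext' fun z w => ?_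
  let g : Z ⊗[k] (Z ⊗[k] Z) →ₗ[k] Z ⊗[k] (Z ⊗[k] (Z ⊗[k] W)) :=
    LinearMap.lTensor Z (LinearMap.lTensor Z ((TensorProduct.mk k Z W).flip w))
  have h₁ : ∀ x : Z ⊗[k] Z, splitHead k Z (Z ⊗[k] W)
      (LinearMap.lTensor Z ((TensorProduct.mk k Z W).flip w) x) =
      g (TensorProduct.assoc k Z Z Z (LinearMap.rTensor Z Coalgebra.comul x)) := by
    intro x
    induction x with
    | zero => simp
    | add x y hx hy => simp only [map_add, hx, hy]
    | tmul a b =>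
      simp [splitHead_tmul (Coalgebra.Repr.arbitrary k a), g,
        ← (Coalgebra.Repr.arbitrary k a).eq, TensorProduct.sum_tmul]
  have h₂ : ∀ x : Z ⊗[k] Z, LinearMap.lTensor Z (splitHead k Z W)
      (LinearMap.lTensor Z ((TensorProduct.mk k Z W).flip w) x) =
      g (LinearMap.lTensor Z Coalgebra.comul x) := by
    intro x
    induction x with
    | zero => simp
    | add x y hx hy => simp only [map_add, hx, hy]
    | tmul a b =>
      simp [splitHead_tmul (Coalgebra.Repr.arbitrary k b), g,
        ← (Coalgebra.Repr.arbitrary k b).eq, TensorProduct.tmul_sum]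
  have h₃ : splitHead k Z W (z ⊗ₜ w) =
      LinearMap.lTensor Z ((TensorProduct.mk k Z W).flip w) (Coalgebra.comul z) := by
    rw [splitHead_tmul (Coalgebra.Repr.arbitrary k z)]
    simp [← (Coalgebra.Repr.arbitrary k z).eq]
  simp only [LinearMap.comp_apply]
  rw [h₃, h₁, h₂, Coalgebra.coassoc_apply]

lemma dropHead_splitHead : dropHead k Z (Z ⊗[k] W) ∘ₗ splitHead k Z W = LinearMap.id := by
  refine TensorProduct.ext' fun z w => ?_
  have r := Coalgebra.Repr.arbitrary k z
  simp only [LinearMap.comp_apply, splitHead_tmul r, map_sum, dropHead_tmul,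
    TensorProduct.smul_tmul', ← TensorProduct.sum_tmul, Coalgebra.sum_counit_smul,
    LinearMap.id_apply]

lemma lTensor_dropHead_splitHead :
    (dropHead k Z W).lTensor Z ∘ₗ splitHead k Z W = LinearMap.id := by
  refine TensorProduct.ext' fun z w => ?_
  have r := Coalgebra.Repr.arbitrary k z
  have h := congrArg (fun x => TensorProduct.rid k Z x ⊗ₜ[k] w)
    (Coalgebra.sum_tmul_counit_eq r)
  simp only [map_sum, TensorProduct.rid_tmul, TensorProduct.sum_tmul, one_smul] at h
  simp only [LinearMap.comp_apply, splitHead_tmul r, map_sum, LinearMap.lTensor_tmul,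
    dropHead_tmul, TensorProduct.tmul_smul, LinearMap.id_apply]
  simpa [TensorProduct.smul_tmul'] using h

end

lemma splitAt_zero (n : ℕ) : splitAt k Z M n 0 = splitHead k Z (Words k Z M n) := by
  cases n <;> rfl

lemma dropAt_zero (n : ℕ) : dropAt k Z M n 0 = dropHead k Z (Words k Z M n) := by
  cases n <;> rfl

lemma splitAt_succ (n j : ℕ) :
    splitAt k Z M (n + 1) (j + 1) = LinearMap.lTensor Z (splitAt k Z M n j) := rfl

lemma dropAt_succ (n j : ℕ) :
    dropAt k Z M (n + 1) (j + 1) = LinearMap.lTensor Z (dropAt k Z M n j) := rfl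

lemma splitAt_splitAt (n i j : ℕ) (hij : i ≤ j) (hj : j ≤ n) :
    splitAt k Z M (n + 1) i ∘ₗ splitAt k Z M n j =
      splitAt k Z M (n + 1) (j + 1) ∘ₗ splitAt k Z M n i := by
  induction n generalizing i j with
  | zero =>
    obtain rfl : j = 0 := by omega
    obtain rfl : i = 0 := by omega
    simp only [splitAt_zero, splitAt_succ]
    exact splitHead_splitHead
  | succ n ih =>
    cases i with
    | zero =>
      cases j with
      | zero =>
        simp only [splitAt_zero, splitAt_succ]
        exact splitHead_splitHead
      | succ j =>
        simp only [splitAt_zero, splitAt_succ]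
        exact splitHead_natural _
    | succ i =>
      obtain ⟨j, rfl⟩ : ∃ j', j = j' + 1 := ⟨j - 1, by omega⟩
      have h := congrArg (LinearMap.lTensor Z) (ih i j (by omega) (by omega))
      exact (LinearMap.lTensor_comp _ _ _).symm.trans (h.trans (LinearMap.lTensor_comp _ _ _))

lemma dropAt_dropAt (n i j : ℕ) (hij : i ≤ j) (hj : j ≤ n) :
    dropAt k Z M n j ∘ₗ dropAt k Z M (n + 1) i = dropAt k Z M n i ∘ₗ dropAt k Z M (n + 1) (j + 1) := by
  induction n generalizing i j with
  | zero =>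
    obtain rfl : j = 0 := by omega
    obtain rfl : i = 0 := by omega
    simp only [dropAt_zero, dropAt_succ]
    exact (dropHead_natural _).symm
  | succ n ih =>
    cases i with
    | zero =>
      simp only [dropAt_zero, dropAt_succ n.succ]
      exact (dropHead_natural _).symm
    | succ i =>
      obtain ⟨j, rfl⟩ : ∃ j', j = j' + 1 := ⟨j - 1, by omega⟩
      have h := congrArg (LinearMap.lTensor Z) (ih i j (by omega) (by omega))
      exact (LinearMap.lTensor_comp _ _ _).symm.trans (h.trans (LinearMap.lTensor_comp _ _ _))

lemma dropAt_splitAt_le (n i j : ℕ) (hij : i ≤ j) (hj : j ≤ n) :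
    splitAt k Z M n i ∘ₗ dropAt k Z M (n + 1) (j + 1) =
      dropAt k Z M (n + 2) (j + 2) ∘ₗ splitAt k Z M (n + 1) i := by
  induction n generalizing i j with
  | zero =>
    obtain rfl : j = 0 := by omega
    obtain rfl : i = 0 := by omega
    simp only [splitAt_zero, dropAt_succ]
    exact splitHead_natural _
  | succ n ih =>
    cases i with
    | zero =>
      simp only [splitAt_zero, dropAt_succ]
      exact splitHead_natural _
    | succ i =>
      obtain ⟨j, rfl⟩ : ∃ j', j = j' + 1 := ⟨j - 1, by omega⟩
      have h := congrArg (LinearMap.lTensor Z) (ih i j (by omega) (by omega))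
      exact (LinearMap.lTensor_comp _ _ _).symm.trans (h.trans (LinearMap.lTensor_comp _ _ _))

lemma dropAt_splitAt_gt (n i j : ℕ) (hij : j ≤ i) (hi : i ≤ n) :
    splitAt k Z M n i ∘ₗ dropAt k Z M (n + 1) j =
      dropAt k Z M (n + 2) j ∘ₗ splitAt k Z M (n + 1) (i + 1) := by
  induction n generalizing i j with
  | zero =>
    obtain rfl : i = 0 := by omega
    obtain rfl : j = 0 := by omega
    simp only [dropAt_zero, splitAt_succ]
    exact (dropHead_natural _).symm
  | succ n ih =>
    cases j with
    | zero =>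
      simp only [dropAt_zero, splitAt_succ _ i]
      exact (dropHead_natural _).symm
    | succ j =>
      obtain ⟨i, rfl⟩ : ∃ i', i = i' + 1 := ⟨i - 1, by omega⟩
      have h := congrArg (LinearMap.lTensor Z) (ih i j (by omega) (by omega))
      exact (LinearMap.lTensor_comp _ _ _).symm.trans (h.trans (LinearMap.lTensor_comp _ _ _))

lemma dropAt_splitAt_self (n i : ℕ) (hi : i ≤ n) :
    dropAt k Z M (n + 1) i ∘ₗ splitAt k Z M n i = LinearMap.id := by
  induction n generalizing i with
  | zero =>
    obtain rfl : i = 0 := by omega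
    simp only [dropAt_zero, splitAt_zero]
    exact dropHead_splitHead
  | succ n ih =>
    cases i with
    | zero =>
      simp only [dropAt_zero, splitAt_zero]
      exact dropHead_splitHead
    | succ i =>
      have h := congrArg (LinearMap.lTensor Z) (ih i (by omega))
      exact (LinearMap.lTensor_comp _ _ _).symm.trans (h.trans (LinearMap.lTensor_id _ _))

lemma dropAt_succ_splitAt (n i : ℕ) (hi : i ≤ n) :
    dropAt k Z M (n + 1) (i + 1) ∘ₗ splitAt k Z M n i = LinearMap.id := by
  induction n generalizing i with
  | zero =>
    obtain rfl : i = 0 := by omega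
    simp only [dropAt_succ, dropAt_zero, splitAt_zero]
    exact lTensor_dropHead_splitHead
  | succ n ih =>
    cases i with
    | zero =>
      simp only [dropAt_succ, dropAt_zero, splitAt_zero]
      exact lTensor_dropHead_splitHead
    | succ i =>
      have h := congrArg (LinearMap.lTensor Z) (ih i (by omega))
      exact (LinearMap.lTensor_comp _ _ _).symm.trans (h.trans (LinearMap.lTensor_id _ _))

section

variable {W W' V V' : Type u} [AddCommGroup W] [Module k W] [AddCommGroup W'] [Module k W']
  [AddCommGroup V] [Module k V] [AddCommGroup V'] [Module k V']

lemma splitHead_rotStep (ρ : Z ⊗[k] W →ₗ[k] V) :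
    splitHead k Z V ∘ₗ rotStep k ρ =
      rotStep k (rotStep k ρ) ∘ₗ (splitHead k Z W).lTensor Z := by
  ext z x w
  simp [rotStep, splitHead_tmul (Coalgebra.Repr.arbitrary k x), TensorProduct.tmul_sum]

lemma dropHead_rotStep (ρ : Z ⊗[k] W →ₗ[k] V) :
    dropHead k Z V ∘ₗ rotStep k ρ = ρ ∘ₗ (dropHead k Z W).lTensor Z := by
  ext z x w
  simp [rotStep]

lemma lTensor_rotStep_split {f : Z ⊗[k] W →ₗ[k] Z ⊗[k] (Z ⊗[k] W)}
    {ρ : Z ⊗[k] W →ₗ[k] Z ⊗[k] W}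
    (h : f ∘ₗ ρ = rotStep k ρ ∘ₗ rotStep k ρ ∘ₗ splitHead k Z W) :
    f.lTensor Z ∘ₗ rotStep k ρ =
      rotStep k (rotStep k ρ) ∘ₗ rotStep k (rotStep k ρ) ∘ₗ splitHead k Z (Z ⊗[k] W) := by
  ext z x w
  have := LinearMap.congr_fun h (z ⊗ₜ w)
  simp only [LinearMap.comp_apply] at this
  simp [rotStep, this, splitHead_tmul (Coalgebra.Repr.arbitrary k z), TensorProduct.tmul_sum]

lemma lTensor_rotStep_drop {f : V →ₗ[k] W} {ρ : Z ⊗[k] W →ₗ[k] V}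
    (h : f ∘ₗ ρ = dropHead k Z W) :
    f.lTensor Z ∘ₗ rotStep k ρ = dropHead k Z (Z ⊗[k] W) := by
  ext z x w
  have := LinearMap.congr_fun h (z ⊗ₜ w)
  simp only [LinearMap.comp_apply] at this
  simp [rotStep, this]

end

/-- The two properties of an endomorphism `R` of `Z ⊗ M` which make the rotations compatible with
the comultiplication and the counit. -/
structure IsCoalgebraTwist (R : Z ⊗[k] M →ₗ[k] Z ⊗[k] M) : Prop where
  counit : dropHead k Z M ∘ₗ R = dropHead k Z M
  comul : splitHead k Z M ∘ₗ R = rotStep k R ∘ₗ rotStep k R ∘ₗ splitHead k Z M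

section

variable {R : Z ⊗[k] M →ₗ[k] Z ⊗[k] M}

lemma splitAt_rot (n j : ℕ) (hj : j < n) :
    splitAt k Z M n j ∘ₗ rot k R n = rot k R (n + 1) ∘ₗ splitAt k Z M n (j + 1) := by
  obtain ⟨n, rfl⟩ : ∃ n', n = n' + 1 := ⟨n - 1, by omega⟩
  replace hj : j ≤ n := by omega
  induction n generalizing j with
  | zero =>
    obtain rfl : j = 0 := by omega
    exact splitHead_rotStep _
  | succ n ih =>
    cases j with
    | zero => exact splitHead_rotStep _
    | succ j => exact lTensor_rotStep (ih j (by omega))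

lemma splitAt_rot_last (hR : IsCoalgebraTwist R) (n : ℕ) :
    splitAt k Z M n n ∘ₗ rot k R n =
      rot k R (n + 1) ∘ₗ rot k R (n + 1) ∘ₗ splitAt k Z M n 0 := by
  induction n with
  | zero => exact hR.comul
  | succ n ih =>
    rw [splitAt_zero] at ih
    exact lTensor_rotStep_split ih

lemma dropAt_rot (n j : ℕ) (hj : j ≤ n) :
    dropAt k Z M (n + 1) j ∘ₗ rot k R (n + 1) = rot k R n ∘ₗ dropAt k Z M (n + 1) (j + 1) := by
  induction n generalizing j with
  | zero =>
    obtain rfl : j = 0 := by omega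
    exact dropHead_rotStep _
  | succ n ih =>
    cases j with
    | zero => exact dropHead_rotStep _
    | succ j => exact lTensor_rotStep (ih j (by omega))

lemma dropAt_rot_last (hR : IsCoalgebraTwist R) (n : ℕ) :
    dropAt k Z M n n ∘ₗ rot k R n = dropAt k Z M n 0 := by
  induction n with
  | zero => exact hR.counit
  | succ n ih =>
    rw [dropAt_zero] at ih
    exact lTensor_rotStep_drop ih

end

end CoalgebraOperators

section AlgebraOperators

variable (k : Type u) [Field k] (A : Type u) [Ring A] [Algebra k A]

/-- `a ⊗ b ⊗ w ↦ a b ⊗ w`. -/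
noncomputable def mulHead (W : Type u) [AddCommGroup W] [Module k W] :
    A ⊗[k] (A ⊗[k] W) →ₗ[k] A ⊗[k] W :=
  LinearMap.rTensor W (LinearMap.mul' k A) ∘ₗ (TensorProduct.assoc k A A W).symm.toLinearMap

/-- `w ↦ 1 ⊗ w`. -/
noncomputable def oneHead (W : Type u) [AddCommGroup W] [Module k W] :
    W →ₗ[k] A ⊗[k] W :=
  TensorProduct.mk k A W 1

variable (M : Type u) [AddCommGroup M] [Module k M]

/-- `a₀ ⊗ ⋯ ⊗ a_{n+1} ⊗ m ↦ a₀ ⊗ ⋯ ⊗ a_j a_{j+1} ⊗ ⋯ ⊗ a_{n+1} ⊗ m` for `j ≤ n`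
(and zero for `j > n`, a value that is never used). -/
noncomputable def mulAt :
    ∀ n : ℕ, ℕ → (Words k A M (n + 2) →ₗ[k] Words k A M (n + 1))
  | n, 0 => mulHead k A (Words k A M n)
  | 0, _ + 1 => 0
  | n + 1, j + 1 => LinearMap.lTensor A (mulAt n j)

/-- `a₀ ⊗ ⋯ ⊗ a_{n-1} ⊗ m ↦ a₀ ⊗ ⋯ ⊗ a_{j-1} ⊗ 1 ⊗ a_j ⊗ ⋯ ⊗ a_{n-1} ⊗ m` for `j ≤ n`
(and zero for `j > n`, a value that is never used). -/
noncomputable def oneAt :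
    ∀ n : ℕ, ℕ → (Words k A M n →ₗ[k] Words k A M (n + 1))
  | n, 0 => oneHead k A (Words k A M n)
  | 0, _ + 1 => 0
  | n + 1, j + 1 => LinearMap.lTensor A (oneAt n j)

variable {k A M}

section

variable {W W' V V' : Type u} [AddCommGroup W] [Module k W] [AddCommGroup W'] [Module k W']
  [AddCommGroup V] [Module k V] [AddCommGroup V'] [Module k V']

@[simp] lemma mulHead_tmul (a b : A) (w : W) :
    mulHead k A W (a ⊗ₜ (b ⊗ₜ w)) = (a * b) ⊗ₜ w := by
  simp [mulHead]

@[simp] lemma oneHead_apply (w : W) : oneHead k A W w = 1 ⊗ₜ w := rfl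

lemma mulHead_natural (f : W →ₗ[k] W') :
    mulHead k A W' ∘ₗ (f.lTensor A).lTensor A = f.lTensor A ∘ₗ mulHead k A W := by
  ext a b w
  simp

lemma oneHead_natural (f : W →ₗ[k] W') :
    f.lTensor A ∘ₗ oneHead k A W = oneHead k A W' ∘ₗ f := by
  ext w
  simp

lemma mulHead_mulHead :
    mulHead k A W ∘ₗ mulHead k A (A ⊗[k] W) = mulHead k A W ∘ₗ (mulHead k A W).lTensor A := by
  ext a b c w
  simp [mul_assoc]

lemma mulHead_oneHead : mulHead k A W ∘ₗ oneHead k A (A ⊗[k] W) = LinearMap.id := by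
  ext a w
  simp

lemma mulHead_lTensor_oneHead :
    mulHead k A W ∘ₗ (oneHead k A W).lTensor A = LinearMap.id := by
  ext a w
  simp

lemma mulHead_rotStep (ρ : A ⊗[k] W →ₗ[k] V) :
    mulHead k A V ∘ₗ rotStep k (rotStep k ρ) = rotStep k ρ ∘ₗ (mulHead k A W).lTensor A := by
  ext z x y w
  simp [rotStep]

lemma oneHead_rotStep (ρ : A ⊗[k] W →ₗ[k] V) :
    oneHead k A V ∘ₗ ρ = rotStep k ρ ∘ₗ (oneHead k A W).lTensor A := by
  ext z w
  simp [rotStep]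

lemma lTensor_rotStep_mul {f : A ⊗[k] (A ⊗[k] W) →ₗ[k] A ⊗[k] W}
    {ρ : A ⊗[k] W →ₗ[k] A ⊗[k] W}
    (h : f ∘ₗ rotStep k ρ ∘ₗ rotStep k ρ = ρ ∘ₗ mulHead k A W) :
    f.lTensor A ∘ₗ rotStep k (rotStep k ρ) ∘ₗ rotStep k (rotStep k ρ) =
      rotStep k ρ ∘ₗ mulHead k A (A ⊗[k] W) := by
  ext z x y w
  have := LinearMap.congr_fun h (z ⊗ₜ (x ⊗ₜ w))
  simp [rotStep] at this
  simp [rotStep, this]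

lemma lTensor_rotStep_one {f : A ⊗[k] W →ₗ[k] A ⊗[k] (A ⊗[k] W)}
    {ρ : A ⊗[k] W →ₗ[k] A ⊗[k] W}
    (h : f ∘ₗ ρ = rotStep k ρ ∘ₗ rotStep k ρ ∘ₗ (oneHead k A W).lTensor A) :
    f.lTensor A ∘ₗ rotStep k ρ =
      rotStep k (rotStep k ρ) ∘ₗ rotStep k (rotStep k ρ) ∘ₗ
        (oneHead k A (A ⊗[k] W)).lTensor A := by
  ext z x w
  have := LinearMap.congr_fun h (z ⊗ₜ w)
  simp [rotStep] at this
  simp [rotStep, this]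

end

lemma mulAt_zero (n : ℕ) : mulAt k A M n 0 = mulHead k A (Words k A M n) := by
  cases n <;> rfl

lemma oneAt_zero (n : ℕ) : oneAt k A M n 0 = oneHead k A (Words k A M n) := by
  cases n <;> rfl

lemma mulAt_succ (n j : ℕ) :
    mulAt k A M (n + 1) (j + 1) = LinearMap.lTensor A (mulAt k A M n j) := rfl

lemma oneAt_succ (n j : ℕ) :
    oneAt k A M (n + 1) (j + 1) = LinearMap.lTensor A (oneAt k A M n j) := rfl

lemma lTensor_comp_eq {W₁ W₂ W₃ W₄ : Type u} [AddCommGroup W₁] [Module k W₁]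
    [AddCommGroup W₂] [Module k W₂] [AddCommGroup W₃] [Module k W₃] [AddCommGroup W₄] [Module k W₄]
    {f : W₁ →ₗ[k] W₂} {g : W₂ →ₗ[k] W₄} {f' : W₁ →ₗ[k] W₃} {g' : W₃ →ₗ[k] W₄}
    (h : g ∘ₗ f = g' ∘ₗ f') :
    g.lTensor A ∘ₗ f.lTensor A = g'.lTensor A ∘ₗ f'.lTensor A := by
  rw [← LinearMap.lTensor_comp, h, LinearMap.lTensor_comp]

lemma lTensor_comp_id {W₁ W₂ : Type u} [AddCommGroup W₁] [Module k W₁]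
    [AddCommGroup W₂] [Module k W₂] {f : W₁ →ₗ[k] W₂} {g : W₂ →ₗ[k] W₁}
    (h : g ∘ₗ f = LinearMap.id) :
    g.lTensor A ∘ₗ f.lTensor A = LinearMap.id := by
  rw [← LinearMap.lTensor_comp, h, LinearMap.lTensor_id]

lemma mulAt_mulAt (n i j : ℕ) (hij : i ≤ j) (hj : j ≤ n) :
    mulAt k A M n j ∘ₗ mulAt k A M (n + 1) i =
      mulAt k A M n i ∘ₗ mulAt k A M (n + 1) (j + 1) := by
  induction n generalizing i j with
  | zero =>
    obtain rfl : j = 0 := by omega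
    obtain rfl : i = 0 := by omega
    exact mulHead_mulHead
  | succ n ih =>
    cases i with
    | zero =>
      cases j with
      | zero => exact mulHead_mulHead
      | succ j => exact (mulHead_natural (mulAt k A M n j)).symm
    | succ i =>
      obtain ⟨j, rfl⟩ : ∃ j', j = j' + 1 := ⟨j - 1, by omega⟩
      exact lTensor_comp_eq (ih i j (by omega) (by omega))

lemma oneAt_oneAt (n i j : ℕ) (hij : i ≤ j) (hj : j ≤ n) :
    oneAt k A M (n + 1) i ∘ₗ oneAt k A M n j =
      oneAt k A M (n + 1) (j + 1) ∘ₗ oneAt k A M n i := by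
  induction n generalizing i j with
  | zero =>
    obtain rfl : j = 0 := by omega
    obtain rfl : i = 0 := by omega
    exact (oneHead_natural _).symm
  | succ n ih =>
    cases i with
    | zero => exact (oneHead_natural (oneAt k A M (n + 1) j)).symm
    | succ i =>
      obtain ⟨j, rfl⟩ : ∃ j', j = j' + 1 := ⟨j - 1, by omega⟩
      exact lTensor_comp_eq (ih i j (by omega) (by omega))

lemma oneAt_mulAt_le (n i j : ℕ) (hij : i ≤ j) (hj : j ≤ n) :
    oneAt k A M (n + 1) (j + 1) ∘ₗ mulAt k A M n i =
      mulAt k A M (n + 1) i ∘ₗ oneAt k A M (n + 2) (j + 2) := by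
  induction n generalizing i j with
  | zero =>
    obtain rfl : j = 0 := by omega
    obtain rfl : i = 0 := by omega
    exact (mulHead_natural (oneAt k A M 0 0)).symm
  | succ n ih =>
    cases i with
    | zero => exact (mulHead_natural (oneAt k A M (n + 1) j)).symm
    | succ i =>
      obtain ⟨j, rfl⟩ : ∃ j', j = j' + 1 := ⟨j - 1, by omega⟩
      exact lTensor_comp_eq (ih i j (by omega) (by omega))

lemma oneAt_mulAt_gt (n i j : ℕ) (hij : j ≤ i) (hi : i ≤ n) :
    oneAt k A M (n + 1) j ∘ₗ mulAt k A M n i =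
      mulAt k A M (n + 1) (i + 1) ∘ₗ oneAt k A M (n + 2) j := by
  induction n generalizing i j with
  | zero =>
    obtain rfl : i = 0 := by omega
    obtain rfl : j = 0 := by omega
    exact (oneHead_natural _).symm
  | succ n ih =>
    cases j with
    | zero => exact (oneHead_natural (mulAt k A M (n + 1) i)).symm
    | succ j =>
      obtain ⟨i, rfl⟩ : ∃ i', i = i' + 1 := ⟨i - 1, by omega⟩
      exact lTensor_comp_eq (ih i j (by omega) (by omega))

lemma mulAt_oneAt_self (n i : ℕ) (hi : i ≤ n) :
    mulAt k A M n i ∘ₗ oneAt k A M (n + 1) i = LinearMap.id := by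
  induction n generalizing i with
  | zero =>
    obtain rfl : i = 0 := by omega
    exact mulHead_oneHead
  | succ n ih =>
    cases i with
    | zero => exact mulHead_oneHead
    | succ i => exact lTensor_comp_id (ih i (by omega))

lemma mulAt_oneAt_succ (n i : ℕ) (hi : i ≤ n) :
    mulAt k A M n i ∘ₗ oneAt k A M (n + 1) (i + 1) = LinearMap.id := by
  induction n generalizing i with
  | zero =>
    obtain rfl : i = 0 := by omega
    exact mulHead_lTensor_oneHead
  | succ n ih =>
    cases i with
    | zero => exact mulHead_lTensor_oneHead
    | succ i => exact lTensor_comp_id (ih i (by omega))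

/-- The two properties of an endomorphism `R` of `A ⊗ M` which make the rotations compatible with
the multiplication and the unit. -/
structure IsAlgebraTwist (R : A ⊗[k] M →ₗ[k] A ⊗[k] M) : Prop where
  one : R ∘ₗ oneHead k A M = oneHead k A M
  mul : mulHead k A M ∘ₗ rotStep k R ∘ₗ rotStep k R = R ∘ₗ mulHead k A M

variable {R : A ⊗[k] M →ₗ[k] A ⊗[k] M}

lemma mulAt_rot (n j : ℕ) (hj : j < n) :
    mulAt k A M n j ∘ₗ rot k R (n + 1) = rot k R n ∘ₗ mulAt k A M n (j + 1) := by
  obtain ⟨n, rfl⟩ : ∃ n', n = n' + 1 := ⟨n - 1, by omega⟩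
  replace hj : j ≤ n := by omega
  induction n generalizing j with
  | zero =>
    obtain rfl : j = 0 := by omega
    exact mulHead_rotStep R
  | succ n ih =>
    cases j with
    | zero => exact mulHead_rotStep (rot k R (n + 1))
    | succ j => exact lTensor_rotStep (ih j (by omega))

lemma mulAt_rot_last (hR : IsAlgebraTwist R) (n : ℕ) :
    mulAt k A M n n ∘ₗ rot k R (n + 1) ∘ₗ rot k R (n + 1) = rot k R n ∘ₗ mulAt k A M n 0 := by
  induction n with
  | zero => exact hR.mul
  | succ n ih =>
    rw [mulAt_zero] at ih
    exact lTensor_rotStep_mul ih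

lemma oneAt_rot (n j : ℕ) (hj : j ≤ n) :
    oneAt k A M (n + 1) j ∘ₗ rot k R n = rot k R (n + 1) ∘ₗ oneAt k A M (n + 1) (j + 1) := by
  induction n generalizing j with
  | zero =>
    obtain rfl : j = 0 := by omega
    exact oneHead_rotStep R
  | succ n ih =>
    cases j with
    | zero => exact oneHead_rotStep (rot k R (n + 1))
    | succ j => exact lTensor_rotStep (ih j (by omega))

lemma oneAt_rot_last (hR : IsAlgebraTwist R) (n : ℕ) :
    oneAt k A M (n + 1) (n + 1) ∘ₗ rot k R n =
      rot k R (n + 1) ∘ₗ rot k R (n + 1) ∘ₗ oneAt k A M (n + 1) 1 := by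
  induction n with
  | zero =>
    have h : (oneHead k A M).lTensor A ∘ₗ R =
        rotStep k R ∘ₗ rotStep k R ∘ₗ (oneHead k A M).lTensor A := by
      refine TensorProduct.ext' fun z w => ?_
      have h₁ : ∀ x : A ⊗[k] M, rotStep k R (1 ⊗ₜ x) = (oneHead k A M).lTensor A x := by
        intro x
        induction x with
        | zero => simp
        | add x y hx hy => rw [TensorProduct.tmul_add, map_add, map_add, hx, hy]
        | tmul a m =>
          have := LinearMap.congr_fun hR.one m
          simp at this
          simp [rotStep, this]
      simp only [LinearMap.comp_apply, LinearMap.lTensor_tmul]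
      rw [← h₁]
      simp [rotStep]
    exact h
  | succ n ih =>
    have e : oneAt k A M (n + 1) 1 = (oneHead k A (Words k A M n)).lTensor A :=
      congrArg (LinearMap.lTensor A) (oneAt_zero n)
    rw [e] at ih
    exact lTensor_rotStep_one ih

lemma mulAt_rot_oneAt (n : ℕ) :
    mulAt k A M n 0 ∘ₗ rot k R (n + 1) ∘ₗ oneAt k A M (n + 1) 1 = rot k R n := by
  have key : ∀ {W : Type u} [AddCommGroup W] [Module k W] (ρ : A ⊗[k] W →ₗ[k] A ⊗[k] W),
      mulHead k A W ∘ₗ rotStep k ρ ∘ₗ (oneHead k A W).lTensor A = ρ := by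
    intro W _ _ ρ
    rw [← oneHead_rotStep, ← LinearMap.comp_assoc, mulHead_oneHead, LinearMap.id_comp]
  cases n with
  | zero => exact key R
  | succ n => exact key (rot k R (n + 1))

end AlgebraOperators

/-! ### Hopf module structures -/

section HopfStructures

variable (k : Type u) [Field k] (H : Type u) [Ring H] [HopfAlgebra k H]

/-- The action of a `k`-algebra `H` on an `H`-module `Z`, as a `k`-bilinear map. -/
noncomputable def smulMap (Z : Type u) [AddCommGroup Z] [Module k Z] [Module H Z]
    [IsScalarTower k H Z] : H →ₗ[k] Z →ₗ[k] Z :=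
  (Algebra.lsmul k k Z).toLinearMap

/-- A left `H`-comodule structure on a `k`-module `M`, written `m ↦ m₍₋₁₎ ⊗ m₍₀₎`. -/
class LeftComodule (M : Type u) [AddCommGroup M] [Module k M] where
  coact : M →ₗ[k] H ⊗[k] M
  coassoc : coact.lTensor H ∘ₗ coact =
    (TensorProduct.assoc k H H M).toLinearMap ∘ₗ Coalgebra.comul.rTensor M ∘ₗ coact
  counit : (TensorProduct.lid k M).toLinearMap ∘ₗ Coalgebra.counit.rTensor M ∘ₗ coact =
    LinearMap.id

/-- `A` is an `H`-module algebra: `h(a b) = h₍₁₎(a) h₍₂₎(b)` and `h(1) = ε(h) 1`. -/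
class IsModuleAlgebra (A : Type u) [Ring A] [Algebra k A] [Module H A]
    [IsScalarTower k H A] : Prop where
  smul_mul : ∀ (h : H) (a b : A), h • (a * b) =
    LinearMap.mul' k A (TensorProduct.map ((smulMap k H A).flip a) ((smulMap k H A).flip b)
      (Coalgebra.comul h))
  smul_one : ∀ h : H, h • (1 : A) = Coalgebra.counit (R := k) h • (1 : A)

/-- `C` is an `H`-module coalgebra: `Δ(h(c)) = h₍₁₎(c₍₁₎) ⊗ h₍₂₎(c₍₂₎)` and `ε(h(c)) = ε(h) ε(c)`. -/
class IsModuleCoalgebra (C : Type u) [AddCommGroup C] [Module k C] [Coalgebra k C] [Module H C]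
    [IsScalarTower k H C] : Prop where
  comul_smul : ∀ (h : H) (c : C), Coalgebra.comul (R := k) (h • c) =
    TensorProduct.map₂ (smulMap k H C) (smulMap k H C) (Coalgebra.comul h) (Coalgebra.comul c)
  counit_smul : ∀ (h : H) (c : C), Coalgebra.counit (R := k) (h • c) =
    Coalgebra.counit (R := k) h * Coalgebra.counit (R := k) c

/-- `act : C ⊗ A → A`, written `c ▷ a`, is an `H`-equivariant action of the coalgebra `C` on the
algebra `A`: `c ▷ (a b) = (c₍₁₎ ▷ a) (c₍₂₎ ▷ b)`, `c ▷ 1 = ε(c) 1` and `h(c ▷ a) = h(c) ▷ a`. -/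
structure IsEquivariantAction {A C : Type u} [Ring A] [Algebra k A] [Module H A]
    [AddCommGroup C] [Module k C] [Coalgebra k C] [Module H C]
    (act : C →ₗ[k] A →ₗ[k] A) : Prop where
  act_mul : ∀ (c : C) (a b : A), act c (a * b) =
    LinearMap.mul' k A (TensorProduct.map (act.flip a) (act.flip b) (Coalgebra.comul c))
  act_one : ∀ c : C, act c 1 = Coalgebra.counit (R := k) c • (1 : A)
  equivariant : ∀ (h : H) (c : C) (a : A), h • act c a = act (h • c) a

variable (Z M : Type u) [AddCommGroup Z] [Module k Z] [Module H Z] [IsScalarTower k H Z]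
  [AddCommGroup M] [Module k M]

/-- The diagonal action of `H` on `Z ⊗ ⋯ ⊗ Z ⊗ M`:
`h(z₀ ⊗ ⋯ ⊗ z_{n-1} ⊗ m) = h₍₁₎ z₀ ⊗ ⋯ ⊗ h₍ₙ₎ z_{n-1} ⊗ h₍ₙ₊₁₎ m`. -/
noncomputable def diagAct [Module H M] [IsScalarTower k H M] :
    ∀ n : ℕ, H →ₗ[k] Words k Z M n →ₗ[k] Words k Z M n
  | 0 => smulMap k H M
  | n + 1 => TensorProduct.map₂ (smulMap k H Z) (diagAct n) ∘ₗ Coalgebra.comul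

variable [LeftComodule k H M]

/-- `z ⊗ m ↦ m₍₋₁₎ z ⊗ m₍₀₎`. -/
noncomputable def coactTwist : Z ⊗[k] M →ₗ[k] Z ⊗[k] M :=
  LinearMap.rTensor M (TensorProduct.lift (smulMap k H Z)) ∘ₗ
    (TensorProduct.assoc k H Z M).symm.toLinearMap ∘ₗ
    (TensorProduct.leftComm k Z H M).toLinearMap ∘ₗ
    LinearMap.lTensor Z (LeftComodule.coact (k := k) (H := H))

variable {k H Z M}

lemma coactTwist_tmul (z : Z) (m : M) :
    coactTwist k H Z M (z ⊗ₜ m) =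
      ((smulMap k H Z).flip z).rTensor M (LeftComodule.coact (k := k) (H := H) m) := by
  simp only [coactTwist, LinearMap.comp_apply, LinearMap.lTensor_tmul]
  generalize (LeftComodule.coact (k := k) (H := H) m) = t
  induction t with
  | zero => simp
  | add x y hx hy => simp only [TensorProduct.tmul_add, map_add, hx, hy]
  | tmul h m => simp

lemma lid_counit_coact (m : M) : TensorProduct.lid k M (Coalgebra.counit.rTensor M
    (LeftComodule.coact (k := k) (H := H) m)) = m :=
  LinearMap.congr_fun (LeftComodule.counit (k := k) (H := H)) m

lemma assoc_symm_coact (m : M) : (TensorProduct.assoc k H H M).symm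
    ((LeftComodule.coact (k := k) (H := H)).lTensor H (LeftComodule.coact (k := k) (H := H) m)) =
      Coalgebra.comul.rTensor M (LeftComodule.coact (k := k) (H := H) m) := by
  rw [LinearEquiv.symm_apply_eq]
  exact LinearMap.congr_fun (LeftComodule.coassoc (k := k) (H := H)) m

lemma isCoalgebraTwist_coactTwist {C : Type u} [AddCommGroup C] [Module k C] [Coalgebra k C]
    [Module H C] [IsScalarTower k H C] [IsModuleCoalgebra k H C] :
    IsCoalgebraTwist (coactTwist k H C M) where
  counit := by
    refine TensorProduct.ext' fun z m => ?_
    have h : ∀ t : H ⊗[k] M, dropHead k C M (((smulMap k H C).flip z).rTensor M t) =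
        Coalgebra.counit (R := k) z • TensorProduct.lid k M (Coalgebra.counit.rTensor M t) := by
      intro t
      induction t with
      | zero => simp
      | add x y hx hy => simp only [map_add, hx, hy, smul_add]
      | tmul h m =>
        simp [smulMap, IsModuleCoalgebra.counit_smul, smul_smul, mul_comm]
    rw [LinearMap.comp_apply, coactTwist_tmul, h, lid_counit_coact, dropHead_tmul]
  comul := by
    refine TensorProduct.ext' fun z m => ?_
    let L : C ⊗[k] C → ((H ⊗[k] H) ⊗[k] M →ₗ[k] C ⊗[k] (C ⊗[k] M)) := fun x =>
      (TensorProduct.assoc k C C M).toLinearMap ∘ₗ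
        ((TensorProduct.map₂ (smulMap k H C) (smulMap k H C)).flip x).rTensor M
    have hL : ∀ x y t, L (x + y) t = L x t + L y t := by
      intro x y t
      simp [L, LinearMap.rTensor_add]
    have h₁ : ∀ t : H ⊗[k] M, splitHead k C M (((smulMap k H C).flip z).rTensor M t) =
        L (Coalgebra.comul z) (Coalgebra.comul.rTensor M t) := by
      intro t
      induction t with
      | zero => simp
      | add x y hx hy => simp only [map_add, hx, hy]
      | tmul h m => simp [L, splitHead, smulMap, IsModuleCoalgebra.comul_smul]
    have h₂ : ∀ x : C ⊗[k] C,
        rotStep k (coactTwist k H C M) (rotStep k (coactTwist k H C M)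
          (TensorProduct.assoc k C C M (x ⊗ₜ m))) =
        L x ((TensorProduct.assoc k H H M).symm
          ((LeftComodule.coact (k := k) (H := H)).lTensor H
            (LeftComodule.coact (k := k) (H := H) m))) := by
      intro x
      induction x with
      | zero => simp [L]
      | add x y hx hy => rw [TensorProduct.add_tmul, map_add, map_add, map_add, hx, hy, hL]
      | tmul a b =>
        have e : rotStep k (coactTwist k H C M)
            (TensorProduct.assoc k C C M ((a ⊗ₜ[k] b) ⊗ₜ m)) =
            b ⊗ₜ coactTwist k H C M (a ⊗ₜ m) := by simp [rotStep]
        rw [e, coactTwist_tmul]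
        generalize (LeftComodule.coact (k := k) (H := H) m) = t
        induction t with
        | zero => simp
        | add x y hx hy => simp only [TensorProduct.tmul_add, map_add, hx, hy]
        | tmul h m =>
          have e' : rotStep k (coactTwist k H C M)
              (b ⊗ₜ ((smulMap k H C).flip a).rTensor M (h ⊗ₜ m)) =
              (h • a) ⊗ₜ coactTwist k H C M (b ⊗ₜ m) := by simp [rotStep, smulMap]
          rw [e', coactTwist_tmul, LinearMap.lTensor_tmul]
          generalize (LeftComodule.coact (k := k) (H := H) m) = s
          induction s with
          | zero => simp
          | add x y hx hy => simp only [TensorProduct.tmul_add, map_add, hx, hy]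
          | tmul h' m => simp [L, smulMap]
    have h₃ : splitHead k C M (z ⊗ₜ m) =
        TensorProduct.assoc k C C M (Coalgebra.comul z ⊗ₜ m) := by simp [splitHead]
    simp only [LinearMap.comp_apply]
    rw [h₃, h₂, assoc_symm_coact, ← h₁, coactTwist_tmul]

lemma isAlgebraTwist_coactTwist {A : Type u} [Ring A] [Algebra k A]
    [Module H A] [IsScalarTower k H A] [IsModuleAlgebra k H A] :
    IsAlgebraTwist (coactTwist k H A M) where
  one := by
    refine LinearMap.ext fun m => ?_
    have h : ∀ t : H ⊗[k] M, ((smulMap k H A).flip 1).rTensor M t =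
        1 ⊗ₜ TensorProduct.lid k M (Coalgebra.counit.rTensor M t) := by
      intro t
      induction t with
      | zero => simp
      | add x y hx hy => simp only [map_add, hx, hy, TensorProduct.tmul_add]
      | tmul h m => simp [smulMap, IsModuleAlgebra.smul_one (k := k), TensorProduct.smul_tmul']
    rw [LinearMap.comp_apply, oneHead_apply, coactTwist_tmul, h, lid_counit_coact]
  mul := by
    refine TensorProduct.ext' fun a y => ?_
    induction y with
    | zero => simp
    | add x y hx hy => simp only [TensorProduct.tmul_add, map_add, hx, hy]
    | tmul b m =>
      let L : (H ⊗[k] H) ⊗[k] M →ₗ[k] A ⊗[k] M :=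
        (LinearMap.mul' k A ∘ₗ
          TensorProduct.map ((smulMap k H A).flip a) ((smulMap k H A).flip b)).rTensor M
      have h₁ : ∀ t : H ⊗[k] M, ((smulMap k H A).flip (a * b)).rTensor M t =
          L (Coalgebra.comul.rTensor M t) := by
        intro t
        induction t with
        | zero => simp
        | add x y hx hy => simp only [map_add, hx, hy]
        | tmul h m => simp [L, smulMap, IsModuleAlgebra.smul_mul (k := k)]
      have h₂ : mulHead k A M (rotStep k (coactTwist k H A M) (rotStep k (coactTwist k H A M)
            (a ⊗ₜ (b ⊗ₜ m)))) =
          L ((TensorProduct.assoc k H H M).symm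
            ((LeftComodule.coact (k := k) (H := H)).lTensor H
              (LeftComodule.coact (k := k) (H := H) m))) := by
        have e : rotStep k (coactTwist k H A M) (a ⊗ₜ (b ⊗ₜ m)) =
            b ⊗ₜ coactTwist k H A M (a ⊗ₜ m) := by simp [rotStep]
        rw [e, coactTwist_tmul]
        generalize (LeftComodule.coact (k := k) (H := H) m) = t
        induction t with
        | zero => simp
        | add x y hx hy => simp only [TensorProduct.tmul_add, map_add, hx, hy]
        | tmul h m =>
          have e' : rotStep k (coactTwist k H A M)
              (b ⊗ₜ ((smulMap k H A).flip a).rTensor M (h ⊗ₜ m)) =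
              (h • a) ⊗ₜ coactTwist k H A M (b ⊗ₜ m) := by simp [rotStep, smulMap]
          rw [e', coactTwist_tmul, LinearMap.lTensor_tmul]
          generalize (LeftComodule.coact (k := k) (H := H) m) = s
          induction s with
          | zero => simp
          | add x y hx hy => simp only [TensorProduct.tmul_add, map_add, hx, hy]
          | tmul h' m => simp [L, smulMap]
      simp only [LinearMap.comp_apply]
      rw [h₂, assoc_symm_coact, ← h₁, mulHead_tmul, coactTwist_tmul]

end HopfStructures

/-! ### The largest quotient in which a given set of relations holds -/

/-- A sequence of `k`-modules with operators raising and lowering the degree and an endomorphism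
in each degree, together with elements of each of the modules which are to be made zero. -/
structure OperatorModule (k : Type u) [Field k] where
  X : ℕ → ModuleCat.{u} k
  up : ∀ n : ℕ, ℕ → (X n →ₗ[k] X (n + 1))
  down : ∀ n : ℕ, ℕ → (X (n + 1) →ₗ[k] X n)
  t : ∀ n : ℕ, X n →ₗ[k] X n
  rel : ∀ n : ℕ, Set (X n)

namespace OperatorModule

variable {k : Type u} [Field k] (P : OperatorModule k)

/-- A family of submodules which contains the relations and is stable under all operators. -/
structure IsAdmissible (K : ∀ n, Submodule k (P.X n)) : Prop where
  rel : ∀ n, ∀ x ∈ P.rel n, x ∈ K n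
  t : ∀ n, ∀ x ∈ K n, P.t n x ∈ K n
  up : ∀ n j, ∀ x ∈ K n, P.up n j x ∈ K (n + 1)
  down : ∀ n j, ∀ x ∈ K (n + 1), P.down n j x ∈ K n

/-- The smallest family of submodules which contains the relations and is stable under all
operators. -/
noncomputable def ker (n : ℕ) : Submodule k (P.X n) :=
  ⨅ (K : ∀ n, Submodule k (P.X n)) (_ : P.IsAdmissible K), K n

lemma mem_ker {n : ℕ} {x : P.X n} : x ∈ P.ker n ↔ ∀ K, P.IsAdmissible K → x ∈ K n := by
  simp [ker, Submodule.mem_iInf]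

lemma isAdmissible_ker : P.IsAdmissible P.ker where
  rel n x hx := P.mem_ker.2 fun _ hK => hK.rel n x hx
  t n x hx := P.mem_ker.2 fun K hK => hK.t n x (P.mem_ker.1 hx K hK)
  up n j x hx := P.mem_ker.2 fun K hK => hK.up n j x (P.mem_ker.1 hx K hK)
  down n j x hx := P.mem_ker.2 fun K hK => hK.down n j x (P.mem_ker.1 hx K hK)

/-- The largest quotient on which the operators are defined and the relations hold. -/
noncomputable def quo (n : ℕ) : ModuleCat.{u} k := ModuleCat.of k (P.X n ⧸ P.ker n)

/-- The class of an element in the quotient. -/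
noncomputable def cls (n : ℕ) : P.X n →ₗ[k] P.quo n := (P.ker n).mkQ

/-- The endomorphism induced on the quotient. -/
noncomputable def quoT (n : ℕ) : P.quo n ⟶ P.quo n :=
  ModuleCat.ofHom ((P.ker n).mapQ (P.ker n) (P.t n) (P.isAdmissible_ker.t n))

/-- The raising operators induced on the quotient. -/
noncomputable def quoUp (n j : ℕ) : P.quo n ⟶ P.quo (n + 1) :=
  ModuleCat.ofHom ((P.ker n).mapQ (P.ker (n + 1)) (P.up n j) (P.isAdmissible_ker.up n j))

/-- The lowering operators induced on the quotient. -/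
noncomputable def quoDown (n j : ℕ) : P.quo (n + 1) ⟶ P.quo n :=
  ModuleCat.ofHom ((P.ker (n + 1)).mapQ (P.ker n) (P.down n j) (P.isAdmissible_ker.down n j))

lemma quo_ext {n : ℕ} {Y : ModuleCat.{u} k} {f g : P.quo n ⟶ Y}
    (h : ∀ x, f.hom (P.cls n x) = g.hom (P.cls n x)) : f = g :=
  ModuleCat.hom_ext (LinearMap.ext fun x => by
    obtain ⟨x, rfl⟩ := Submodule.mkQ_surjective _ x
    exact h x)

@[simp] lemma quoT_cls (n : ℕ) (x : P.X n) : (P.quoT n).hom (P.cls n x) = P.cls n (P.t n x) := rfl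

@[simp] lemma quoUp_cls (n j : ℕ) (x : P.X n) :
    (P.quoUp n j).hom (P.cls n x) = P.cls (n + 1) (P.up n j x) := rfl

@[simp] lemma quoDown_cls (n j : ℕ) (x : P.X (n + 1)) :
    (P.quoDown n j).hom (P.cls (n + 1) x) = P.cls n (P.down n j x) := rfl

lemma endoIter_hom {X : ModuleCat.{u} k} (f : X →ₗ[k] X) (m : ℕ) :
    (endoIter (ModuleCat.ofHom f) m).hom = f ^ m := by
  induction m with
  | zero => rfl
  | succ m ih => rw [endoIter, ModuleCat.hom_comp, ih, pow_succ']; rfl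

lemma endoIter_quoT_cls (n m : ℕ) (x : P.X n) :
    (endoIter (P.quoT n) m).hom (P.cls n x) = P.cls n ((P.t n ^ m) x) := by
  induction m with
  | zero => rfl
  | succ m ih =>
    rw [endoIter, ModuleCat.hom_comp, LinearMap.comp_apply, ih, quoT_cls, pow_succ']
    rfl

lemma endoIter_quoT {n : ℕ}
    (h : ∀ x, (P.t n ^ (n + 1)) x - x ∈ P.rel n) : endoIter (P.quoT n) (n + 1) = 𝟙 _ := by
  refine P.quo_ext fun x => ?_
  rw [endoIter_quoT_cls, ← sub_eq_zero, ModuleCat.hom_id, LinearMap.id_apply, ← map_sub]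
  exact (Submodule.Quotient.mk_eq_zero _).2 (P.isAdmissible_ker.rel n _ (h x))

end OperatorModule

section Endo

variable {D : Type u} [Category.{v} D]

lemma endoIter_succ' {X : D} (f : X ⟶ X) (m : ℕ) : endoIter f (m + 1) = f ≫ endoIter f m := by
  induction m with
  | zero => simp [endoIter]
  | succ m ih => exact (congrArg (fun g => g ≫ f) ih).trans (Category.assoc _ _ _)

lemma endoIter_eq_pow {X : D} (f : X ⟶ X) (m : ℕ) : endoIter f m = (End.of f ^ m).asHom := by
  induction m with
  | zero => rfl
  | succ m ih => rw [endoIter, ih, pow_succ']; rfl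

lemma endoIter_endoIter {X : D} (f : X ⟶ X) (n : ℕ) (h : endoIter f (n + 1) = 𝟙 X) :
    endoIter (endoIter f n) (n + 1) = 𝟙 X := by
  have h' : End.of f ^ (n + 1) = 1 := (endoIter_eq_pow f (n + 1)).symm.trans h
  have e : End.of (endoIter f n) = End.of f ^ n := endoIter_eq_pow f n
  rw [endoIter_eq_pow, e, ← pow_mul, mul_comm, pow_mul, h', one_pow]
  rfl

lemma endoIter_comp_self {X : D} (f : X ⟶ X) (n : ℕ) (h : endoIter f (n + 1) = 𝟙 X) :
    endoIter f n ≫ f = 𝟙 X := h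

lemma self_comp_endoIter {X : D} (f : X ⟶ X) (n : ℕ) (h : endoIter f (n + 1) = 𝟙 X) :
    f ≫ endoIter f n = 𝟙 X := by
  rw [← endoIter_succ', h]

lemma endoIter_op {X : D} (f : X ⟶ X) (m : ℕ) : endoIter f.op m = (endoIter f m).op := by
  induction m with
  | zero => rfl
  | succ m ih => rw [endoIter, ih, endoIter_succ', op_comp]

/-- Cocyclic data from relations for the inverse `t` of the cyclic operator. -/
@[simps] def CocyclicData.ofInverse (X : ℕ → D) (δ : ∀ n : ℕ, ℕ → (X n ⟶ X (n + 1)))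
    (σ : ∀ n : ℕ, ℕ → (X (n + 1) ⟶ X n)) (t : ∀ n : ℕ, X n ⟶ X n)
    (δδ : ∀ n i j, i ≤ j → j ≤ n → δ n j ≫ δ (n + 1) i = δ n i ≫ δ (n + 1) (j + 1))
    (σσ : ∀ n i j, i ≤ j → j ≤ n → σ (n + 1) i ≫ σ n j = σ (n + 1) (j + 1) ≫ σ n i)
    (σδ_le : ∀ n i j, i ≤ j → j ≤ n → σ n j ≫ δ n i = δ (n + 1) i ≫ σ (n + 1) (j + 1))
    (σδ_gt : ∀ n i j, j < i → i ≤ n → σ n j ≫ δ n i = δ (n + 1) (i + 1) ≫ σ (n + 1) j)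
    (δσ_self : ∀ n i, i ≤ n → δ n i ≫ σ n i = 𝟙 _)
    (δσ_succ : ∀ n i, i < n → δ n (i + 1) ≫ σ n i = 𝟙 _)
    (δtσ : ∀ n, δ n 0 ≫ t (n + 1) ≫ σ n 0 = t n)
    (t_pow : ∀ n, endoIter (t n) (n + 1) = 𝟙 _)
    (tδ : ∀ n j, j < n → δ n j ≫ t (n + 1) = t n ≫ δ n (j + 1))
    (tδ_last : ∀ n, δ n n ≫ t (n + 1) ≫ t (n + 1) = t n ≫ δ n 0)
    (tσ : ∀ n j, j < n → σ n j ≫ t n = t (n + 1) ≫ σ n (j + 1))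
    (tσ_last : ∀ n, σ n n ≫ t n = t (n + 1) ≫ t (n + 1) ≫ σ n 0) : CocyclicData D where
  X := X
  δ := δ
  σ := σ
  τ n := endoIter (t n) n
  δδ := δδ
  σσ := σσ
  σδ_le := σδ_le
  σδ_gt := σδ_gt
  δσ_self := δσ_self
  δσ_succ := δσ_succ
  τ_pow n := endoIter_endoIter _ _ (t_pow n)
  δτσ n := by
    have h₁ := endoIter_comp_self _ _ (t_pow (n + 1))
    have h₂ := self_comp_endoIter _ _ (t_pow n)
    have h₃ := self_comp_endoIter _ _ (t_pow (n + 1))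
    have e : σ n n = t (n + 1) ≫ t (n + 1) ≫ σ n 0 ≫ endoIter (t n) n := by
      rw [← Category.comp_id (σ n n), ← h₂, ← Category.assoc, tσ_last]
      simp
    rw [e, reassoc_of% h₁]
    have := δtσ n
    rw [reassoc_of% this, h₂]
  τδ n j hj := by
    have h₁ := endoIter_comp_self _ _ (t_pow n)
    have h₃ := self_comp_endoIter _ _ (t_pow (n + 1))
    rw [← Category.comp_id (δ n j), ← h₃, reassoc_of% (tδ n j hj), reassoc_of% h₁]
  τδ_last n := by
    have h₁ := endoIter_comp_self _ _ (t_pow n)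
    have h₃ := self_comp_endoIter _ _ (t_pow (n + 1))
    have e : δ n n = t n ≫ δ n 0 ≫ endoIter (t (n + 1)) (n + 1) ≫
        endoIter (t (n + 1)) (n + 1) := by
      rw [← reassoc_of% (tδ_last n), reassoc_of% h₃, h₃, Category.comp_id]
    rw [e, reassoc_of% h₁]
  τσ n j hj := by
    have h₁ := endoIter_comp_self _ _ (t_pow (n + 1))
    have h₃ := self_comp_endoIter _ _ (t_pow n)
    rw [← Category.comp_id (σ n j), ← h₃, reassoc_of% (tσ n j hj), reassoc_of% h₁]
  τσ_last n := by
    have h₁ := endoIter_comp_self _ _ (t_pow (n + 1))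
    have h₃ := self_comp_endoIter _ _ (t_pow n)
    rw [← Category.comp_id (σ n n), ← h₃, reassoc_of% (tσ_last n), reassoc_of% h₁,
      reassoc_of% h₁]

end Endo

/-! ### The cocyclic and cyclic modules -/

section CyclicObjects

variable (k : Type u) [Field k] (H : Type u) [Ring H] [HopfAlgebra k H]

/-- The relations which make the Hopf algebra act through its counit and the rotation of `n + 1`
factors have order dividing `n + 1`. -/
def hopfRel (Z M : Type u) [AddCommGroup Z] [Module k Z] [Module H Z] [IsScalarTower k H Z]
    [AddCommGroup M] [Module k M] [Module H M] [IsScalarTower k H M] [LeftComodule k H M]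
    (n : ℕ) : Set (Words k Z M (n + 1)) :=
  {y | (∃ (h : H) (x : Words k Z M (n + 1)),
      y = diagAct k H Z M (n + 1) h x - Coalgebra.counit (R := k) h • x) ∨
    ∃ x, y = (rot k (coactTwist k H Z M) n ^ (n + 1)) x - x}

section Coalgebra

variable (C M : Type u) [AddCommGroup C] [Module k C] [Coalgebra k C] [Module H C]
  [IsScalarTower k H C]
  [AddCommGroup M] [Module k M] [Module H M] [IsScalarTower k H M] [LeftComodule k H M]

/-- The spaces `C^{⊗ (n+1)} ⊗ M` of an `H`-module coalgebra `C` with coefficients in an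
`H`-module/comodule `M`: the raising operators split a factor by the comultiplication, the lowering
operators apply the counit to one of the factors `1, …, n`, the endomorphism is
`c₀ ⊗ ⋯ ⊗ c_n ⊗ m ↦ c₁ ⊗ ⋯ ⊗ c_n ⊗ m₍₋₁₎(c₀) ⊗ m₍₀₎`. -/
noncomputable def coalgebraOperators : OperatorModule k where
  X n := Words k C M (n + 1)
  up n j := splitAt k C M n j
  down n j := dropAt k C M (n + 1) (j + 1)
  t n := rot k (coactTwist k H C M) n
  rel n := hopfRel k H C M n

variable [IsModuleCoalgebra k H C]

/-- The cocyclic structure on the largest quotient of `C^{⊗ (n+1)} ⊗ M`, `n ≥ 0`, which is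
cocyclic and on which `H` acts through its counit. -/
noncomputable def hopfCocyclicData : CocyclicData (ModuleCat.{u} k) where
  X := (coalgebraOperators k H C M).quo
  δ := (coalgebraOperators k H C M).quoUp
  σ := (coalgebraOperators k H C M).quoDown
  τ := (coalgebraOperators k H C M).quoT
  δδ n i j hij hj := OperatorModule.quo_ext _ fun x =>
    congrArg (OperatorModule.cls _ _) (LinearMap.congr_fun (splitAt_splitAt n i j hij hj) x)
  σσ n i j hij hj := OperatorModule.quo_ext _ fun x =>
    congrArg (OperatorModule.cls _ _)
      (LinearMap.congr_fun (dropAt_dropAt (n + 1) (i + 1) (j + 1) (by omega) (by omega)) x)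
  σδ_le n i j hij hj := OperatorModule.quo_ext _ fun x =>
    congrArg (OperatorModule.cls _ _)
      (LinearMap.congr_fun (dropAt_splitAt_le n i j hij hj) x)
  σδ_gt n i j hij hi := OperatorModule.quo_ext _ fun x =>
    congrArg (OperatorModule.cls _ _)
      (LinearMap.congr_fun (dropAt_splitAt_gt n i (j + 1) (by omega) hi) x)
  δσ_self n i hi := OperatorModule.quo_ext _ fun x =>
    congrArg (OperatorModule.cls _ _) (LinearMap.congr_fun (dropAt_succ_splitAt n i hi) x)
  δσ_succ n i hi := OperatorModule.quo_ext _ fun x =>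
    congrArg (OperatorModule.cls _ _)
      (LinearMap.congr_fun (dropAt_splitAt_self n (i + 1) (by omega)) x)
  δτσ n := OperatorModule.quo_ext _ fun x =>
    congrArg (OperatorModule.cls _ _)
      ((LinearMap.congr_fun (dropAt_rot_last isCoalgebraTwist_coactTwist (n + 1)) _).trans
        (LinearMap.congr_fun (dropAt_splitAt_self n 0 (by omega)) x))
  τ_pow n := OperatorModule.endoIter_quoT _ fun x => Or.inr ⟨x, rfl⟩
  τδ n j hj := OperatorModule.quo_ext _ fun x =>
    congrArg (OperatorModule.cls _ _) (LinearMap.congr_fun (splitAt_rot n j hj) x)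
  τδ_last n := OperatorModule.quo_ext _ fun x =>
    congrArg (OperatorModule.cls _ _)
      (LinearMap.congr_fun (splitAt_rot_last isCoalgebraTwist_coactTwist n) x)
  τσ n j hj := OperatorModule.quo_ext _ fun x =>
    congrArg (OperatorModule.cls _ _)
      (LinearMap.congr_fun (dropAt_rot n (j + 1) (by omega)) x)
  τσ_last n := OperatorModule.quo_ext _ fun x =>
    congrArg (OperatorModule.cls _ _)
      ((LinearMap.congr_fun (dropAt_rot_last isCoalgebraTwist_coactTwist (n + 1)) _).trans
        (LinearMap.congr_fun (dropAt_rot n 0 (by omega)) x))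

/-- The cocyclic module `C_•(C, M)` of an `H`-module coalgebra `C` with coefficients in an arbitrary
`H`-module/comodule `M`. -/
noncomputable def hopfCocyclic : Lam ⥤ ModuleCat.{u} k := (hopfCocyclicData k H C M).toFunctor

variable {C M} in
/-- The class of `c₀ ⊗ ⋯ ⊗ c_n ⊗ m` in `C_n(C, M)`. -/
noncomputable def hopfCocyclicMk (n : ℕ) (c : Fin (n + 1) → C) (m : M) :
    (hopfCocyclic k H C M).obj (Lam.mk n) :=
  (coalgebraOperators k H C M).cls n (word k (n + 1) c m)

end Coalgebra

section Algebra

variable (A M : Type u) [Ring A] [Algebra k A] [Module H A] [IsScalarTower k H A]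
  [AddCommGroup M] [Module k M] [Module H M] [IsScalarTower k H M] [LeftComodule k H M]

/-- The spaces `A^{⊗ (n+1)} ⊗ M` of an `H`-module algebra `A` with coefficients in an
`H`-module/comodule `M`: the lowering operators multiply two neighbouring factors, the raising
operators insert `1` after a factor, the endomorphism is
`a₀ ⊗ ⋯ ⊗ a_n ⊗ m ↦ a₁ ⊗ ⋯ ⊗ a_n ⊗ m₍₋₁₎(a₀) ⊗ m₍₀₎`. (If the antipode `S` is bijective, the
inverse of the endomorphism is
`a₀ ⊗ ⋯ ⊗ a_n ⊗ m ↦ S⁻¹(m₍₋₁₎)(a_n) ⊗ a₀ ⊗ ⋯ ⊗ a_{n-1} ⊗ m₍₀₎`, the usual cyclic operator.) -/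
noncomputable def algebraOperators : OperatorModule k where
  X n := Words k A M (n + 1)
  up n j := oneAt k A M (n + 1) (j + 1)
  down n j := mulAt k A M n j
  t n := rot k (coactTwist k H A M) n
  rel n := hopfRel k H A M n

variable [IsModuleAlgebra k H A]

lemma quo_op_ext {P : OperatorModule k} {n : ℕ} {Y : ModuleCat.{u} k} {f g : P.quo n ⟶ Y}
    (h : ∀ x, f.hom (P.cls n x) = g.hom (P.cls n x)) : f.op = g.op :=
  congrArg Quiver.Hom.op (P.quo_ext h)

/-- The cyclic structure on the largest quotient of `A^{⊗ (n+1)} ⊗ M`, `n ≥ 0`, which is cyclic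
and on which `H` acts through its counit. The cyclic operator is the inverse of the endomorphism
of `algebraOperators`, the last face is the first face applied after the cyclic operator. -/
noncomputable def hopfCyclicData : CocyclicData (ModuleCat.{u} k)ᵒᵖ :=
  CocyclicData.ofInverse
    (fun n => op ((algebraOperators k H A M).quo n))
    (fun n j => ((algebraOperators k H A M).quoDown n j).op)
    (fun n j => ((algebraOperators k H A M).quoUp n j).op)
    (fun n => ((algebraOperators k H A M).quoT n).op)
    (fun n i j hij hj => quo_op_ext k fun x =>
      congrArg (OperatorModule.cls _ _) (LinearMap.congr_fun (mulAt_mulAt n i j hij hj) x))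
    (fun n i j hij hj => quo_op_ext k fun x =>
      congrArg (OperatorModule.cls _ _)
        (LinearMap.congr_fun (oneAt_oneAt (n + 1) (i + 1) (j + 1) (by omega) (by omega)) x))
    (fun n i j hij hj => quo_op_ext k fun x =>
      congrArg (OperatorModule.cls _ _) (LinearMap.congr_fun (oneAt_mulAt_le n i j hij hj) x))
    (fun n i j hij hi => quo_op_ext k fun x =>
      congrArg (OperatorModule.cls _ _)
        (LinearMap.congr_fun (oneAt_mulAt_gt n i (j + 1) (by omega) hi) x))
    (fun n i hi => quo_op_ext k fun x =>
      congrArg (OperatorModule.cls _ _) (LinearMap.congr_fun (mulAt_oneAt_succ n i hi) x))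
    (fun n i hi => quo_op_ext k fun x =>
      congrArg (OperatorModule.cls _ _)
        (LinearMap.congr_fun (mulAt_oneAt_self n (i + 1) (by omega)) x))
    (fun n => quo_op_ext k fun x =>
      congrArg (OperatorModule.cls _ _) (LinearMap.congr_fun (mulAt_rot_oneAt n) x))
    (fun n => by
      rw [endoIter_op, OperatorModule.endoIter_quoT _ fun x => Or.inr ⟨x, rfl⟩]
      rfl)
    (fun n j hj => quo_op_ext k fun x =>
      congrArg (OperatorModule.cls _ _) (LinearMap.congr_fun (mulAt_rot n j hj) x))
    (fun n => quo_op_ext k fun x =>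
      congrArg (OperatorModule.cls _ _)
        (LinearMap.congr_fun (mulAt_rot_last isAlgebraTwist_coactTwist n) x))
    (fun n j hj => quo_op_ext k fun x =>
      congrArg (OperatorModule.cls _ _)
        (LinearMap.congr_fun (oneAt_rot n (j + 1) (by omega)) x))
    (fun n => quo_op_ext k fun x =>
      congrArg (OperatorModule.cls _ _)
        (LinearMap.congr_fun (oneAt_rot_last isAlgebraTwist_coactTwist n) x))

/-- The cyclic module `C_•(A, M)` of an `H`-module algebra `A` with coefficients in an arbitrary
`H`-module/comodule `M`. -/
noncomputable def hopfCyclic : Lamᵒᵖ ⥤ ModuleCat.{u} k := (hopfCyclicData k H A M).toFunctor.leftOp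

variable {A M} in
/-- The class of `a₀ ⊗ ⋯ ⊗ a_n ⊗ m` in `C_n(A, M)`. -/
noncomputable def hopfCyclicMk (n : ℕ) (a : Fin (n + 1) → A) (m : M) :
    (hopfCyclic k H A M).obj (op (Lam.mk n)) :=
  (algebraOperators k H A M).cls n (word k (n + 1) a m)

end Algebra

section Ordinary

variable (A : Type u) [Ring A] [Algebra k A]

variable {k} in
lemma words_induction {Z M : Type u} [AddCommGroup Z] [Module k Z] [AddCommGroup M] [Module k M]
    (n : ℕ) {p : Words k Z M n → Prop} (zero : p 0) (add : ∀ x y, p x → p y → p (x + y))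
    (hw : ∀ z m, p (word k n z m)) (x : Words k Z M n) : p x := by
  induction n with
  | zero => exact hw Fin.elim0 x
  | succ n ih =>
    refine TensorProduct.induction_on x zero (fun z y => ?_) add
    refine ih (p := fun y => p (z ⊗ₜ[k] y : Z ⊗[k] Words k Z M n)) ?_ ?_ ?_ y
    · rw [TensorProduct.tmul_zero]
      exact zero
    · intro x y hx hy
      rw [TensorProduct.tmul_add]
      exact add _ _ hx hy
    · intro w m
      exact hw (Fin.cons z w) m

lemma rot_id_word {Z M : Type u} [AddCommGroup Z] [Module k Z] [AddCommGroup M] [Module k M]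
    (n : ℕ) (z : Fin (n + 1) → Z) (m : M) :
    rot k (LinearMap.id : Z ⊗[k] M →ₗ[k] Z ⊗[k] M) n (word k (n + 1) z m) =
      word k (n + 1) (fun i => z (i + 1)) m := by
  induction n with
  | zero =>
    have : (fun i : Fin 1 => z (i + 1)) = z := by
      funext i
      exact congrArg z (Subsingleton.elim (α := Fin 1) _ _)
    rw [this]
    rfl
  | succ n ih =>
    have e := ih (Fin.cons (z 0) (fun i => z i.succ.succ))
    refine Eq.trans (congrArg (fun y => (z 1 ⊗ₜ[k] y : Z ⊗[k] Words k Z M (n + 1))) e) ?_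
    have h₀ : z (0 + 1) = z 1 := by rw [zero_add]
    have h₁ : (fun i : Fin (n + 1) => (Fin.cons (z 0) (fun i => z i.succ.succ) :
        Fin (n + 1) → Z) (i + 1)) = fun i => z (i.succ + 1) := by
      funext i
      refine Fin.lastCases ?_ (fun i => ?_) i
      · rw [Fin.last_add_one, Fin.succ_last, Fin.last_add_one]
        rfl
      · rw [Fin.succ_castSucc, Fin.coeSucc_eq_succ, Fin.coeSucc_eq_succ]
        rfl
    exact congrArg₂ (fun (x : Z) (y : Fin (n + 1) → Z) =>
      (x ⊗ₜ[k] word k (n + 1) y m : Z ⊗[k] Words k Z M (n + 1))) h₀.symm h₁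

lemma rot_id_pow {Z M : Type u} [AddCommGroup Z] [Module k Z] [AddCommGroup M] [Module k M]
    (n : ℕ) : rot k (LinearMap.id : Z ⊗[k] M →ₗ[k] Z ⊗[k] M) n ^ (n + 1) = 1 := by
  have h : ∀ (l : ℕ) (z : Fin (n + 1) → Z) (m : M),
      (rot k (LinearMap.id : Z ⊗[k] M →ₗ[k] Z ⊗[k] M) n ^ l) (word k (n + 1) z m) =
        word k (n + 1) (fun i => z (i + l • (1 : Fin (n + 1)))) m := by
    intro l
    induction l with
    | zero => intro z m; simp
    | succ l ih =>
      intro z m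
      rw [pow_succ', Module.End.mul_apply, ih, rot_id_word]
      simp only [add_assoc, succ_nsmul']
  refine LinearMap.ext fun x => ?_
  refine words_induction (n + 1) (p := fun x =>
    (rot k (LinearMap.id : Z ⊗[k] M →ₗ[k] Z ⊗[k] M) n ^ (n + 1)) x = x) ?_ ?_ ?_ x
  · exact map_zero _
  · intro x y hx hy
    rw [map_add, hx, hy]
  · intro z m
    have h₀ : (n + 1) • (1 : Fin (n + 1)) = 0 := by
      simpa using card_nsmul_eq_zero (x := (1 : Fin (n + 1)))
    rw [h, h₀]
    simp only [add_zero]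

lemma isAlgebraTwist_id :
    IsAlgebraTwist (LinearMap.id : A ⊗[k] k →ₗ[k] A ⊗[k] k) where
  one := rfl
  mul := by
    ext a b
    simp [rotStep]

/-- The cyclic structure on `A^{⊗ (n+1)}`, `n ≥ 0`, realized as `A^{⊗ (n+1)} ⊗ k`; the cyclic
operator is the inverse of `a₀ ⊗ ⋯ ⊗ a_n ↦ a₁ ⊗ ⋯ ⊗ a_n ⊗ a₀`, that is
`a₀ ⊗ ⋯ ⊗ a_n ↦ a_n ⊗ a₀ ⊗ ⋯ ⊗ a_{n-1}`. -/
noncomputable def cycData : CocyclicData (ModuleCat.{u} k)ᵒᵖ :=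
  CocyclicData.ofInverse
    (fun n => op (Words k A k (n + 1)))
    (fun n j => (ModuleCat.ofHom (mulAt k A k n j)).op)
    (fun n j => (ModuleCat.ofHom (oneAt k A k (n + 1) (j + 1))).op)
    (fun n => (ModuleCat.ofHom (rot k (LinearMap.id : A ⊗[k] k →ₗ[k] A ⊗[k] k) n)).op)
    (fun n i j hij hj => congrArg (fun f => (ModuleCat.ofHom f).op) (mulAt_mulAt n i j hij hj))
    (fun n i j hij hj => congrArg (fun f => (ModuleCat.ofHom f).op)
      (oneAt_oneAt (n + 1) (i + 1) (j + 1) (by omega) (by omega)))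
    (fun n i j hij hj => congrArg (fun f => (ModuleCat.ofHom f).op)
      (oneAt_mulAt_le n i j hij hj))
    (fun n i j hij hi => congrArg (fun f => (ModuleCat.ofHom f).op)
      (oneAt_mulAt_gt n i (j + 1) (by omega) hi))
    (fun n i hi => congrArg (fun f => (ModuleCat.ofHom f).op) (mulAt_oneAt_succ n i hi))
    (fun n i hi => congrArg (fun f => (ModuleCat.ofHom f).op)
      (mulAt_oneAt_self n (i + 1) (by omega)))
    (fun n => congrArg (fun f => (ModuleCat.ofHom f).op) (mulAt_rot_oneAt n))
    (fun n => by
      rw [endoIter_op]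
      refine congrArg Quiver.Hom.op (ModuleCat.hom_ext ?_)
      rw [OperatorModule.endoIter_hom, rot_id_pow]
      rfl)
    (fun n j hj => congrArg (fun f => (ModuleCat.ofHom f).op) (mulAt_rot n j hj))
    (fun n => congrArg (fun f => (ModuleCat.ofHom f).op)
      (mulAt_rot_last (isAlgebraTwist_id k A) n))
    (fun n j hj => congrArg (fun f => (ModuleCat.ofHom f).op)
      (oneAt_rot n (j + 1) (by omega)))
    (fun n => congrArg (fun f => (ModuleCat.ofHom f).op)
      (oneAt_rot_last (isAlgebraTwist_id k A) n))

/-- The canonical cyclic module `Cyc_•(A)` of an algebra `A`. -/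
noncomputable def cyc : Lamᵒᵖ ⥤ ModuleCat.{u} k := (cycData k A).toFunctor.leftOp

variable {A} in
/-- The element `a₀ ⊗ ⋯ ⊗ a_n` of `Cyc_n(A)`. -/
noncomputable def cycMk (n : ℕ) (a : Fin (n + 1) → A) : (cyc k A).obj (op (Lam.mk n)) :=
  (word k (n + 1) a 1 : Words k A k (n + 1))

end Ordinary

end CyclicObjects

/-! ### The double functor `diag Hom_k` and the external pairing -/

section DiagHom

variable (k : Type u) [Field k] {J : Type} [Category.{0} J]

variable {k} in
/-- The right `J`-module `a ↦ Hom_k(X_a, Y_a)` of a left `J`-module `X` and a right `J`-module `Y`;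
an arrow `f : b ⟶ a` of `J` sends `ψ : X_a → Y_a` to `x ↦ Y_f(ψ(X_f(x)))`. -/
noncomputable def diagHomObj (X : J ⥤ ModuleCat.{u} k) (Y : Jᵒᵖ ⥤ ModuleCat.{u} k) :
    Jᵒᵖ ⥤ ModuleCat.{u} k where
  obj a := ModuleCat.of k (X.obj a.unop →ₗ[k] Y.obj a)
  map f := ModuleCat.ofHom
    { toFun := fun ψ => (Y.map f).hom ∘ₗ ψ ∘ₗ (X.map f.unop).hom
      map_add' := fun ψ ψ' => by ext; simp
      map_smul' := fun r ψ => by ext; simp }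
  map_id a := by ext; simp
  map_comp f g := by ext; simp

/-- The double functor `diag_• Hom_k(-, -)`, contravariant in the first variable. -/
noncomputable def diagHom :
    (J ⥤ ModuleCat.{u} k)ᵒᵖ ⥤ (Jᵒᵖ ⥤ ModuleCat.{u} k) ⥤ (Jᵒᵖ ⥤ ModuleCat.{u} k) where
  obj X :=
    { obj := fun Y => diagHomObj X.unop Y
      map := fun g =>
        { app := fun a => ModuleCat.ofHom
            { toFun := fun ψ => (g.app a).hom ∘ₗ ψ
              map_add' := fun ψ ψ' => by ext; simp
              map_smul' := fun r ψ => by ext; simp }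
          naturality := fun a b f => by
            ext ψ
            exact LinearMap.ext fun x =>
              LinearMap.congr_fun (congrArg ModuleCat.Hom.hom (g.naturality f)) _ }
      map_id := fun Y => by ext; rfl
      map_comp := fun f g => by ext; rfl }
  map {X X'} f :=
    { app := fun Y =>
        { app := fun a => ModuleCat.ofHom
            { toFun := fun ψ => ψ ∘ₗ (f.unop.app a.unop).hom
              map_add' := fun ψ ψ' => by ext; simp
              map_smul' := fun r ψ => by ext; simp }
          naturality := fun a b h => by
            ext (ψ : X.unop.obj a.unop →ₗ[k] Y.obj a)
            exact LinearMap.ext fun x => congrArg (fun y => (Y.map h).hom (ψ y))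
              (LinearMap.congr_fun (congrArg ModuleCat.Hom.hom (f.unop.naturality h.unop)) x).symm }
      naturality := fun Y Y' g => by ext; rfl }
  map_id X := by ext; rfl
  map_comp f g := by ext; rfl

instance (X : (J ⥤ ModuleCat.{u} k)ᵒᵖ) : ((diagHom k (J := J)).obj X).Additive where
  map_add {Y Y' f g} := by ext; rfl

instance (Y : Jᵒᵖ ⥤ ModuleCat.{u} k) : ((diagHom k (J := J)).flip.obj Y).Additive where
  map_add {X X' f g} := by
    ext a (ψ : X.unop.obj a.unop →ₗ[k] Y.obj a)
    exact LinearMap.ext fun x => map_add ψ _ _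

/-- A short complex of functors is short exact if it is so at each object. -/
lemma shortExact_of_evaluation {I : Type} [Category.{0} I]
    (S : ShortComplex (I ⥤ ModuleCat.{u} k))
    (h : ∀ a, (S.map ((evaluation I (ModuleCat.{u} k)).obj a)).ShortExact) : S.ShortExact where
  exact := by
    rw [ShortComplex.exact_iff_isZero_homology]
    refine Functor.isZero _ fun a => ?_
    exact ((ShortComplex.exact_iff_isZero_homology _).1 (h a).exact).of_iso
      (S.mapHomologyIso ((evaluation I (ModuleCat.{u} k)).obj a)).symm
  mono_f := by
    have : ∀ a, Mono (S.f.app a) := fun a => (h a).mono_f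
    exact NatTrans.mono_of_mono_app _
  epi_g := by
    have : ∀ a, Epi (S.g.app a) := fun a => (h a).epi_g
    exact NatTrans.epi_of_epi_app _

lemma shortExact_evaluation {I : Type} [Category.{0} I]
    {S : ShortComplex (I ⥤ ModuleCat.{u} k)} (h : S.ShortExact) (a : I) :
    (S.map ((evaluation I (ModuleCat.{u} k)).obj a)).ShortExact :=
  h.map_of_exact _

variable {k} in
/-- Over a field, `Hom(V, -)` preserves short exact sequences. -/
lemma shortExact_postcomp (V : Type u) [AddCommGroup V] [Module k V]
    {S : ShortComplex (ModuleCat.{u} k)} (h : S.ShortExact)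
    (T : ShortComplex (ModuleCat.{u} k))
    (e₁ : T.X₁ ≃ₗ[k] (V →ₗ[k] S.X₁)) (e₂ : T.X₂ ≃ₗ[k] (V →ₗ[k] S.X₂))
    (e₃ : T.X₃ ≃ₗ[k] (V →ₗ[k] S.X₃)) (hf : ∀ x, e₂ (T.f.hom x) = S.f.hom ∘ₗ e₁ x)
    (hg : ∀ x, e₃ (T.g.hom x) = S.g.hom ∘ₗ e₂ x) : T.ShortExact := by
  have hinj := h.moduleCat_injective_f
  have hsurj := h.moduleCat_surjective_g
  have hex := (ShortComplex.ShortExact.moduleCat_exact_iff_function_exact _).1 h.exact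
  obtain ⟨s, hs⟩ := LinearMap.exists_rightInverse_of_surjective _ (LinearMap.range_eq_top.2 hsurj)
  obtain ⟨r, hr⟩ := LinearMap.exists_leftInverse_of_injective _ (LinearMap.ker_eq_bot.2 hinj)
  refine ModuleCat.shortComplex_shortExact _ ?_ ?_ ?_
  · intro y
    constructor
    · intro hy
      have h₀ : S.g.hom ∘ₗ e₂ y = 0 := by rw [← hg, hy, map_zero]
      refine ⟨e₁.symm (r ∘ₗ e₂ y), e₂.injective ?_⟩
      rw [hf, LinearEquiv.apply_symm_apply]
      refine LinearMap.ext fun v => ?_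
      obtain ⟨x, hx⟩ := (hex _).1 (LinearMap.congr_fun h₀ v)
      have := LinearMap.congr_fun hr x
      simp only [LinearMap.comp_apply, LinearMap.id_apply] at this ⊢
      rw [← hx, this]
    · rintro ⟨x, rfl⟩
      exact LinearMap.congr_fun (congrArg ModuleCat.Hom.hom T.zero) x
  · intro x y hxy
    refine e₁.injective (LinearMap.ext fun v => hinj ?_)
    exact LinearMap.congr_fun (((hf x).symm.trans (congrArg e₂ hxy)).trans (hf y)) v
  · intro y
    refine ⟨e₂.symm (s ∘ₗ e₃ y), e₃.injective ?_⟩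
    rw [hg, LinearEquiv.apply_symm_apply, ← LinearMap.comp_assoc, hs, LinearMap.id_comp]

variable {k} in
/-- Over a field, `Hom(-, V)` preserves short exact sequences. -/
lemma shortExact_precomp (V : Type u) [AddCommGroup V] [Module k V]
    {S : ShortComplex (ModuleCat.{u} k)} (h : S.ShortExact)
    (T : ShortComplex (ModuleCat.{u} k))
    (e₁ : T.X₁ ≃ₗ[k] (S.X₃ →ₗ[k] V)) (e₂ : T.X₂ ≃ₗ[k] (S.X₂ →ₗ[k] V))
    (e₃ : T.X₃ ≃ₗ[k] (S.X₁ →ₗ[k] V)) (hf : ∀ x, e₂ (T.f.hom x) = e₁ x ∘ₗ S.g.hom)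
    (hg : ∀ x, e₃ (T.g.hom x) = e₂ x ∘ₗ S.f.hom) : T.ShortExact := by
  have hinj := h.moduleCat_injective_f
  have hsurj := h.moduleCat_surjective_g
  have hex := (ShortComplex.ShortExact.moduleCat_exact_iff_function_exact _).1 h.exact
  obtain ⟨s, hs⟩ := LinearMap.exists_rightInverse_of_surjective _ (LinearMap.range_eq_top.2 hsurj)
  obtain ⟨r, hr⟩ := LinearMap.exists_leftInverse_of_injective _ (LinearMap.ker_eq_bot.2 hinj)
  refine ModuleCat.shortComplex_shortExact _ ?_ ?_ ?_
  · intro y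
    constructor
    · intro hy
      have h₀ : e₂ y ∘ₗ S.f.hom = 0 := by rw [← hg, hy, map_zero]
      refine ⟨e₁.symm (e₂ y ∘ₗ s), e₂.injective ?_⟩
      rw [hf, LinearEquiv.apply_symm_apply]
      refine LinearMap.ext fun v => ?_
      have h₁ : S.g.hom (s (S.g.hom v) - v) = 0 := by
        rw [map_sub, sub_eq_zero]
        exact LinearMap.congr_fun hs _
      obtain ⟨x, hx⟩ := (hex _).1 h₁
      have h₂ := LinearMap.congr_fun h₀ x
      simp only [LinearMap.comp_apply, LinearMap.zero_apply] at h₂ ⊢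
      rw [hx, map_sub, sub_eq_zero] at h₂
      exact h₂
    · rintro ⟨x, rfl⟩
      exact LinearMap.congr_fun (congrArg ModuleCat.Hom.hom T.zero) x
  · intro x y hxy
    refine e₁.injective (LinearMap.ext fun v => ?_)
    obtain ⟨w, rfl⟩ := hsurj v
    exact LinearMap.congr_fun (((hf x).symm.trans (congrArg e₂ hxy)).trans (hf y)) w
  · intro y
    refine ⟨e₂.symm (e₃ y ∘ₗ r), e₃.injective ?_⟩
    rw [hg, LinearEquiv.apply_symm_apply, LinearMap.comp_assoc, hr, LinearMap.comp_id]

/-- `diag_• Hom_k(-, -)` is exact in the second variable. -/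
lemma diagHom_shortExact_right (X : J ⥤ ModuleCat.{u} k)
    {S : ShortComplex (Jᵒᵖ ⥤ ModuleCat.{u} k)} (hS : S.ShortExact) :
    (S.map ((diagHom k).obj (op X))).ShortExact :=
  shortExact_of_evaluation k _ fun a =>
    shortExact_postcomp (X.obj a.unop) (shortExact_evaluation k hS a) _ (LinearEquiv.refl k _)
      (LinearEquiv.refl k _) (LinearEquiv.refl k _) (fun _ => rfl) (fun _ => rfl)

/-- `diag_• Hom_k(-, -)` is exact in the first variable. -/
lemma diagHom_shortExact_left (Y : Jᵒᵖ ⥤ ModuleCat.{u} k)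
    {S : ShortComplex (J ⥤ ModuleCat.{u} k)} (hS : S.ShortExact) :
    (S.op.map ((diagHom k).flip.obj Y)).ShortExact :=
  shortExact_of_evaluation k _ fun a =>
    shortExact_precomp (Y.obj a) (shortExact_evaluation k hS a.unop) _ (LinearEquiv.refl k _)
      (LinearEquiv.refl k _) (LinearEquiv.refl k _) (fun _ => rfl) (fun _ => rfl)

end DiagHom

/-! ### Cohomology groups and the external pairing -/

section Pairing

open CategoryTheory.Abelian

variable {k : Type u} [Field k]

noncomputable instance {J : Type} [Category.{0} J] : HasExt.{u + 1} (J ⥤ ModuleCat.{u} k) :=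
  HasExt.standard _

variable (k) in
/-- The trivial `J`-module `k_•`, equal to `k` at each object, all arrows acting as the identity. -/
abbrev trivialModule (J : Type) [Category.{0} J] : J ⥤ ModuleCat.{u} k :=
  (Functor.const J).obj (ModuleCat.of k k)

/-- The space `Ext_Λ^p(k_•, X)`, the `p`-th cyclic cohomology of the left `Λ`-module `X`. -/
abbrev cocyclicCohomology (X : Lam ⥤ ModuleCat.{u} k) (p : ℕ) : Type (u + 1) :=
  Ext (trivialModule k Lam) X p

/-- The space `Ext_Λ^q(Y, k_•)`, the `q`-th cyclic cohomology of the right `Λ`-module `Y`. -/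
abbrev cyclicCohomology (Y : Lamᵒᵖ ⥤ ModuleCat.{u} k) (q : ℕ) : Type (u + 1) :=
  Ext Y (trivialModule k Lamᵒᵖ) q

/-- The value at `x` of an element of `diag_a Hom_k(X, Y) = Hom_k(X_a, Y_a)`. -/
def diagHomEval {X : Lam ⥤ ModuleCat.{u} k} {Y : Lamᵒᵖ ⥤ ModuleCat.{u} k} {a : Lamᵒᵖ}
    (ψ : (((diagHom k).obj (op X)).obj Y).obj a) (x : X.obj a.unop) : Y.obj a :=
  (show X.obj a.unop →ₗ[k] Y.obj a from ψ) x

/-- The isomorphism `diag Hom_k(k_•, k_•) ≅ k_•`, `ψ ↦ ψ(1)`, as a morphism. -/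
noncomputable def diagHomTrivial :
    ((diagHom k).obj (op (trivialModule k Lam))).obj (trivialModule k Lamᵒᵖ) ⟶
      trivialModule k Lamᵒᵖ where
  app _ := ModuleCat.ofHom (LinearMap.applyₗ (R := k) (M := k) (M₂ := k) 1)
  naturality _ _ _ := rfl

/-- The maps `η p q X Y` are the external pairing induced on `Ext` groups by the exact double functor
`diag Hom_k` and the isomorphism `diag Hom_k(k_•, k_•) ≅ k_•`: they are natural in both variables,
they are compatible with the connecting homomorphisms in both variables (the multiplications by the
classes of short exact sequences), and in bidegree `(0, 0)` they are given by the action of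
`diag Hom_k` on morphisms. Products of `Ext` classes are in the order of arrows in diagrams. -/
structure IsExternalPairing
    (η : ∀ (p q : ℕ) (X : Lam ⥤ ModuleCat.{u} k) (Y : Lamᵒᵖ ⥤ ModuleCat.{u} k),
      cocyclicCohomology X p ⊗[k] cyclicCohomology Y q →ₗ[k]
        cyclicCohomology (((diagHom k).obj (op X)).obj Y) (p + q)) : Prop where
  zero : ∀ {X : Lam ⥤ ModuleCat.{u} k} {Y : Lamᵒᵖ ⥤ ModuleCat.{u} k}
    (f : trivialModule k Lam ⟶ X) (g : Y ⟶ trivialModule k Lamᵒᵖ),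
    η 0 0 X Y (Ext.mk₀ f ⊗ₜ Ext.mk₀ g) =
      Ext.mk₀ (((diagHom k).map f.op).app Y ≫
        ((diagHom k).obj (op (trivialModule k Lam))).map g ≫ diagHomTrivial)
  natural_left : ∀ {p q : ℕ} {X X' : Lam ⥤ ModuleCat.{u} k} {Y : Lamᵒᵖ ⥤ ModuleCat.{u} k}
    (f : X ⟶ X') (α : cocyclicCohomology X p) (β : cyclicCohomology Y q),
    η p q X' Y (α.comp (Ext.mk₀ f) (add_zero p) ⊗ₜ β) =
      (Ext.mk₀ (((diagHom k).map f.op).app Y)).comp (η p q X Y (α ⊗ₜ β)) (zero_add _)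
  natural_right : ∀ {p q : ℕ} {X : Lam ⥤ ModuleCat.{u} k} {Y Y' : Lamᵒᵖ ⥤ ModuleCat.{u} k}
    (g : Y ⟶ Y') (α : cocyclicCohomology X p) (β : cyclicCohomology Y' q),
    η p q X Y (α ⊗ₜ (Ext.mk₀ g).comp β (zero_add q)) =
      (Ext.mk₀ (((diagHom k).obj (op X)).map g)).comp (η p q X Y' (α ⊗ₜ β)) (zero_add _)
  connecting_left : ∀ {p q : ℕ} {S : ShortComplex (Lam ⥤ ModuleCat.{u} k)} (hS : S.ShortExact)
    {Y : Lamᵒᵖ ⥤ ModuleCat.{u} k}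
    (α : cocyclicCohomology S.X₃ p) (β : cyclicCohomology Y q),
    η (p + 1) q S.X₁ Y (α.comp hS.extClass rfl ⊗ₜ β) =
      (diagHom_shortExact_left k Y hS).extClass.comp (η p q S.X₃ Y (α ⊗ₜ β)) (by omega)
  connecting_right : ∀ {p q : ℕ} {X : Lam ⥤ ModuleCat.{u} k}
    {S : ShortComplex (Lamᵒᵖ ⥤ ModuleCat.{u} k)} (hS : S.ShortExact)
    (α : cocyclicCohomology X p) (β : cyclicCohomology S.X₁ q),
    η p (q + 1) X S.X₃ (α ⊗ₜ hS.extClass.comp β (add_comm 1 q)) =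
      (-1 : k) ^ p •
        (diagHom_shortExact_right k X hS).extClass.comp (η p q X S.X₁ (α ⊗ₜ β)) (by omega)

end Pairing

section HopfCohomology

variable (k : Type u) [Field k] (H : Type u) [Ring H] [HopfAlgebra k H]
  (M : Type u) [AddCommGroup M] [Module k M] [Module H M] [IsScalarTower k H M]
  [LeftComodule k H M]

/-- The Hopf-cyclic cohomology `HC^p_Hopf(C, M)` of an `H`-module coalgebra. -/
abbrev hopfCohomologyCoalgebra (C : Type u) [AddCommGroup C] [Module k C] [Coalgebra k C]
    [Module H C] [IsScalarTower k H C] [IsModuleCoalgebra k H C] (p : ℕ) : Type (u + 1) :=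
  cocyclicCohomology (hopfCocyclic k H C M) p

/-- The Hopf-cyclic cohomology `HC^q_Hopf(A, M)` of an `H`-module algebra. -/
abbrev hopfCohomologyAlgebra (A : Type u) [Ring A] [Algebra k A] [Module H A]
    [IsScalarTower k H A] [IsModuleAlgebra k H A] (q : ℕ) : Type (u + 1) :=
  cyclicCohomology (hopfCyclic k H A M) q

/-- The ordinary cyclic cohomology `HC^n(A)` of an algebra. -/
abbrev HC (A : Type u) [Ring A] [Algebra k A] (n : ℕ) : Type (u + 1) :=
  cyclicCohomology (cyc k A) n

end HopfCohomology

/-! The theorem has two independent halves: a product on Ext which is forced by its values in degree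
zero, and a morphism of cyclic modules which has to descend to quotients.

For the product, fix `Y` and let `G = diag Hom(-, Y)`, a contravariant exact functor. If `T : X → I
→ Q` is an embedding into an injective with its quotient, every class in `Ext^{p+1}(k, X)` is `α ·
[T]`, and `α` is ambiguous only by classes coming from `Ext^p(k, I)`. Hence `θ(α · [T]) = [G T] ·
θ(α)` extends `f ↦ G f` from degree zero to maps `Ext^p(k, X) → Ext^p(G X, G k)`
(`exists_isContraExt`). The pairing is `θ(α) · ev · β`, where `ev : diag Hom(k, Y) → Y` evaluates at
1. Its behaviour in `Y` is a comparison of the maps `θ` of several exact functors, along a natural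
transformation (`IsContraExt.natTrans`) and along a short exact sequence of functors
(`IsContraExt.comp_extClass`). The sign `(-1)^p` collects one minus sign per degree, because the two
Yoneda products around a 3 × 3 diagram anticommute (`extClass_comp_extClass_anticomm`). Uniqueness
is dimension shifting in both variables (`IsExternalPairing.unique`).

For the morphism, compatibility of the formula on words with the generators of `Λ` follows from the
axioms of the action; the difficulty is that the formula must kill the kernel of the quotient on the
coalgebra side. That kernel is closed under cofaces, and for a word `x` in `A` the compatibility
with a coface gives information only after two neighbouring factors have been multiplied. So the
kernel is first computed more explicitly: in a module coalgebra, splitting and dropping factors send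
rotated relations to rotated relations, whence the kernel lies in the span of the rotations of the
relations (`isAdmissible_rotSpan`, `ker_coalgebraOperators_le`). The rotations are needed, since
nothing makes `t` commute with the diagonal action when action and coaction on `M` are unrelated.
Equivariance sends relations to relations, and a rotation of the word in `C` is absorbed by rotating
the word in `A` backwards, which is possible because the ordinary rotation has finite order
(`actWords_mem_ker`). Elementary tensors span, so the morphism is unique. -/

/-! ### Yoneda products and contravariant exact functors -/

section HomologicalAlgebra

open CategoryTheory.Limits CategoryTheory.Abelian

/-! ### Anticommutation of Yoneda products in a 3 × 3 diagram -/

section Anticommutation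

variable {C : Type*} [Category C] [Abelian C]

/-- In a `3 × 3` diagram with exact rows and columns, the two Yoneda products of the outer
short exact sequences differ by a sign. -/
lemma extClass_comp_extClass_anticomm [HasExt C] {R₁ R₂ R₃ : ShortComplex C} (φ : R₁ ⟶ R₂)
    (ψ : R₂ ⟶ R₃) (w₁ : φ.τ₁ ≫ ψ.τ₁ = 0) (w₂ : φ.τ₂ ≫ ψ.τ₂ = 0) (w₃ : φ.τ₃ ≫ ψ.τ₃ = 0)
    (h₁ : R₁.ShortExact) (h₂ : R₂.ShortExact) (h₃ : R₃.ShortExact)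
    (c₁ : (ShortComplex.mk φ.τ₁ ψ.τ₁ w₁).ShortExact)
    (c₂ : (ShortComplex.mk φ.τ₂ ψ.τ₂ w₂).ShortExact)
    (c₃ : (ShortComplex.mk φ.τ₃ ψ.τ₃ w₃).ShortExact) :
    c₃.extClass.comp h₁.extClass (rfl : 1 + 1 = 2) = -h₃.extClass.comp c₁.extClass rfl := by
  have := h₁.mono_f; have := h₂.mono_f; have := h₃.mono_f
  have := h₁.epi_g; have := h₂.epi_g; have := h₃.epi_g
  have : Mono φ.τ₁ := c₁.mono_f
  have : Mono φ.τ₂ := c₂.mono_f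
  have : Mono φ.τ₃ := c₃.mono_f
  have : Epi ψ.τ₁ := c₁.epi_g
  have : Epi ψ.τ₂ := c₂.epi_g
  -- `d` maps the centre of the diagram onto its last corner. Its kernel `K` is, informally, the sum
  -- of the images of `R₁.X₂` and `R₂.X₁`, which meet in `R₁.X₁`; everything below takes place in
  -- `K`.
  let d : R₂.X₂ ⟶ R₃.X₃ := ψ.τ₂ ≫ R₃.g
  have hd : d = R₂.g ≫ ψ.τ₃ := ψ.comm₂₃.symm ▸ rfl
  have : Epi d := epi_comp _ _
  let ι := kernel.ι d
  let G : ShortComplex C := ShortComplex.mk ι d (kernel.condition d)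
  have hG : G.ShortExact := { exact := ShortComplex.exact_kernel d }
  obtain ⟨p, hp⟩ : ∃ p : kernel d ⟶ R₁.X₃, p ≫ φ.τ₃ = ι ≫ R₂.g :=
    ⟨_, c₃.fIsKernel.fac (KernelFork.ofι (ι ≫ R₂.g)
      (by simp only [Category.assoc]; rw [← hd]; exact kernel.condition d)) .zero⟩
  obtain ⟨q, hq⟩ : ∃ q : kernel d ⟶ R₃.X₁, q ≫ R₃.f = ι ≫ ψ.τ₂ :=
    ⟨_, h₃.fIsKernel.fac (KernelFork.ofι (ι ≫ ψ.τ₂)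
      (by simp only [Category.assoc]; exact kernel.condition d)) .zero⟩
  let a : R₁.X₂ ⟶ kernel d := kernel.lift d φ.τ₂ (by simp [d, reassoc_of% w₂])
  let b : R₂.X₁ ⟶ kernel d := kernel.lift d R₂.f (by rw [hd]; simp)
  have ha : a ≫ ι = φ.τ₂ := kernel.lift_ι _ _ _
  have hb : b ≫ ι = R₂.f := kernel.lift_ι _ _ _
  have hap : a ≫ p = R₁.g := by
    rw [← cancel_mono φ.τ₃, Category.assoc, hp, reassoc_of% ha, φ.comm₂₃]
  have haq : a ≫ q = 0 := by
    rw [← cancel_mono R₃.f, Category.assoc, hq, reassoc_of% ha, w₂, zero_comp]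
  have hbp : b ≫ p = 0 := by
    rw [← cancel_mono φ.τ₃, Category.assoc, hp, reassoc_of% hb, R₂.zero, zero_comp]
  have hbq : b ≫ q = ψ.τ₁ := by
    rw [← cancel_mono R₃.f, Category.assoc, hq, reassoc_of% hb, ψ.comm₁₂]
  have hj : R₁.f ≫ a = φ.τ₁ ≫ b := by
    rw [← cancel_mono ι, Category.assoc, Category.assoc, ha, hb, φ.comm₁₂]
  let j : R₁.X₁ ⟶ kernel d := R₁.f ≫ a
  let π : kernel d ⟶ R₁.X₃ ⊞ R₃.X₁ := biprod.lift p q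
  have hjπ : j ≫ π = 0 := by
    ext
    · simp [j, π, hap]
    · simp [j, π, haq]
  -- `E` is `R₁.X₁ → K → R₁.X₃ ⊞ R₃.X₁`; together with `G` it splices to an exact sequence that
  -- dominates both products.
  let E : ShortComplex C := ShortComplex.mk j π hjπ
  have : Mono a := mono_of_mono_fac ha
  have hE : E.ShortExact := by
    refine { exact := ?_, mono_f := mono_comp _ _, epi_g := ?_ }
    · refine ShortComplex.exact_of_f_is_kernel E ?_
      -- If `p` and `q` both kill `s`, then exactness of the middle row puts `s` in `R₂.X₁`, and
      -- exactness of the first column puts it in `R₁.X₁`.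
      have lift : ∀ {W : C} (s : W ⟶ kernel d), s ≫ π = 0 → ∃ l : W ⟶ R₁.X₁, l ≫ j = s := by
        intro W s hs
        have hsp : s ≫ p = 0 := by simpa [π] using hs =≫ biprod.fst
        have hsq : s ≫ q = 0 := by simpa [π] using hs =≫ biprod.snd
        obtain ⟨y, hy⟩ : ∃ y : W ⟶ R₂.X₁, y ≫ R₂.f = s ≫ ι :=
          ⟨_, h₂.fIsKernel.fac (KernelFork.ofι (s ≫ ι)
            (by rw [Category.assoc, ← hp, reassoc_of% hsp, zero_comp])) .zero⟩
        have hy' : y ≫ ψ.τ₁ = 0 := by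
          rw [← cancel_mono R₃.f, Category.assoc, ψ.comm₁₂, reassoc_of% hy, ← hq,
            reassoc_of% hsq, zero_comp]
        obtain ⟨z, hz⟩ : ∃ z : W ⟶ R₁.X₁, z ≫ φ.τ₁ = y :=
          ⟨_, c₁.fIsKernel.fac (KernelFork.ofι y hy') .zero⟩
        refine ⟨z, ?_⟩
        rw [← cancel_mono ι, show j = φ.τ₁ ≫ b from hj, reassoc_of% hz, Category.assoc, hb, hy]
      have : Mono j := mono_comp _ _
      exact KernelFork.IsLimit.ofι' j hjπ fun s hs =>
        ⟨(lift s hs).choose, (lift s hs).choose_spec⟩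
    -- Already the restriction of `π` to `R₁.X₂ ⊞ R₂.X₁` is an epimorphism, being diagonal with
    -- epimorphic entries.
    · have e : biprod.desc a b ≫ π = biprod.map R₁.g ψ.τ₁ := by
        ext <;> simp [π, hap, haq, hbp, hbq]
      have : Epi (biprod.desc a b ≫ π) := by rw [e]; infer_instance
      exact epi_of_epi (biprod.desc a b) π
  -- Pushing `[G]` out along `p` and `q` gives `[c₃]` and `[h₃]`; pulling `[E]` back along the two
  -- inclusions gives `[h₁]` and `[c₁]`.
  have n₁ := ShortComplex.ShortExact.extClass_naturality hG c₃
    { τ₁ := p, τ₂ := R₂.g, τ₃ := 𝟙 _, comm₁₂ := hp, comm₂₃ := by simp [G, hd] }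
  have n₂ := ShortComplex.ShortExact.extClass_naturality hG h₃
    { τ₁ := q, τ₂ := ψ.τ₂, τ₃ := 𝟙 _, comm₁₂ := hq, comm₂₃ := by simp [G, d] }
  have n₃ := ShortComplex.ShortExact.extClass_naturality h₁ hE
    { τ₁ := 𝟙 _, τ₂ := a, τ₃ := biprod.inl, comm₁₂ := by simp [E, j],
      comm₂₃ := by dsimp [E]; ext <;> simp [π, hap, haq] }
  have n₄ := ShortComplex.ShortExact.extClass_naturality c₁ hE
    { τ₁ := 𝟙 _, τ₂ := b, τ₃ := biprod.inr, comm₁₂ := by simp [E, j, hj],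
      comm₂₃ := by dsimp [E]; ext <;> simp [π, hbp, hbq] }
  have hπ : Ext.mk₀ π = (Ext.mk₀ p).comp (Ext.mk₀ biprod.inl) (add_zero 0) +
      (Ext.mk₀ q).comp (Ext.mk₀ biprod.inr) (add_zero 0) := by
    rw [Ext.mk₀_comp_mk₀, Ext.mk₀_comp_mk₀, ← Ext.mk₀_add]
    congr 1
    ext <;> simp [π]
  -- The product `π · [E]` vanishes. Expanding `π` as `p · inl + q · inr` turns `[G] · π · [E] = 0`
  -- into `[c₃] · [h₁] + [h₃] · [c₁] = 0`.
  have h₀ : (hG.extClass.comp (Ext.mk₀ π) (add_zero 1)).comp hE.extClass (rfl : 1 + 1 = 2) = 0 := by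
    rw [Ext.comp_assoc_of_second_deg_zero]
    have := hE.comp_extClass
    dsimp only [E] at this ⊢
    rw [this, Ext.comp_zero]
  dsimp only [G, E] at n₁ n₂ n₃ n₄ h₀
  simp only [Ext.mk₀_id_comp] at n₁ n₂ n₃ n₄
  rw [hπ, Ext.comp_add, Ext.add_comp,
    ← Ext.comp_assoc_of_third_deg_zero, ← Ext.comp_assoc_of_third_deg_zero, n₁, n₂,
    Ext.comp_assoc_of_second_deg_zero, Ext.comp_assoc_of_second_deg_zero, ← n₃, ← n₄,
    Ext.comp_mk₀_id, Ext.comp_mk₀_id] at h₀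
  exact eq_neg_of_add_eq_zero_left h₀

end Anticommutation

/-! ### Dimension shifting by injective objects -/

section Effaceability

variable {C : Type*} [Category C] [Abelian C]

/-- An embedding of an object in an injective object, completed to a short exact sequence. -/
lemma exists_shortExact_injective [EnoughInjectives C] (X : C) :
    ∃ (I Q : C) (f : X ⟶ I) (g : I ⟶ Q) (w : f ≫ g = 0),
      Injective I ∧ (ShortComplex.mk f g w).ShortExact :=
  ⟨_, _, Injective.ι X, cokernel.π _, cokernel.condition _, inferInstance,
    { exact := ShortComplex.exact_cokernel _ }⟩

/-- Dimension shifting: the obstruction to `α` being a connecting image lies in `Ext^{p+1}(Z,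
S.X₂)`, which is zero. -/
lemma exists_comp_extClass_eq [HasExt C] {S : ShortComplex C} (hS : S.ShortExact) [Injective S.X₂]
    {Z : C} {p : ℕ} (α : Ext Z S.X₁ (p + 1)) :
    ∃ β : Ext Z S.X₃ p, β.comp hS.extClass rfl = α :=
  Ext.covariant_sequence_exact₁ _ hS α (Ext.eq_zero_of_injective _) rfl

/-- Each class of positive degree is a product with the class of a short exact sequence and a
morphism on the left. -/
lemma exists_mk₀_comp_extClass_comp_eq [HasExt C] [EnoughInjectives C] {Z X : C} {p : ℕ}
    (α : Ext Z X (p + 1)) :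
    ∃ (S : ShortComplex C) (hS : S.ShortExact) (g : Z ⟶ S.X₃) (β : Ext S.X₁ X p),
      (Ext.mk₀ g).comp (hS.extClass.comp β (add_comm 1 p)) (zero_add _) = α := by
  -- Injectives split off a short exact sequence at the target end, while one at the source end is
  -- wanted. In degree one the remaining factor is a morphism and both ends coincide; in higher
  -- degree the induction moves inward and the sequence split off at the target is absorbed into the
  -- last factor.
  induction p generalizing X with
  | zero =>
    obtain ⟨I, Q, f, g, w, hI, hS⟩ := exists_shortExact_injective X
    have : Injective (ShortComplex.mk f g w).X₂ := hI
    obtain ⟨β, rfl⟩ := exists_comp_extClass_eq hS α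
    refine ⟨_, hS, Ext.homEquiv₀ β, Ext.mk₀ (𝟙 _), ?_⟩
    rw [Ext.comp_mk₀_id, Ext.mk₀_homEquiv₀_apply]
  | succ p ih =>
    obtain ⟨I, Q, f, g, w, hI, hS⟩ := exists_shortExact_injective X
    have : Injective (ShortComplex.mk f g w).X₂ := hI
    obtain ⟨β, rfl⟩ := exists_comp_extClass_eq hS α
    obtain ⟨S, hS', g', γ, rfl⟩ := ih β
    refine ⟨S, hS', g', γ.comp hS.extClass rfl, ?_⟩
    rw [Ext.comp_assoc _ _ _ (zero_add _) rfl (by omega),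
      Ext.comp_assoc _ _ _ (add_comm 1 p) rfl (by omega)]

/-- Evaluation at `a` preserves monomorphisms, so its right adjoint sends injectives to injectives.
The product over all `a` of the objects coinduced from injective hulls `I a ⊇ X(a)` receives `X`; at
`a` this map is mono because its composite with the projection and the counit is the embedding `X(a)
→ I a`. -/
instance {J : Type} [Category.{0} J] (k : Type u) [Field k] :
    EnoughInjectives (J ⥤ ModuleCat.{u} k) where
  presentation X := by
    let I (a : J) : ModuleCat.{u} k := Injective.under (X.obj a)
    let R (a : J) : J ⥤ ModuleCat.{u} k := (evaluationRightAdjoint (ModuleCat.{u} k) a).obj (I a)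
    have hR (a : J) : Injective (R a) :=
      Injective.injective_of_adjoint (evaluationAdjunctionLeft (ModuleCat.{u} k) a) (I a)
    let f (a : J) : X ⟶ R a :=
      (evaluationAdjunctionLeft (ModuleCat.{u} k) a).homEquiv _ _ (Injective.ι (X.obj a))
    have hf (a : J) : Mono ((f a).app a) := by
      have h : (f a).app a ≫ ((evaluationAdjunctionLeft (ModuleCat.{u} k) a).counit.app (I a)) =
          Injective.ι (X.obj a) := by
        have := ((evaluationAdjunctionLeft (ModuleCat.{u} k) a).homEquiv X (I a)).left_inv
          (Injective.ι (X.obj a))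
        rwa [Equiv.invFun_as_coe, Adjunction.homEquiv_counit] at this
      exact mono_of_mono_fac h
    have hm : Mono (Pi.lift f) := by
      have : ∀ a, Mono ((Pi.lift f).app a) := fun a => by
        have h : (Pi.lift f).app a ≫ (Pi.π R a).app a = (f a).app a := by
          rw [← NatTrans.comp_app, Limits.Pi.lift_π]
        have := hf a
        exact mono_of_mono_fac h
      exact NatTrans.mono_of_mono_app _
    exact ⟨{ J := ∏ᶜ R, injective := inferInstance, f := Pi.lift f, mono := hm }⟩

end Effaceability

/-! ### Extending a contravariant exact functor to Ext groups -/

section ContraExt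

variable {k : Type*} [Field k] {C : Type*} [Category C] [Abelian C] [Linear k C]
  {D : Type*} [Category D] [Abelian D] [Linear k D] [HasExt D]
  (U : C) (G : Cᵒᵖ ⥤ D) [G.Additive]

/-- `G` sends short exact sequences to short exact sequences. -/
def PreservesShortExact : Prop := ∀ ⦃S : ShortComplex C⦄, S.ShortExact → (S.op.map G).ShortExact

section

variable {G} (hG : PreservesShortExact G)

/-- The class of the image of a short exact sequence under a contravariant functor. -/
noncomputable def PreservesShortExact.extClass {S : ShortComplex C} (hS : S.ShortExact) :
    Ext (G.obj (op S.X₁)) (G.obj (op S.X₃)) 1 :=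
  (hG hS).extClass

lemma PreservesShortExact.comp_extClass {S : ShortComplex C} (hS : S.ShortExact) {Y : D} {p : ℕ}
    (γ : Ext (G.obj (op S.X₂)) Y p) :
    (hG.extClass hS).comp ((Ext.mk₀ (G.map S.g.op)).comp γ (zero_add p)) (add_comm 1 p) = 0 :=
  (hG hS).extClass_comp_assoc γ

lemma PreservesShortExact.extClass_naturality {S T : ShortComplex C} (hS : S.ShortExact)
    (hT : T.ShortExact) (φ : S ⟶ T) :
    (hG.extClass hT).comp (Ext.mk₀ (G.map φ.τ₃.op)) (add_zero 1) =
      (Ext.mk₀ (G.map φ.τ₁.op)).comp (hG.extClass hS) (zero_add 1) :=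
  ShortComplex.ShortExact.extClass_naturality (hG hT) (hG hS)
    (G.mapShortComplex.map (ShortComplex.opMap φ))

end

variable [HasExt C]

/-- The extension by one degree of a natural transformation from `Ext(U, X)` to `Ext(G X, G U)`. -/
lemma exists_contraExt_succ [EnoughInjectives C]
    (hG : PreservesShortExact G) (p : ℕ)
    (θ : ∀ X : C, Ext U X p →ₗ[k] Ext (G.obj (op X)) (G.obj (op U)) p)
    (natural : ∀ {X X' : C} (f : X ⟶ X') (α : Ext U X p),
      θ X' (α.comp (Ext.mk₀ f) (add_zero p)) = (Ext.mk₀ (G.map f.op)).comp (θ X α) (zero_add p)) :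
    ∃ θ' : ∀ X : C, Ext U X (p + 1) →ₗ[k] Ext (G.obj (op X)) (G.obj (op U)) (p + 1),
      ∀ {S : ShortComplex C} (hS : S.ShortExact) {X : C} (f : S.X₁ ⟶ X) (α : Ext U S.X₃ p),
        θ' X ((α.comp hS.extClass rfl).comp (Ext.mk₀ f) (add_zero _)) =
          (Ext.mk₀ (G.map f.op)).comp ((hG.extClass hS).comp (θ _ α) (add_comm 1 p))
            (zero_add _) := by
  -- The extra morphism `f` makes one formula serve twice: `f = 𝟙` gives compatibility with
  -- connecting maps, and the chosen embedding of a source object gives naturality.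
  have key : ∀ X : C, ∃ g : Ext U X (p + 1) →ₗ[k] Ext (G.obj (op X)) (G.obj (op U)) (p + 1),
      ∀ {S : ShortComplex C} (hS : S.ShortExact) (f : S.X₁ ⟶ X) (α : Ext U S.X₃ p),
        g ((α.comp hS.extClass rfl).comp (Ext.mk₀ f) (add_zero _)) =
          (Ext.mk₀ (G.map f.op)).comp ((hG.extClass hS).comp (θ _ α) (add_comm 1 p))
            (zero_add _) := by
    intro X
    obtain ⟨I, Q, i, q, w, hI, hT⟩ := exists_shortExact_injective X
    have : Injective (ShortComplex.mk i q w).X₂ := hI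
    let δ : Ext U Q p →ₗ[k] Ext U X (p + 1) := hT.extClass.postcompOfLinear k U rfl
    have hδ : Function.Surjective δ := exists_comp_extClass_eq hT
    -- Over a field the surjection `δ` has a linear section, so the new map can be written down as
    -- `g ∘ s` and is linear at once.
    obtain ⟨s, hs⟩ := LinearMap.exists_rightInverse_of_surjective δ (LinearMap.range_eq_top.2 hδ)
    let g : Ext U Q p →ₗ[k] Ext (G.obj (op X)) (G.obj (op U)) (p + 1) :=
      Ext.precompOfLinear (hG.extClass hT) k _ (add_comm 1 p) ∘ₗ θ Q
    -- Independence of the preimage: `ker δ` comes from `Ext^p(U, I)`, and there naturality of `θ`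
    -- produces the factor `[G T] · G(q) = 0`.
    have hg : ∀ α, δ α = 0 → g α = 0 := by
      intro α hα
      obtain ⟨β, rfl⟩ := Ext.covariant_sequence_exact₃ _ hT α rfl hα
      change (hG.extClass hT).comp (θ Q _) (add_comm 1 p) = 0
      rw [natural]
      exact hG.comp_extClass hT _
    have hgs : ∀ α, g (s (δ α)) = g α := by
      intro α
      rw [← sub_eq_zero, ← map_sub]
      refine hg _ ?_
      rw [map_sub, sub_eq_zero]
      exact LinearMap.congr_fun hs _
    refine ⟨g ∘ₗ s, fun {S} hS f α => ?_⟩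
    have := hS.mono_f
    have := hS.epi_g
    -- Injectivity of `I` extends `f` to a morphism from `S` to the chosen sequence; naturality of
    -- extension classes on both sides then reduces `S` to that sequence.
    obtain ⟨a, ha⟩ : ∃ a : S.X₂ ⟶ I, S.f ≫ a = f ≫ i :=
      ⟨Injective.factorThru (f ≫ i) S.f, Injective.comp_factorThru _ _⟩
    obtain ⟨b, hb⟩ : ∃ b : S.X₃ ⟶ Q, S.g ≫ b = a ≫ q :=
      ⟨_, hS.gIsCokernel.fac (CokernelCofork.ofπ (a ≫ q)
        (by rw [reassoc_of% ha, w, comp_zero])) .one⟩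
    let φ : S ⟶ ShortComplex.mk i q w :=
      { τ₁ := f, τ₂ := a, τ₃ := b, comm₁₂ := ha.symm, comm₂₃ := hb.symm }
    have e : (α.comp hS.extClass rfl).comp (Ext.mk₀ f) (add_zero _) =
        δ (α.comp (Ext.mk₀ b) (add_zero p)) := by
      change _ = (α.comp (Ext.mk₀ b) (add_zero p)).comp hT.extClass rfl
      rw [Ext.comp_assoc_of_second_deg_zero, Ext.comp_assoc_of_third_deg_zero]
      exact congrArg (fun x => α.comp x rfl) (hS.extClass_naturality hT φ)
    rw [e, LinearMap.comp_apply, hgs]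
    change (hG.extClass hT).comp (θ Q _) (add_comm 1 p) = _
    rw [natural, ← Ext.comp_assoc_of_second_deg_zero]
    refine (congrArg (fun x => Ext.comp x (θ S.X₃ α) (add_comm 1 p))
      (hG.extClass_naturality hS hT φ)).trans ?_
    exact Ext.comp_assoc _ _ _ (zero_add 1) (add_comm 1 p) (by omega)
  choose θ' h using key
  exact ⟨θ', fun hS X f α => h X hS f α⟩

/-- The maps `Ext(U, X) → Ext(G X, G U)` are induced by the exact contravariant functor `G`. -/
structure IsContraExt (hG : PreservesShortExact G)
    (θ : ∀ (p : ℕ) (X : C), Ext U X p →ₗ[k] Ext (G.obj (op X)) (G.obj (op U)) p) : Prop where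
  zero : ∀ {X : C} (f : U ⟶ X), θ 0 X (Ext.mk₀ f) = Ext.mk₀ (G.map f.op)
  natural : ∀ {p : ℕ} {X X' : C} (f : X ⟶ X') (α : Ext U X p),
    θ p X' (α.comp (Ext.mk₀ f) (add_zero p)) =
      (Ext.mk₀ (G.map f.op)).comp (θ p X α) (zero_add p)
  connecting : ∀ {p : ℕ} {S : ShortComplex C} (hS : S.ShortExact) (α : Ext U S.X₃ p),
    θ (p + 1) S.X₁ (α.comp hS.extClass rfl) =
      (hG.extClass hS).comp (θ p S.X₃ α) (add_comm 1 p)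

/-- Recursion on the degree, starting from `f ↦ G f`. Additivity of `G` alone would give an additive
map in degree zero; `hlin` makes it `k`-linear, and the later degrees inherit this. -/
lemma exists_isContraExt [EnoughInjectives C]
    (hG : PreservesShortExact G)
    (hlin : ∀ (r : k) {X : C} (f : U ⟶ X), G.map (r • f).op = r • G.map f.op) :
    ∃ θ : ∀ (p : ℕ) (X : C), Ext U X p →ₗ[k] Ext (G.obj (op X)) (G.obj (op U)) p,
      IsContraExt U G hG θ := by
  -- Naturality is carried along in the recursion because the passage to the next degree is well
  -- defined only for a natural family.
  let Fam (p : ℕ) := { θ : ∀ X : C, Ext U X p →ₗ[k] Ext (G.obj (op X)) (G.obj (op U)) p //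
    ∀ {X X' : C} (f : X ⟶ X') (α : Ext U X p),
      θ X' (α.comp (Ext.mk₀ f) (add_zero p)) = (Ext.mk₀ (G.map f.op)).comp (θ X α) (zero_add p) }
  let base : Fam 0 := ⟨fun X =>
    { toFun α := Ext.mk₀ (G.map (Ext.homEquiv₀ α).op)
      map_add' α β := by
        have : Ext.homEquiv₀ (α + β) = Ext.homEquiv₀ α + Ext.homEquiv₀ β :=
          Ext.addEquiv₀.map_add α β
        rw [this, op_add, G.map_add, Ext.mk₀_add]
      map_smul' r α := by
        have : Ext.homEquiv₀ (r • α) = r • Ext.homEquiv₀ α :=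
          (Ext.linearEquiv₀ (R := k)).map_smul r α
        rw [this, hlin, Ext.mk₀_smul]
        rfl }, by
    intro X X' f α
    obtain ⟨α, rfl⟩ := Ext.homEquiv₀.symm.surjective α
    have e : Ext.homEquiv₀ ((Ext.homEquiv₀.symm α).comp (Ext.mk₀ f) (add_zero 0)) = α ≫ f := by
      exact (Ext.homEquiv₀.eq_symm_apply).1 (Ext.mk₀_comp_mk₀ _ _)
    change Ext.mk₀ _ = (Ext.mk₀ _).comp (Ext.mk₀ _) _
    rw [Ext.mk₀_comp_mk₀, e, Equiv.apply_symm_apply, op_comp, G.map_comp]⟩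
  have step : ∀ (p : ℕ) (θ : Fam p), ∃ θ' : Fam (p + 1),
      ∀ {S : ShortComplex C} (hS : S.ShortExact) (α : Ext U S.X₃ p),
        θ'.1 S.X₁ (α.comp hS.extClass rfl) =
          (hG.extClass hS).comp (θ.1 S.X₃ α) (add_comm 1 p) := by
    rintro p ⟨θ, hθ⟩
    obtain ⟨θ', h⟩ := exists_contraExt_succ U G hG p θ hθ
    have h' : ∀ {S : ShortComplex C} (hS : S.ShortExact) (α : Ext U S.X₃ p),
        θ' S.X₁ (α.comp hS.extClass rfl) =
          (hG.extClass hS).comp (θ S.X₃ α) (add_comm 1 p) := by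
      intro S hS α
      have := h hS (𝟙 _) α
      rwa [Ext.comp_mk₀_id, op_id, G.map_id, Ext.mk₀_id_comp] at this
    refine ⟨⟨θ', fun {X X'} f α => ?_⟩, h'⟩
    -- Naturality in the new degree: write the class as `β · [T]` and apply the formula once with
    -- `f` and once with the identity.
    obtain ⟨I, Q, i, q, w, hI, hT⟩ := exists_shortExact_injective X
    have : Injective (ShortComplex.mk i q w).X₂ := hI
    obtain ⟨β, rfl⟩ := exists_comp_extClass_eq hT α
    exact (h hT f β).trans (congrArg (fun x => (Ext.mk₀ (G.map f.op)).comp x (zero_add _))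
      (h' hT β).symm)
  choose next hnext using step
  let θ : ∀ p, Fam p := fun p => Nat.rec base next p
  refine ⟨fun p => (θ p).1, ⟨fun {X} f => ?_, fun {p} => (θ p).2, fun {p S} => hnext p (θ p)⟩⟩
  change Ext.mk₀ (G.map (Ext.homEquiv₀ (Ext.mk₀ f)).op) = _
  congr 3
  exact Ext.homEquiv₀.apply_symm_apply f

/-! ### Comparison of the extended maps of different functors -/

section Comparison

variable {U} [EnoughInjectives C]

/-- In degree zero this is naturality of `γ`. Shifting the degree multiplies by connecting classes,
along which `γ` passes since it is a morphism of the image sequences. Used for naturality of the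
pairing in `Y`. -/
lemma IsContraExt.natTrans {G G' : Cᵒᵖ ⥤ D} [G.Additive] [G'.Additive]
    {hG : PreservesShortExact G} {hG' : PreservesShortExact G'}
    {θ : ∀ (p : ℕ) (X : C), Ext U X p →ₗ[k] Ext (G.obj (op X)) (G.obj (op U)) p}
    {θ' : ∀ (p : ℕ) (X : C), Ext U X p →ₗ[k] Ext (G'.obj (op X)) (G'.obj (op U)) p}
    (h : IsContraExt U G hG θ) (h' : IsContraExt U G' hG' θ') (γ : G ⟶ G')
    {p : ℕ} {X : C} (α : Ext U X p) :
    (θ p X α).comp (Ext.mk₀ (γ.app (op U))) (add_zero p) =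
      (Ext.mk₀ (γ.app (op X))).comp (θ' p X α) (zero_add p) := by
  induction p generalizing X with
  | zero =>
    obtain ⟨f, rfl⟩ := (Ext.mk₀_bijective U X).2 α
    rw [h.zero, h'.zero, Ext.mk₀_comp_mk₀, Ext.mk₀_comp_mk₀, γ.naturality]
  | succ p ih =>
    obtain ⟨I, Q, i, q, w, hI, hS⟩ := exists_shortExact_injective X
    have : Injective (ShortComplex.mk i q w).X₂ := hI
    obtain ⟨β, rfl⟩ := exists_comp_extClass_eq hS α
    have n : (hG.extClass hS).comp (Ext.mk₀ (γ.app (op Q))) (add_zero 1) =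
        (Ext.mk₀ (γ.app (op X))).comp (hG'.extClass hS) (zero_add 1) :=
      ShortComplex.ShortExact.extClass_naturality (hG hS) (hG' hS)
        ((ShortComplex.mk i q w).op.mapNatTrans γ)
    have e := h.connecting hS β
    have e' := h'.connecting hS β
    dsimp only at e e'
    rw [e, e', Ext.comp_assoc_of_third_deg_zero, ih, ← Ext.comp_assoc_of_second_deg_zero, n,
      Ext.comp_assoc _ _ _ (zero_add 1) (add_comm 1 p) (by omega)]

/-- In degree zero both sides agree because a morphism `U ⟶ X` induces a morphism between the
sequences `c`. Each further degree moves the class of `c` past a connecting class, at the cost of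
one sign. Used for the connecting maps of the pairing in `Y`. -/
lemma IsContraExt.comp_extClass {G₁ G₂ G₃ : Cᵒᵖ ⥤ D} [G₁.Additive] [G₂.Additive] [G₃.Additive]
    {h₁ : PreservesShortExact G₁} (h₂ : PreservesShortExact G₂) {h₃ : PreservesShortExact G₃}
    {θ₁ : ∀ (p : ℕ) (X : C), Ext U X p →ₗ[k] Ext (G₁.obj (op X)) (G₁.obj (op U)) p}
    {θ₃ : ∀ (p : ℕ) (X : C), Ext U X p →ₗ[k] Ext (G₃.obj (op X)) (G₃.obj (op U)) p}
    (hθ₁ : IsContraExt U G₁ h₁ θ₁) (hθ₃ : IsContraExt U G₃ h₃ θ₃) (a : G₁ ⟶ G₂) (b : G₂ ⟶ G₃)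
    (w : ∀ X, a.app X ≫ b.app X = 0)
    (c : ∀ X, (ShortComplex.mk (a.app X) (b.app X) (w X)).ShortExact)
    {p : ℕ} {X : C} (α : Ext U X p) :
    (θ₃ p X α).comp (c (op U)).extClass rfl =
      (-1 : k) ^ p • (c (op X)).extClass.comp (θ₁ p X α) (add_comm 1 p) := by
  induction p generalizing X with
  | zero =>
    obtain ⟨f, rfl⟩ := (Ext.mk₀_bijective U X).2 α
    rw [hθ₁.zero, hθ₃.zero, pow_zero, one_smul]
    exact ((c (op X)).extClass_naturality (c (op U))
      { τ₁ := G₁.map f.op, τ₂ := G₂.map f.op, τ₃ := G₃.map f.op,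
        comm₁₂ := a.naturality _, comm₂₃ := b.naturality _ }).symm
  | succ p ih =>
    obtain ⟨I, Q, i, q, w', hI, hS⟩ := exists_shortExact_injective X
    have : Injective (ShortComplex.mk i q w').X₂ := hI
    obtain ⟨β, rfl⟩ := exists_comp_extClass_eq hS α
    -- The 3 × 3 diagram has as rows the images of `X → I → Q` under the three functors, and as
    -- columns the sequences `c` at the three objects.
    have n : (c (op X)).extClass.comp (h₁.extClass hS) (rfl : 1 + 1 = 2) =
        -(h₃.extClass hS).comp (c (op Q)).extClass rfl :=
      extClass_comp_extClass_anticomm ((ShortComplex.mk i q w').op.mapNatTrans a)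
        ((ShortComplex.mk i q w').op.mapNatTrans b) (w _) (w _) (w _) (h₁ hS) (h₂ hS) (h₃ hS)
        (c _) (c _) (c _)
    have e₁ := hθ₁.connecting hS β
    have e₃ := hθ₃.connecting hS β
    dsimp only at e₁ e₃
    rw [e₁, e₃, Ext.comp_assoc _ _ _ (add_comm 1 p) rfl (by omega), ih, Ext.comp_smul,
      ← Ext.comp_assoc _ _ _ (rfl : 1 + 1 = 2) (add_comm 1 p) (by omega),
      ← Ext.comp_assoc _ _ _ (rfl : 1 + 1 = 2) (add_comm 1 p) (by omega), n, Ext.neg_comp,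
      pow_succ, mul_neg_one, neg_smul, smul_neg, neg_neg]

end Comparison

end ContraExt

end HomologicalAlgebra

/-! ### Existence and uniqueness of the external pairing -/

section ExternalPairing

open CategoryTheory.Abelian

variable {k : Type u} [Field k]

/-- The isomorphism `diag Hom_k(k_•, Y) ≅ Y`, `ψ ↦ ψ(1)`, as a morphism. -/
noncomputable def diagHomEvalOne (Y : Lamᵒᵖ ⥤ ModuleCat.{u} k) :
    ((diagHom k).obj (op (trivialModule k Lam))).obj Y ⟶ Y where
  app a := ModuleCat.ofHom (LinearMap.applyₗ (R := k) (M := k) (M₂ := Y.obj a) 1)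
  naturality _ _ _ := rfl

lemma diagHomEvalOne_naturality {Y Y' : Lamᵒᵖ ⥤ ModuleCat.{u} k} (g : Y ⟶ Y') :
    ((diagHom k).obj (op (trivialModule k Lam))).map g ≫ diagHomEvalOne Y' =
      diagHomEvalOne Y ≫ g := rfl

variable (k) in
lemma preservesShortExact_diagHom (Y : Lamᵒᵖ ⥤ ModuleCat.{u} k) :
    PreservesShortExact ((diagHom k).flip.obj Y) :=
  fun _ hS => diagHom_shortExact_left k Y hS

variable (k) in
lemma exists_contraExt_diagHom (Y : Lamᵒᵖ ⥤ ModuleCat.{u} k) :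
    ∃ θ : ∀ (p : ℕ) (X : Lam ⥤ ModuleCat.{u} k), Ext (trivialModule k Lam) X p →ₗ[k]
        Ext (((diagHom k).obj (op X)).obj Y)
          (((diagHom k).obj (op (trivialModule k Lam))).obj Y) p,
      IsContraExt (trivialModule k Lam) ((diagHom k).flip.obj Y)
        (preservesShortExact_diagHom k Y) θ := by
  refine exists_isContraExt _ ((diagHom k).flip.obj Y) _ fun r X f => ?_
  ext a (ψ : X.obj a.unop →ₗ[k] Y.obj a)
  exact LinearMap.ext fun x => map_smul ψ _ _

/-- The external pairing `α ⊗ β ↦ diag Hom_k(α, Y) · ε · β`, `ε` being the evaluation at `1`. -/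
lemma exists_isExternalPairing :
    ∃ η : ∀ (p q : ℕ) (X : Lam ⥤ ModuleCat.{u} k) (Y : Lamᵒᵖ ⥤ ModuleCat.{u} k),
      cocyclicCohomology X p ⊗[k] cyclicCohomology Y q →ₗ[k]
        cyclicCohomology (((diagHom k).obj (op X)).obj Y) (p + q), IsExternalPairing η := by
  choose θ hθ using exists_contraExt_diagHom k
  let η (p q : ℕ) (X : Lam ⥤ ModuleCat.{u} k) (Y : Lamᵒᵖ ⥤ ModuleCat.{u} k) :
      cocyclicCohomology X p ⊗[k] cyclicCohomology Y q →ₗ[k]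
        cyclicCohomology (((diagHom k).obj (op X)).obj Y) (p + q) :=
    TensorProduct.lift ((Ext.bilinearCompOfLinear k _ _ _ p q (p + q) rfl ∘ₗ θ Y p X).compl₂
      (Ext.precompOfLinear (Ext.mk₀ (diagHomEvalOne Y)) k _ (zero_add q)))
  have hη {p q : ℕ} {X : Lam ⥤ ModuleCat.{u} k} {Y : Lamᵒᵖ ⥤ ModuleCat.{u} k}
      (α : cocyclicCohomology X p) (β : cyclicCohomology Y q) : η p q X Y (α ⊗ₜ β) =
        (θ Y p X α).comp ((Ext.mk₀ (diagHomEvalOne Y)).comp β (zero_add q)) rfl := rfl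
  refine ⟨η, ⟨?_, ?_, ?_, ?_, ?_⟩⟩
  · intro X Y f g
    rw [hη, (hθ Y).zero, Ext.mk₀_comp_mk₀]
    exact Ext.mk₀_comp_mk₀ _ _
  · intro p q X X' Y f α β
    rw [hη, hη, (hθ Y).natural]
    exact Ext.comp_assoc _ _ _ (zero_add p) rfl (by omega)
  · intro p q X Y Y' g α β
    -- The map `g` is a natural transformation of exact functors `diag Hom(-, Y) → diag Hom(-, Y')`;
    -- its component at `k_•` is then carried past the evaluation at 1.
    have h := (hθ Y).natTrans (hθ Y') ((diagHom k).flip.map g) α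
    have e : (Ext.mk₀ (diagHomEvalOne Y)).comp ((Ext.mk₀ g).comp β (zero_add q)) (zero_add q) =
        (Ext.mk₀ (((diagHom k).obj (op (trivialModule k Lam))).map g)).comp
          ((Ext.mk₀ (diagHomEvalOne Y')).comp β (zero_add q)) (zero_add q) := by
      rw [Ext.mk₀_comp_mk₀_assoc, Ext.mk₀_comp_mk₀_assoc, diagHomEvalOne_naturality]
    rw [hη, hη, e, ← Ext.comp_assoc_of_second_deg_zero]
    refine (congrArg (fun x => Ext.comp x _ rfl) h).trans ?_
    exact Ext.comp_assoc _ _ _ (zero_add p) rfl (by omega)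
  · intro p q S hS Y α β
    rw [hη, hη, (hθ Y).connecting]
    exact Ext.comp_assoc _ _ _ (add_comm 1 p) rfl (by omega)
  · intro p q X S hS α β
    -- The sequence `S` gives a short exact sequence of functors `diag Hom(-, S)`; this is where the
    -- sign `(-1)^p` enters.
    have h := IsContraExt.comp_extClass (preservesShortExact_diagHom k S.X₂) (hθ S.X₁) (hθ S.X₃)
      ((diagHom k).flip.map S.f) ((diagHom k).flip.map S.g)
      (fun X => (S.map ((diagHom k).obj X)).zero)
      (fun X => diagHom_shortExact_right k X.unop hS) α
    -- Evaluation at 1 is a morphism from the sequence `diag Hom(k_•, S)` to `S`, so it identifies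
    -- their connecting classes without a sign.
    have n := (diagHom_shortExact_right k (trivialModule k Lam) hS).extClass_naturality hS
      { τ₁ := diagHomEvalOne S.X₁, τ₂ := diagHomEvalOne S.X₂, τ₃ := diagHomEvalOne S.X₃,
        comm₁₂ := (diagHomEvalOne_naturality S.f).symm,
        comm₂₃ := (diagHomEvalOne_naturality S.g).symm }
    have e : (Ext.mk₀ (diagHomEvalOne S.X₃)).comp (hS.extClass.comp β (add_comm 1 q))
          (zero_add _) =
        (diagHom_shortExact_right k (trivialModule k Lam) hS).extClass.comp
          ((Ext.mk₀ (diagHomEvalOne S.X₁)).comp β (zero_add q)) (add_comm 1 q) := by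
      refine (Ext.comp_assoc _ _ _ (zero_add 1) (add_comm 1 q) (by omega)).symm.trans ?_
      refine (congrArg (fun x => Ext.comp x β (add_comm 1 q)) n.symm).trans ?_
      exact Ext.comp_assoc_of_second_deg_zero _ _ _ _
    rw [hη, hη, e]
    refine (Ext.comp_assoc _ _ _ rfl (add_comm 1 q) (by omega)).symm.trans ?_
    refine (congrArg (fun x => Ext.comp x _ (by omega)) h).trans ?_
    refine (Ext.smul_comp _ _ _ _).trans (congrArg _ ?_)
    exact Ext.comp_assoc _ _ _ (add_comm 1 p) rfl (by omega)

/-- An external pairing is determined by its values in bidegree `(0, 0)`. -/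
lemma IsExternalPairing.unique
    {η η' : ∀ (p q : ℕ) (X : Lam ⥤ ModuleCat.{u} k) (Y : Lamᵒᵖ ⥤ ModuleCat.{u} k),
      cocyclicCohomology X p ⊗[k] cyclicCohomology Y q →ₗ[k]
        cyclicCohomology (((diagHom k).obj (op X)).obj Y) (p + q)}
    (h : IsExternalPairing η) (h' : IsExternalPairing η') {p q : ℕ}
    {X : Lam ⥤ ModuleCat.{u} k} {Y : Lamᵒᵖ ⥤ ModuleCat.{u} k}
    (α : cocyclicCohomology X p) (β : cyclicCohomology Y q) :
    η p q X Y (α ⊗ₜ β) = η' p q X Y (α ⊗ₜ β) := by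
  induction p generalizing X with
  | zero =>
    obtain ⟨f, rfl⟩ := (Ext.mk₀_bijective _ _).2 α
    induction q generalizing Y with
    | zero =>
      obtain ⟨g, rfl⟩ := (Ext.mk₀_bijective _ _).2 β
      rw [h.zero, h'.zero]
    | succ q ih =>
      -- The target of `β` is fixed as `k_•`, so the degree must be lowered at the source:
      -- naturality removes `g` and compatibility with `S` removes its class.
      obtain ⟨S, hS, g, β, rfl⟩ := exists_mk₀_comp_extClass_comp_eq β
      rw [h.natural_right, h'.natural_right, h.connecting_right, h'.connecting_right, ih]
  | succ p ih =>
    -- In the first variable `X` is free to vary, and the embedding in an injective lowers the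
    -- degree directly.
    obtain ⟨I, Q, i, r, w, hI, hS⟩ := exists_shortExact_injective X
    have : Injective (ShortComplex.mk i r w).X₂ := hI
    obtain ⟨α, rfl⟩ := exists_comp_extClass_eq hS α
    have e := h.connecting_left hS α β
    have e' := h'.connecting_left hS α β
    rw [ih] at e
    exact e.trans e'.symm

end ExternalPairing

/-! ### The rotations and the diagonal action on words -/

section DiagonalAction

variable {k : Type u} [Field k] {H : Type u} [Ring H] [HopfAlgebra k H]
  {C : Type u} [AddCommGroup C] [Module k C] [Module H C] [IsScalarTower k H C]
  {W W' : Type u} [AddCommGroup W] [Module k W] [AddCommGroup W'] [Module k W']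

/-- The inductive step of the two commutation lemmas below: an operator that commutes with `H` on
the tail still does so after a factor is put in front. A general tensor `t` stands in for `Δ(h)`. -/
lemma lTensor_map₂_smulMap {D : H →ₗ[k] W →ₗ[k] W} {D' : H →ₗ[k] W' →ₗ[k] W'} {f : W →ₗ[k] W'}
    (hf : ∀ h w, f (D h w) = D' h (f w)) (t : H ⊗[k] H) (y : C ⊗[k] W) :
    f.lTensor C (TensorProduct.map₂ (smulMap k H C) D t y) =
      TensorProduct.map₂ (smulMap k H C) D' t (f.lTensor C y) := by
  induction t with
  | zero => simp
  | add t t' ht ht' => simp only [map_add, LinearMap.add_apply, ht, ht']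
  | tmul h h' =>
    induction y with
    | zero => simp
    | add y y' hy hy' => simp only [map_add, hy, hy']
    | tmul c w => simp [hf]

variable [Coalgebra k C] [IsModuleCoalgebra k H C]

/-- By `Δ(h(c)) = h₍₁₎(c₍₁₎) ⊗ h₍₂₎(c₍₂₎)` both sides apply an iterated coproduct of `h` to `c₍₁₎ ⊗
c₍₂₎ ⊗ w`, in its two bracketings; coassociativity of `H` identifies them. The map `L` is this
common evaluation. -/
lemma splitHead_map₂_comul (D : H →ₗ[k] W →ₗ[k] W) (h : H) (y : C ⊗[k] W) :
    splitHead k C W (TensorProduct.map₂ (smulMap k H C) D (Coalgebra.comul h) y) =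
      TensorProduct.map₂ (smulMap k H C)
        (TensorProduct.map₂ (smulMap k H C) D ∘ₗ Coalgebra.comul) (Coalgebra.comul h)
        (splitHead k C W y) := by
  induction y with
  | zero => simp
  | add y y' hy hy' => simp only [map_add, hy, hy']
  | tmul c w =>
    let L : C ⊗[k] C →ₗ[k] H ⊗[k] (H ⊗[k] H) →ₗ[k] C ⊗[k] (C ⊗[k] W) :=
      (TensorProduct.map₂ (smulMap k H C) (TensorProduct.map₂ (smulMap k H C) D)).flip ∘ₗ
        (TensorProduct.assoc k C C W).toLinearMap ∘ₗ (TensorProduct.mk k (C ⊗[k] C) W).flip w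
    have h₁ : ∀ t : H ⊗[k] H, splitHead k C W (TensorProduct.map₂ (smulMap k H C) D t (c ⊗ₜ w)) =
        L (Coalgebra.comul c)
          (TensorProduct.assoc k H H H (LinearMap.rTensor H Coalgebra.comul t)) := by
      intro t
      induction t with
      | zero => simp
      | add t t' ht ht' => simp only [map_add, LinearMap.add_apply, ht, ht']
      | tmul h h' =>
        simp only [TensorProduct.map₂_apply_tmul, splitHead, LinearMap.comp_apply,
          TensorProduct.map_tmul, LinearMap.rTensor_tmul, LinearEquiv.coe_coe]
        rw [show smulMap k H C h c = h • c from rfl, IsModuleCoalgebra.comul_smul]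
        generalize (Coalgebra.comul h : H ⊗[k] H) = s
        generalize (Coalgebra.comul c : C ⊗[k] C) = x
        induction s with
        | zero => simp
        | add s s' hs hs' =>
          simp only [map_add, LinearMap.add_apply, TensorProduct.add_tmul, hs, hs']
        | tmul a b =>
          induction x with
          | zero => simp
          | add x x' hx hx' =>
            simp only [map_add, LinearMap.add_apply, TensorProduct.add_tmul, hx, hx']
          | tmul x x' => simp [L]
    have h₂ : ∀ t : H ⊗[k] H, TensorProduct.map₂ (smulMap k H C)
          (TensorProduct.map₂ (smulMap k H C) D ∘ₗ Coalgebra.comul) t (splitHead k C W (c ⊗ₜ w)) =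
        L (Coalgebra.comul c) (LinearMap.lTensor H Coalgebra.comul t) := by
      intro t
      induction t with
      | zero => simp
      | add t t' ht ht' => simp only [map_add, LinearMap.add_apply, ht, ht']
      | tmul h h' =>
        simp only [splitHead, LinearMap.comp_apply, LinearMap.rTensor_tmul, LinearEquiv.coe_coe]
        generalize (Coalgebra.comul c : C ⊗[k] C) = x
        induction x with
        | zero => simp
        | add x x' hx hx' =>
          simp only [map_add, LinearMap.add_apply, TensorProduct.add_tmul, hx, hx']
        | tmul x x' => simp [L]
    rw [h₁, h₂, Coalgebra.coassoc_apply]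

/-- The left side is `ε(h₍₁₎) ε(c) D(h₍₂₎)(w)`, and the counit axiom of `H` contracts the two
factors of `Δ(h)`. -/
lemma dropHead_map₂_comul (D : H →ₗ[k] W →ₗ[k] W) (h : H) (y : C ⊗[k] W) :
    dropHead k C W (TensorProduct.map₂ (smulMap k H C) D (Coalgebra.comul h) y) =
      D h (dropHead k C W y) := by
  induction y with
  | zero => simp
  | add y y' hy hy' => simp only [map_add, hy, hy']
  | tmul c w =>
    have h₁ : ∀ t : H ⊗[k] H, dropHead k C W (TensorProduct.map₂ (smulMap k H C) D t (c ⊗ₜ w)) =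
        Coalgebra.counit (R := k) c •
          D (TensorProduct.lid k H (LinearMap.rTensor H Coalgebra.counit t)) w := by
      intro t
      induction t with
      | zero => simp
      | add t t' ht ht' => simp only [map_add, LinearMap.add_apply, ht, ht', smul_add]
      | tmul h h' =>
        simp [smulMap, IsModuleCoalgebra.counit_smul, smul_smul, mul_comm]
    rw [h₁, Coalgebra.rTensor_counit_comul, TensorProduct.lid_tmul, one_smul, dropHead_tmul,
      map_smul]

variable {M : Type u} [AddCommGroup M] [Module k M] [Module H M] [IsScalarTower k H M]

/-- Needed so that the relations making `H` act through `ε` are preserved by cofaces; for indices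
out of range both sides are zero. -/
lemma splitAt_diagAct (n j : ℕ) (h : H) (y : Words k C M (n + 1)) :
    splitAt k C M n j (diagAct k H C M (n + 1) h y) =
      diagAct k H C M (n + 2) h (splitAt k C M n j y) := by
  induction n generalizing j h with
  | zero =>
    cases j with
    | zero => exact splitHead_map₂_comul _ _ _
    | succ j => exact (map_zero (diagAct k H C M 2 h)).symm
  | succ n ih =>
    cases j with
    | zero => exact splitHead_map₂_comul _ _ _
    | succ j => exact lTensor_map₂_smulMap (fun h y => ih j h y) _ _

lemma dropAt_diagAct (n j : ℕ) (h : H) (y : Words k C M (n + 1)) :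
    dropAt k C M n j (diagAct k H C M (n + 1) h y) =
      diagAct k H C M n h (dropAt k C M n j y) := by
  induction n generalizing j h with
  | zero =>
    cases j with
    | zero => exact dropHead_map₂_comul _ _ _
    | succ j => exact (map_zero (diagAct k H C M 0 h)).symm
  | succ n ih =>
    cases j with
    | zero => exact dropHead_map₂_comul _ _ _
    | succ j => exact lTensor_map₂_smulMap (fun h y => ih j h y) _ _

end DiagonalAction

/-! ### Moving cofaces and codegeneracies past powers of the rotation -/

section RotationPowers

variable {k : Type u} [Field k] {C : Type u} [AddCommGroup C] [Module k C] [Coalgebra k C]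
  {M : Type u} [AddCommGroup M] [Module k M] {R : C ⊗[k] M →ₗ[k] C ⊗[k] M}

lemma splitAt_eq_zero (n j : ℕ) (hj : n < j) : splitAt k C M n j = 0 := by
  induction n generalizing j with
  | zero =>
    obtain ⟨j, rfl⟩ : ∃ j', j = j' + 1 := ⟨j - 1, by omega⟩
    rfl
  | succ n ih =>
    obtain ⟨j, rfl⟩ : ∃ j', j = j' + 1 := ⟨j - 1, by omega⟩
    rw [splitAt_succ, ih j (by omega)]
    exact LinearMap.lTensor_zero _

lemma dropAt_eq_zero (n j : ℕ) (hj : n < j) : dropAt k C M n j = 0 := by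
  induction n generalizing j with
  | zero =>
    obtain ⟨j, rfl⟩ : ∃ j', j = j' + 1 := ⟨j - 1, by omega⟩
    rfl
  | succ n ih =>
    obtain ⟨j, rfl⟩ : ∃ j', j = j' + 1 := ⟨j - 1, by omega⟩
    rw [dropAt_succ, ih j (by omega)]
    exact LinearMap.lTensor_zero _

lemma splitAt_rot_pow (n j i : ℕ) (h : j + i ≤ n) :
    splitAt k C M n j ∘ₗ (rot k R n ^ i) = (rot k R (n + 1) ^ i) ∘ₗ splitAt k C M n (j + i) := by
  induction i generalizing j with
  | zero => rfl
  | succ i ih =>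
    rw [pow_succ', Module.End.mul_eq_comp, ← LinearMap.comp_assoc, splitAt_rot n j (by omega),
      LinearMap.comp_assoc, ih (j + 1) (by omega), pow_succ', Module.End.mul_eq_comp,
      LinearMap.comp_assoc, show j + 1 + i = j + (i + 1) by omega]

lemma dropAt_rot_pow (n j i : ℕ) (h : j + i ≤ n + 1) :
    dropAt k C M (n + 1) j ∘ₗ (rot k R (n + 1) ^ i) =
      (rot k R n ^ i) ∘ₗ dropAt k C M (n + 1) (j + i) := by
  induction i generalizing j with
  | zero => rfl
  | succ i ih =>
    rw [pow_succ', Module.End.mul_eq_comp, ← LinearMap.comp_assoc, dropAt_rot n j (by omega),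
      LinearMap.comp_assoc, ih (j + 1) (by omega), pow_succ', Module.End.mul_eq_comp,
      LinearMap.comp_assoc, show j + 1 + i = j + (i + 1) by omega]

lemma pow_apply_of_eq {V : Type u} [AddCommGroup V] [Module k V] (f : Module.End k V) {a b c : ℕ}
    (h : a = b + (1 + c)) (z : V) : (f ^ a) z = (f ^ b) (f ((f ^ c) z)) := by
  rw [h, pow_add, pow_add, pow_one, Module.End.mul_apply, Module.End.mul_apply]

/-- Factor the full turn as `t^(n-j) · t · t^j`. The first block moves the split from position `j`
to `n`, the middle rotation wraps it around to `0` and becomes `t²`, and the last block returns it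
to `j`; this accounts for the exponent `n + 2`. -/
lemma splitAt_rot_pow_succ (hR : IsCoalgebraTwist R) (n j : ℕ) (h : j ≤ n) :
    splitAt k C M n j ∘ₗ (rot k R n ^ (n + 1)) =
      (rot k R (n + 1) ^ (n + 2)) ∘ₗ splitAt k C M n j := by
  have h₁ := splitAt_rot_pow (R := R) n j (n - j) (by omega)
  have h₂ := splitAt_rot_last hR n
  have h₃ := splitAt_rot_pow (R := R) n 0 j (by omega)
  rw [show j + (n - j) = n by omega] at h₁
  rw [zero_add] at h₃
  refine LinearMap.ext fun y => ?_
  have e₁ := LinearMap.congr_fun h₁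
  have e₂ := LinearMap.congr_fun h₂
  have e₃ := LinearMap.congr_fun h₃
  simp only [LinearMap.comp_apply] at e₁ e₂ e₃ ⊢
  rw [pow_apply_of_eq (rot k R n) (show n + 1 = (n - j) + (1 + j) by omega), e₁, e₂, e₃,
    pow_apply_of_eq (rot k R (n + 1)) (show n + 2 = (n - j) + (1 + (1 + j)) by omega),
    pow_add _ 1 j, pow_one, Module.End.mul_apply]

/-- The same circuit, `t^(n+1-j) · t · t^j`; here the wrap-around rotation disappears with the
dropped factor, leaving `n + 1`. -/
lemma dropAt_rot_pow_succ (hR : IsCoalgebraTwist R) (n j : ℕ) (h : j ≤ n + 1) :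
    dropAt k C M (n + 1) j ∘ₗ (rot k R (n + 1) ^ (n + 2)) =
      (rot k R n ^ (n + 1)) ∘ₗ dropAt k C M (n + 1) j := by
  have h₁ := dropAt_rot_pow (R := R) n j (n + 1 - j) (by omega)
  have h₂ := dropAt_rot_last hR (n + 1)
  have h₃ := dropAt_rot_pow (R := R) n 0 j (by omega)
  rw [show j + (n + 1 - j) = n + 1 by omega] at h₁
  rw [zero_add] at h₃
  refine LinearMap.ext fun y => ?_
  have e₁ := LinearMap.congr_fun h₁
  have e₂ := LinearMap.congr_fun h₂
  have e₃ := LinearMap.congr_fun h₃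
  simp only [LinearMap.comp_apply] at e₁ e₂ e₃ ⊢
  have e : ∀ z, (rot k R n ^ (n + 1)) z = (rot k R n ^ (n + 1 - j)) ((rot k R n ^ j) z) := by
    intro z
    rw [← Module.End.mul_apply, ← pow_add, Nat.sub_add_cancel h]
  rw [pow_apply_of_eq (rot k R (n + 1)) (show n + 2 = (n + 1 - j) + (1 + j) by omega), e, e₁, e₂,
    e₃]

/-- For arbitrary powers, possibly many full turns, only the shape matters: each rotation advances
the position, and at the last position it wraps to `0` and leaves two rotations behind. -/
lemma exists_splitAt_rot_pow (hR : IsCoalgebraTwist R) (n j i : ℕ) (h : j ≤ n) :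
    ∃ i' j', j' ≤ n ∧ ∀ y, splitAt k C M n j ((rot k R n ^ i) y) =
      (rot k R (n + 1) ^ i') (splitAt k C M n j' y) := by
  induction i generalizing j with
  | zero => exact ⟨0, j, h, fun y => rfl⟩
  | succ i ih =>
    rcases h.lt_or_eq with hj | rfl
    · obtain ⟨i', j', h', e⟩ := ih (j + 1) (by omega)
      refine ⟨i' + 1, j', h', fun y => ?_⟩
      have := LinearMap.congr_fun (splitAt_rot (R := R) n j hj)
      simp only [LinearMap.comp_apply] at this
      rw [pow_succ', Module.End.mul_apply, this, e, pow_succ', Module.End.mul_apply]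
    · obtain ⟨i', j', h', e⟩ := ih 0 (by omega)
      refine ⟨i' + 2, j', h', fun y => ?_⟩
      have := LinearMap.congr_fun (splitAt_rot_last hR j)
      simp only [LinearMap.comp_apply] at this
      rw [pow_succ', Module.End.mul_apply, this, e, pow_succ', pow_succ', Module.End.mul_apply,
        Module.End.mul_apply]

lemma exists_dropAt_rot_pow (hR : IsCoalgebraTwist R) (n j i : ℕ) (h : j ≤ n + 1) :
    ∃ i' j', j' ≤ n + 1 ∧ ∀ y, dropAt k C M (n + 1) j ((rot k R (n + 1) ^ i) y) =
      (rot k R n ^ i') (dropAt k C M (n + 1) j' y) := by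
  induction i generalizing j with
  | zero => exact ⟨0, j, h, fun y => rfl⟩
  | succ i ih =>
    rcases h.lt_or_eq with hj | rfl
    · obtain ⟨i', j', h', e⟩ := ih (j + 1) (by omega)
      refine ⟨i' + 1, j', h', fun y => ?_⟩
      have := LinearMap.congr_fun (dropAt_rot (R := R) n j (by omega))
      simp only [LinearMap.comp_apply] at this
      rw [pow_succ', Module.End.mul_apply, this, e, pow_succ', Module.End.mul_apply]
    · obtain ⟨i', j', h', e⟩ := ih 0 (by omega)
      refine ⟨i', j', h', fun y => ?_⟩
      have := LinearMap.congr_fun (dropAt_rot_last hR (n + 1))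
      simp only [LinearMap.comp_apply] at this
      rw [pow_succ', Module.End.mul_apply, this, e]

end RotationPowers

/-! ### An explicit bound for the kernel on the coalgebra side -/

section Kernel

variable {k : Type u} [Field k] {H : Type u} [Ring H] [HopfAlgebra k H]
  {C M : Type u} [AddCommGroup C] [Module k C] [Module H C]
  [IsScalarTower k H C]
  [AddCommGroup M] [Module k M] [Module H M] [IsScalarTower k H M] [LeftComodule k H M]

variable (k H C M) in
/-- The submodule generated by the rotations of the relations. -/
noncomputable def rotSpan (n : ℕ) : Submodule k (Words k C M (n + 1)) :=
  Submodule.span k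
    {y | ∃ (i : ℕ), ∃ z ∈ hopfRel k H C M n, y = (rot k (coactTwist k H C M) n ^ i) z}

lemma rotSpan_le_comap {n m : ℕ} {f : Words k C M (n + 1) →ₗ[k] Words k C M (m + 1)}
    (hf : ∀ (i : ℕ), ∀ z ∈ hopfRel k H C M n,
      f ((rot k (coactTwist k H C M) n ^ i) z) ∈ rotSpan k H C M m) :
    rotSpan k H C M n ≤ (rotSpan k H C M m).comap f := by
  refine Submodule.span_le.2 ?_
  rintro _ ⟨i, z, hz, rfl⟩
  exact hf i z hz

variable [Coalgebra k C] [IsModuleCoalgebra k H C]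

/-- A relation goes to the relation of the same kind for the split word: splitting commutes with the
action of `H` and takes a full turn to a full turn. -/
lemma splitAt_mem_hopfRel (n j : ℕ) (hj : j ≤ n) {y : Words k C M (n + 1)}
    (hy : y ∈ hopfRel k H C M n) : splitAt k C M n j y ∈ hopfRel k H C M (n + 1) := by
  rcases hy with ⟨h, x, rfl⟩ | ⟨x, rfl⟩
  · refine Or.inl ⟨h, splitAt k C M n j x, ?_⟩
    rw [map_sub, splitAt_diagAct, map_smul]
  · refine Or.inr ⟨splitAt k C M n j x, ?_⟩
    rw [map_sub]
    exact congrArg (· - _)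
      (LinearMap.congr_fun (splitAt_rot_pow_succ isCoalgebraTwist_coactTwist n j hj) x)

lemma dropAt_mem_hopfRel (n j : ℕ) (hj : j ≤ n + 1) {y : Words k C M (n + 2)}
    (hy : y ∈ hopfRel k H C M (n + 1)) : dropAt k C M (n + 1) j y ∈ hopfRel k H C M n := by
  rcases hy with ⟨h, x, rfl⟩ | ⟨x, rfl⟩
  · refine Or.inl ⟨h, dropAt k C M (n + 1) j x, ?_⟩
    rw [map_sub, dropAt_diagAct, map_smul]
  · refine Or.inr ⟨dropAt k C M (n + 1) j x, ?_⟩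
    rw [map_sub]
    exact congrArg (· - _)
      (LinearMap.congr_fun (dropAt_rot_pow_succ isCoalgebraTwist_coactTwist n j hj) x)

/-- A coface or codegeneracy of a rotated relation is a rotation of a coface or codegeneracy of that
relation, and the latter is again a relation. So no element beyond the rotated relations is
produced, and by minimality the kernel is contained in their span. -/
lemma isAdmissible_rotSpan : (coalgebraOperators k H C M).IsAdmissible (rotSpan k H C M) where
  rel n x hx :=
    (Submodule.subset_span ⟨0, x, hx, rfl⟩ : (x : Words k C M (n + 1)) ∈ rotSpan k H C M n)
  t n x hx := by
    refine rotSpan_le_comap (f := rot k (coactTwist k H C M) n) (fun i z hz => ?_) hx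
    refine Submodule.subset_span ⟨i + 1, z, hz, ?_⟩
    rw [pow_succ', Module.End.mul_apply]
  up n j x hx := by
    refine rotSpan_le_comap (f := splitAt k C M n j) (fun i z hz => ?_) hx
    -- Admissibility quantifies over all indices; out of range the operator is zero.
    by_cases hj : j ≤ n
    · obtain ⟨i', j', h', e⟩ :=
        exists_splitAt_rot_pow (M := M) (isCoalgebraTwist_coactTwist (k := k) (H := H) (C := C))
          n j i hj
      rw [e]
      exact Submodule.subset_span ⟨i', _, splitAt_mem_hopfRel n j' h' hz, rfl⟩
    · rw [splitAt_eq_zero n j (by omega)]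
      exact Submodule.zero_mem _
  down n j x hx := by
    refine rotSpan_le_comap (n := n + 1) (f := dropAt k C M (n + 1) (j + 1)) (fun i z hz => ?_) hx
    by_cases hj : j + 1 ≤ n + 1
    -- Passing the rotations can bring the index to `0`, which is not among the lowering operators;
    -- dropping that factor preserves the relations all the same.
    · obtain ⟨i', j', h', e⟩ := exists_dropAt_rot_pow (M := M)
        (isCoalgebraTwist_coactTwist (k := k) (H := H) (C := C)) n (j + 1) i hj
      rw [e]
      exact Submodule.subset_span ⟨i', _, dropAt_mem_hopfRel n j' h' hz, rfl⟩
    · rw [dropAt_eq_zero (n + 1) (j + 1) (by omega)]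
      exact Submodule.zero_mem _

lemma ker_coalgebraOperators_le (n : ℕ) :
    (coalgebraOperators k H C M).ker n ≤ rotSpan k H C M n :=
  fun _ hx => (OperatorModule.mem_ker _).1 hx _ isAdmissible_rotSpan

end Kernel

/-! ### The action of words in `C` on words in `A` -/

section ActWords

variable {k : Type u} [Field k] {A C : Type u} [Ring A] [Algebra k A] [AddCommGroup C] [Module k C]
  (act : C →ₗ[k] A →ₗ[k] A) (M : Type u) [AddCommGroup M] [Module k M]

/-- The map `a₀ ⊗ ⋯ ⊗ a_{n-1} ↦ (c₀ ⊗ ⋯ ⊗ c_{n-1} ⊗ m ↦ c₀ ▷ a₀ ⊗ ⋯ ⊗ c_{n-1} ▷ a_{n-1} ⊗ m)`. -/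
noncomputable def actWords : ∀ n : ℕ, Words k A k n →ₗ[k] Words k C M n →ₗ[k] Words k A M n
  | 0 => LinearMap.lsmul k M
  | n + 1 => TensorProduct.map₂ act.flip (actWords n)

lemma actWords_word (n : ℕ) (a : Fin n → A) (c : Fin n → C) (m : M) :
    actWords act M n (word k n a 1) (word k n c m) = word k n (fun i => act (c i) (a i)) m := by
  induction n with
  | zero => exact one_smul k m
  | succ n ih =>
    exact congrArg (fun y : Words k A M n => (act (c 0) (a 0) ⊗ₜ[k] y : A ⊗[k] Words k A M n))
      (ih _ _)

variable {M}

section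

variable {W W' V V' X X' : Type u} [AddCommGroup W] [Module k W] [AddCommGroup W'] [Module k W']
  [AddCommGroup V] [Module k V] [AddCommGroup V'] [Module k V'] [AddCommGroup X] [Module k X]
  [AddCommGroup X'] [Module k X']

/-- The inductive step for `actWords_rot`: the moved factors `a` and `c` meet only inside `ρ` and
`ρ'`, while those they pass are paired with each other. -/
lemma map₂_rotStep {B : W →ₗ[k] V →ₗ[k] X} {B' : W' →ₗ[k] V' →ₗ[k] X'}
    {ρ : A ⊗[k] W →ₗ[k] W'} {ρ' : C ⊗[k] V →ₗ[k] V'} {ρ'' : A ⊗[k] X →ₗ[k] X'}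
    (h : ∀ x y, B' (ρ x) (ρ' y) = ρ'' (TensorProduct.map₂ act.flip B x y))
    (x : A ⊗[k] (A ⊗[k] W)) (y : C ⊗[k] (C ⊗[k] V)) :
    TensorProduct.map₂ act.flip B' (rotStep k ρ x) (rotStep k ρ' y) =
      rotStep k ρ'' (TensorProduct.map₂ act.flip (TensorProduct.map₂ act.flip B) x y) := by
  suffices e : ((TensorProduct.map₂ act.flip B').compl₂ (rotStep k ρ')) ∘ₗ (rotStep k ρ) =
      (TensorProduct.map₂ act.flip (TensorProduct.map₂ act.flip B)).compr₂ (rotStep k ρ'') from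
    LinearMap.congr_fun (LinearMap.congr_fun e x) y
  ext a b w c d v
  simp [rotStep, h]

end

end ActWords

/-! ### Compatibility of the action on words with all operators, and descent to the quotients -/

section ActWordsOperators

variable {k : Type u} [Field k] {H : Type u} [Ring H]
  {A C M : Type u} [Ring A] [Algebra k A] [Module H A]
  [AddCommGroup C] [Module k C] [Coalgebra k C] [Module H C]
  [AddCommGroup M] [Module k M] {act : C →ₗ[k] A →ₗ[k] A}

section

variable {W V X : Type u} [AddCommGroup W] [Module k W] [AddCommGroup V] [Module k V]
  [AddCommGroup X] [Module k X]

/-- This is `c ▷ (a b) = (c₍₁₎ ▷ a)(c₍₂₎ ▷ b)`: a coface on `C`, followed by the action and a face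
on the result, amounts to a face on the word in `A`. -/
lemma mulHead_map₂_splitHead (hact : IsEquivariantAction k H act)
    (B : W →ₗ[k] V →ₗ[k] X) (x : A ⊗[k] (A ⊗[k] W)) (y : C ⊗[k] V) :
    mulHead k A X (TensorProduct.map₂ act.flip (TensorProduct.map₂ act.flip B) x
      (splitHead k C V y)) = TensorProduct.map₂ act.flip B (mulHead k A W x) y := by
  suffices e : ((TensorProduct.map₂ act.flip (TensorProduct.map₂ act.flip B)).compl₂
      (splitHead k C V)).compr₂ (mulHead k A X) =
      (TensorProduct.map₂ act.flip B) ∘ₗ (mulHead k A W) from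
    LinearMap.congr_fun (LinearMap.congr_fun e x) y
  ext a b w c v
  have r := Coalgebra.Repr.arbitrary k c
  have e : act c (a * b) = ∑ i ∈ r.index, act (r.left i) a * act (r.right i) b := by
    rw [hact.act_mul, ← r.eq]
    simp
  simp [splitHead_tmul r, e, TensorProduct.sum_tmul]

/-- This is `c ▷ 1 = ε(c) 1`: inserting 1 into the word in `A` makes the matching factor of `C` act
through its counit. -/
lemma oneHead_dropHead (hact : IsEquivariantAction k H act)
    (B : W →ₗ[k] V →ₗ[k] X) (x : W) (y : C ⊗[k] V) :
    TensorProduct.map₂ act.flip B (oneHead k A W x) y =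
      oneHead k A X (B x (dropHead k C V y)) := by
  suffices e : (TensorProduct.map₂ act.flip B (oneHead k A W x)) =
      oneHead k A X ∘ₗ B x ∘ₗ dropHead k C V from LinearMap.congr_fun e y
  ext c v
  simp [hact.act_one, TensorProduct.smul_tmul]

end

lemma mulAt_actWords_splitAt (hact : IsEquivariantAction k H act)
    (n j : ℕ) (x : Words k A k (n + 2)) (y : Words k C M (n + 1)) :
    mulAt k A M n j (actWords act M (n + 2) x (splitAt k C M n j y)) =
      actWords act M (n + 1) (mulAt k A k n j x) y := by
  induction n generalizing j with
  | zero =>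
    cases j with
    | zero => exact mulHead_map₂_splitHead hact _ _ _
    | succ j =>
      exact ((congrArg (fun f : _ →ₗ[k] _ => f y) (map_zero (actWords act M 1))).trans rfl).symm
  | succ n ih =>
    cases j with
    | zero => exact mulHead_map₂_splitHead hact _ _ _
    | succ j =>
      suffices e : ((actWords act M (n + 3)).compl₂ ((splitAt k C M n j).lTensor C)).compr₂
          ((mulAt k A M n j).lTensor A) =
          (actWords act M (n + 2)) ∘ₗ ((mulAt k A k n j).lTensor A) from
        LinearMap.congr_fun (LinearMap.congr_fun e x) y
      refine TensorProduct.ext' fun a w => ?_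
      refine TensorProduct.ext' fun c v => ?_
      exact congrArg (fun z : Words k A M (n + 1) => (act c a ⊗ₜ[k] z : A ⊗[k] Words k A M (n + 1)))
        (ih j w v)

lemma actWords_oneAt (hact : IsEquivariantAction k H act)
    (n j : ℕ) (x : Words k A k n) (y : Words k C M (n + 1)) :
    actWords act M (n + 1) (oneAt k A k n j x) y =
      oneAt k A M n j (actWords act M n x (dropAt k C M n j y)) := by
  induction n generalizing j with
  | zero =>
    cases j with
    | zero => exact oneHead_dropHead hact _ _ _
    | succ j =>
      exact (congrArg (fun f : _ →ₗ[k] _ => f y) (map_zero (actWords act M 1))).trans rfl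
  | succ n ih =>
    cases j with
    | zero => exact oneHead_dropHead hact _ _ _
    | succ j =>
      suffices e : (actWords act M (n + 2)) ∘ₗ ((oneAt k A k n j).lTensor A) =
          ((actWords act M (n + 1)).compl₂ ((dropAt k C M n j).lTensor C)).compr₂
          ((oneAt k A M n j).lTensor A) from
        LinearMap.congr_fun (LinearMap.congr_fun e x) y
      refine TensorProduct.ext' fun a w => ?_
      refine TensorProduct.ext' fun c v => ?_
      exact congrArg (fun z : Words k A M (n + 1) => (act c a ⊗ₜ[k] z : A ⊗[k] Words k A M (n + 1)))
        (ih j w v)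

variable [HopfAlgebra k H] [IsScalarTower k H A] [IsScalarTower k H C]

lemma map₂_diag (hact : IsEquivariantAction k H act)
    {W V X : Type u} [AddCommGroup W] [Module k W] [AddCommGroup V]
    [Module k V] [AddCommGroup X] [Module k X]
    {D : H →ₗ[k] V →ₗ[k] V} {D' : H →ₗ[k] X →ₗ[k] X} {B : W →ₗ[k] V →ₗ[k] X}
    (h : ∀ r x y, B x (D r y) = D' r (B x y)) (t : H ⊗[k] H) (x : A ⊗[k] W) (y : C ⊗[k] V) :
    TensorProduct.map₂ act.flip B x (TensorProduct.map₂ (smulMap k H C) D t y) =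
      TensorProduct.map₂ (smulMap k H A) D' t (TensorProduct.map₂ act.flip B x y) := by
  induction t with
  | zero => simp
  | add t t' ht ht' => simp only [map_add, LinearMap.add_apply, ht, ht']
  | tmul r s =>
    suffices e : (TensorProduct.map₂ act.flip B).compl₂
        (TensorProduct.map₂ (smulMap k H C) D (r ⊗ₜ s)) =
        (TensorProduct.map₂ act.flip B).compr₂
          (TensorProduct.map₂ (smulMap k H A) D' (r ⊗ₜ s)) from
      LinearMap.congr_fun (LinearMap.congr_fun e x) y
    ext a w c v
    simp [h, smulMap, hact.equivariant]

/-- The word `x` stays fixed, because `h(c ▷ a) = h(c) ▷ a` lets `H` act through the factors in `C`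
only, with the same iterated coproduct on both sides. -/
lemma actWords_diagAct [Module H M] [IsScalarTower k H M]
    (hact : IsEquivariantAction k H act) (n : ℕ) (h : H) (x : Words k A k n) (y : Words k C M n) :
    actWords act M n x (diagAct k H C M n h y) = diagAct k H A M n h (actWords act M n x y) := by
  induction n generalizing h with
  | zero => exact (Algebra.lsmul k k M h).map_smul (x : k) (y : M) |>.symm
  | succ n ih => exact map₂_diag hact (fun r x y => ih r x y) _ _ _

variable [LeftComodule k H M]

/-- All three words are rotated together. At the end of the turn the coaction twists `c` on one side
and `c ▷ a` on the other, and these agree by equivariance; `x` is rotated without a twist. -/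
lemma actWords_rot (hact : IsEquivariantAction k H act)
    (n : ℕ) (x : Words k A k (n + 1)) (y : Words k C M (n + 1)) :
    actWords act M (n + 1) (rot k (LinearMap.id : A ⊗[k] k →ₗ[k] A ⊗[k] k) n x)
        (rot k (coactTwist k H C M) n y) =
      rot k (coactTwist k H A M) n (actWords act M (n + 1) x y) := by
  induction n with
  | zero =>
    suffices e : (TensorProduct.map₂ act.flip (LinearMap.lsmul k M)).compl₂ (coactTwist k H C M) =
        (TensorProduct.map₂ act.flip (LinearMap.lsmul k M)).compr₂ (coactTwist k H A M) from
      LinearMap.congr_fun (LinearMap.congr_fun e x) y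
    ext a c m
    simp only [AlgebraTensorModule.curry_apply, LinearMap.restrictScalars_self,
      TensorProduct.curry_apply, LinearMap.compl₂_apply, LinearMap.compr₂_apply,
      TensorProduct.map₂_apply_tmul, TensorProduct.map_tmul, LinearMap.flip_apply,
      LinearMap.lsmul_apply, one_smul, coactTwist_tmul]
    generalize (LeftComodule.coact (k := k) (H := H) m) = t
    induction t with
    | zero => simp
    | add t t' ht ht' => simp only [map_add, ht, ht']
    | tmul h m => simp [smulMap, hact.equivariant]
  | succ n ih => exact map₂_rotStep act ih x y

lemma actWords_rot_pow (hact : IsEquivariantAction k H act)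
    (n i : ℕ) (x : Words k A k (n + 1)) (y : Words k C M (n + 1)) :
    actWords act M (n + 1) ((rot k (LinearMap.id : A ⊗[k] k →ₗ[k] A ⊗[k] k) n ^ i) x)
        ((rot k (coactTwist k H C M) n ^ i) y) =
      (rot k (coactTwist k H A M) n ^ i) (actWords act M (n + 1) x y) := by
  induction i with
  | zero => rfl
  | succ i ih =>
    rw [pow_succ', pow_succ', pow_succ', Module.End.mul_apply, Module.End.mul_apply,
      Module.End.mul_apply, actWords_rot hact, ih]

variable [Module H M] [IsScalarTower k H M]

lemma actWords_mem_hopfRel (hact : IsEquivariantAction k H act)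
    (n : ℕ) (x : Words k A k (n + 1)) {y : Words k C M (n + 1)}
    (hy : y ∈ hopfRel k H C M n) : actWords act M (n + 1) x y ∈ hopfRel k H A M n := by
  rcases hy with ⟨h, z, rfl⟩ | ⟨z, rfl⟩
  · refine Or.inl ⟨h, actWords act M (n + 1) x z, ?_⟩
    rw [map_sub, actWords_diagAct hact, map_smul]
  · refine Or.inr ⟨actWords act M (n + 1) x z, ?_⟩
    -- As `t^(n+1)` is the identity on the word in `A`, it may be inserted there so that all words
    -- make a full turn.
    rw [map_sub, ← actWords_rot_pow hact, rot_id_pow, Module.End.one_apply]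

/-- The preimages of the kernels are not visibly stable under cofaces: compatibility controls
`actWords x (splitAt y)` only after `mulAt`. Hence the detour through the span of rotated relations,
where only rotations remain to be handled. -/
lemma actWords_mem_ker [IsModuleCoalgebra k H C] (hact : IsEquivariantAction k H act)
    (n : ℕ) (x : Words k A k (n + 1))
    {y : Words k C M (n + 1)} (hy : y ∈ (coalgebraOperators k H C M).ker n) :
    actWords act M (n + 1) x y ∈ (algebraOperators k H A M).ker n := by
  have adm := (algebraOperators k H A M).isAdmissible_ker
  suffices h : rotSpan k H C M n ≤
      Submodule.comap (actWords act M (n + 1) x) ((algebraOperators k H A M).ker n) from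
    h (ker_coalgebraOperators_le n hy)
  refine Submodule.span_le.2 ?_
  rintro _ ⟨i, z, hz, rfl⟩
  induction i generalizing x with
  | zero => exact adm.rel n _ (actWords_mem_hopfRel hact n x hz)
  | succ i ih =>
    -- The rotation of the word in `C` is matched by writing `x` as a rotation; `t^n` is the inverse
    -- of `t` on words in `A`.
    have e : x = rot k (LinearMap.id : A ⊗[k] k →ₗ[k] A ⊗[k] k) n
        ((rot k (LinearMap.id : A ⊗[k] k →ₗ[k] A ⊗[k] k) n ^ n) x) := by
      rw [← Module.End.mul_apply, ← pow_succ', rot_id_pow, Module.End.one_apply]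
    have := adm.t n _ (ih ((rot k (LinearMap.id : A ⊗[k] k →ₗ[k] A ⊗[k] k) n ^ n) x))
    change rot k (coactTwist k H A M) n (actWords act M (n + 1) _ _) ∈ _ at this
    rw [← actWords_rot hact, ← e, ← Module.End.mul_apply, ← pow_succ'] at this
    exact this

end ActWordsOperators

/-! ### Morphisms of cyclic modules -/

section Generators

open CyclicQuiver

namespace Lam

/-- The arrow of `Λ` represented by an arrow of the free category on the generators. -/
abbrev arrow {x y : Paths CyclicQuiver} (p : x ⟶ y) :
    (Quotient.functor CyclicQuiver.Rel).obj x ⟶ (Quotient.functor CyclicQuiver.Rel).obj y :=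
  (Quotient.functor CyclicQuiver.Rel).map p

lemma arrow_d_last (n : ℕ) :
    arrow (d n (n + 1) le_rfl) = arrow (d n 0 (by omega)) ≫ arrow (t (n + 1)) :=
  CategoryTheory.Quotient.sound _ (Rel.δ_last n)

/-- A property of arrows of `Λ` which holds for identities and generators and is stable under
composition holds for all arrows. -/
lemma arrow_induction (P : ∀ {x y : Lam}, (x ⟶ y) → Prop) (id : ∀ x : Lam, P (𝟙 x))
    (comp : ∀ {x y z : Lam} (f : x ⟶ y) (g : y ⟶ z), P f → P g → P (f ≫ g))
    (d : ∀ (n j : ℕ) (h : j ≤ n), P (arrow (d n j (by omega))))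
    (s : ∀ (n j : ℕ) (h : j ≤ n), P (arrow (s n j h)))
    (t : ∀ n : ℕ, P (arrow (t n))) {x y : Lam} (f : x ⟶ y) : P f := by
  obtain ⟨f, rfl⟩ := (Quotient.functor CyclicQuiver.Rel).map_surjective f
  refine Paths.induction (fun {x y} (p : x ⟶ y) => P (arrow p)) (fun {x} => ?_)
    (fun {x y z} p e hp => ?_) f
  · exact id _
  · have h : P (arrow ((Paths.of CyclicQuiver).map e)) := by
      match e with
      | .δ n j h =>
        -- The last coface is `∂_0` followed by `τ`, so it is obtained by composition instead of
        -- being a separate case.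
        rcases h.lt_or_eq with h' | rfl
        · exact d n j (by omega)
        · have := comp _ _ (d n 0 (by omega)) (t (n + 1))
          rw [← arrow_d_last] at this
          exact this
      | .σ n j h => exact s n j h
      | .τ n => exact t n
    exact comp _ _ hp h

/-- A natural transformation between functors on `Λᵒᵖ`, from compatibility with the generators. -/
def natTransMk {D : Type*} [Category D] {F G : Lamᵒᵖ ⥤ D}
    (app : ∀ x : Lam, F.obj (op x) ⟶ G.obj (op x))
    (d : ∀ (n j : ℕ) (_ : j ≤ n), F.map (arrow (d n j (by omega))).op ≫ app _ =
      app _ ≫ G.map (arrow (d n j (by omega))).op)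
    (s : ∀ (n j : ℕ) (h : j ≤ n), F.map (arrow (s n j h)).op ≫ app _ =
      app _ ≫ G.map (arrow (s n j h)).op)
    (t : ∀ n : ℕ, F.map (arrow (t n)).op ≫ app _ = app _ ≫ G.map (arrow (t n)).op) : F ⟶ G where
  app x := app x.unop
  naturality x y f := by
    refine arrow_induction (fun {x y} f => F.map f.op ≫ app x = app y ≫ G.map f.op)
      (fun x => ?_) (fun f g hf hg => ?_) d s t f.unop
    · rw [op_id, F.map_id, G.map_id, Category.comp_id, Category.id_comp]
    · rw [op_comp, F.map_comp, G.map_comp, Category.assoc, hf, reassoc_of% hg]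

end Lam

namespace CocyclicData

variable {D : Type u} [Category.{v} D] (E : CocyclicData D)

lemma toFunctor_map_d (n j : ℕ) (h : j ≤ n) :
    E.toFunctor.map (Lam.arrow (d n j (by omega))) = E.δ n j :=
  (E.pathFunctor_d n j (by omega)).trans (E.face_of_le h)

lemma toFunctor_map_s (n j : ℕ) (h : j ≤ n) :
    E.toFunctor.map (Lam.arrow (s n j h)) = E.σ n j :=
  E.pathFunctor_s n j h

lemma toFunctor_map_t (n : ℕ) : E.toFunctor.map (Lam.arrow (t n)) = E.τ n :=
  E.pathFunctor_t n

end CocyclicData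

end Generators

/-! ### Elementary tensors determine the morphism -/

section ElementaryTensors

variable {k : Type u} [Field k]

lemma word_smul {Z : Type u} [AddCommGroup Z] [Module k Z] (n : ℕ) (z : Fin n → Z) (r : k) :
    word k n z r = r • word k n z (1 : k) := by
  induction n with
  | zero => exact (mul_one r).symm
  | succ n ih =>
    exact (congrArg (fun y : Words k Z k n => (z 0 ⊗ₜ[k] y : Z ⊗[k] Words k Z k n)) (ih _)).trans
      (TensorProduct.tmul_smul r (z 0) _)

lemma words_hom_ext {Z V N : Type u} [AddCommGroup Z] [Module k Z] [AddCommGroup N] [Module k N]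
    [AddCommGroup V] [Module k V] {n : ℕ} {f g : Words k Z N n →ₗ[k] V}
    (h : ∀ z m, f (word k n z m) = g (word k n z m)) : f = g :=
  LinearMap.ext fun x => words_induction n (p := fun x => f x = g x) (by simp)
    (fun x y hx hy => by rw [map_add, map_add, hx, hy]) h x

/-- Morphisms from `Cyc_•(A)` to `diag_• Hom_k(C_•(C, M), Y)` are determined by their values on
elementary tensors. -/
lemma cyc_hom_ext {H : Type u} [Ring H] [HopfAlgebra k H] {A C M : Type u} [Ring A] [Algebra k A]
    [AddCommGroup C] [Module k C] [Coalgebra k C] [Module H C] [IsScalarTower k H C]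
    [IsModuleCoalgebra k H C] [AddCommGroup M] [Module k M] [Module H M] [IsScalarTower k H M]
    [LeftComodule k H M] {Y : Lamᵒᵖ ⥤ ModuleCat.{u} k}
    {φ φ' : cyc k A ⟶ ((diagHom k).obj (op (hopfCocyclic k H C M))).obj Y}
    (h : ∀ (n : ℕ) (a : Fin (n + 1) → A) (c : Fin (n + 1) → C) (m : M),
      diagHomEval ((φ.app (op (Lam.mk n))).hom (cycMk k n a)) (hopfCocyclicMk k H n c m) =
        diagHomEval ((φ'.app (op (Lam.mk n))).hom (cycMk k n a)) (hopfCocyclicMk k H n c m)) :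
    φ = φ' := by
  have key : ∀ n : ℕ, φ.app (op (Lam.mk n)) = φ'.app (op (Lam.mk n)) := by
    intro n
    have e (a : Fin (n + 1) → A) : (φ.app (op (Lam.mk n))).hom (cycMk k n a) =
        (φ'.app (op (Lam.mk n))).hom (cycMk k n a) :=
      Submodule.linearMap_qext _ (words_hom_ext fun c m => h n a c m)
    refine ModuleCat.hom_ext (words_hom_ext fun a r => ?_)
    -- `Cyc_n(A)` is realized with a last factor `k`; pulling the scalar `r` out leaves the elements
    -- `cycMk`.
    rw [word_smul]
    exact (map_smul _ r (cycMk k n a)).trans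
      ((congrArg (r • ·) (e a)).trans (map_smul _ r (cycMk k n a)).symm)
  exact NatTrans.ext (funext fun a => key a.unop.as)

end ElementaryTensors

/-! ### The characteristic map on the quotients -/

section CharacteristicMap

open CyclicQuiver

variable {k : Type u} [Field k] {H : Type u} [Ring H] [HopfAlgebra k H]
  {A C : Type u} [Ring A] [Algebra k A] [Module H A] [IsScalarTower k H A]
  [AddCommGroup C] [Module k C] [Coalgebra k C] [Module H C] [IsScalarTower k H C]
  [IsModuleCoalgebra k H C]
  (M : Type u) [AddCommGroup M] [Module k M] [Module H M] [IsScalarTower k H M]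
  [LeftComodule k H M]
  {act : C →ₗ[k] A →ₗ[k] A} (hact : IsEquivariantAction k H act)

/-- The map induced by `actWords` on the quotients. -/
noncomputable def actQuo (n : ℕ) : Words k A k (n + 1) →ₗ[k]
    ((coalgebraOperators k H C M).quo n →ₗ[k] (algebraOperators k H A M).quo n) where
  toFun x := ((coalgebraOperators k H C M).ker n).mapQ ((algebraOperators k H A M).ker n)
    (actWords act M (n + 1) x) fun _ hy => actWords_mem_ker hact n x hy
  map_add' x x' := by
    refine Submodule.linearMap_qext _ (LinearMap.ext fun y => ?_)
    exact congrArg (fun f : Words k C M (n + 1) →ₗ[k] Words k A M (n + 1) =>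
      (algebraOperators k H A M).cls n (f y)) (map_add (actWords act M (n + 1)) x x')
  map_smul' r x := by
    refine Submodule.linearMap_qext _ (LinearMap.ext fun y => ?_)
    exact congrArg (fun f : Words k C M (n + 1) →ₗ[k] Words k A M (n + 1) =>
      (algebraOperators k H A M).cls n (f y)) (map_smul (actWords act M (n + 1)) r x)

lemma actQuo_mulAt (n j : ℕ) (x : Words k A k (n + 2)) :
    actQuo M hact n (mulAt k A k n j x) = ((algebraOperators k H A M).quoDown n j).hom ∘ₗ
      actQuo M hact (n + 1) x ∘ₗ ((coalgebraOperators k H C M).quoUp n j).hom := by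
  refine Submodule.linearMap_qext _ (LinearMap.ext fun y => ?_)
  exact congrArg ((algebraOperators k H A M).cls n) (mulAt_actWords_splitAt hact n j x y).symm

lemma actQuo_oneAt (n j : ℕ) (x : Words k A k (n + 1)) :
    actQuo M hact (n + 1) (oneAt k A k (n + 1) (j + 1) x) =
      ((algebraOperators k H A M).quoUp n j).hom ∘ₗ
        actQuo M hact n x ∘ₗ ((coalgebraOperators k H C M).quoDown n j).hom := by
  refine Submodule.linearMap_qext _ (LinearMap.ext fun y => ?_)
  exact congrArg ((algebraOperators k H A M).cls (n + 1))
    (actWords_oneAt hact (n + 1) (j + 1) x y)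

lemma actQuo_rot (n : ℕ) (x : Words k A k (n + 1)) :
    actQuo M hact n (rot k (LinearMap.id : A ⊗[k] k →ₗ[k] A ⊗[k] k) n x) ∘ₗ
        ((coalgebraOperators k H C M).quoT n).hom =
      ((algebraOperators k H A M).quoT n).hom ∘ₗ actQuo M hact n x := by
  refine Submodule.linearMap_qext _ (LinearMap.ext fun y => ?_)
  exact congrArg ((algebraOperators k H A M).cls n) (actWords_rot hact n x y)

lemma endoIter_unop {D : Type u} [Category.{v} D] {X : D} (f : X ⟶ X) (m : ℕ) :
    (endoIter f.op m).unop = endoIter f m := by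
  rw [endoIter_op, Quiver.Hom.unop_op]

/-- The cyclic operator is `t^n = t⁻¹` on the two cyclic modules but `t` on the cocyclic one.
Solving `φ(t y) ∘ t = t ∘ φ(y)` with `x = t y` for `φ(y)` gives `φ(t⁻¹ x) = t⁻¹ ∘ φ(x) ∘ t`, which
is how `τ` acts on `diag Hom`. -/
lemma actQuo_endoIter_rot (n : ℕ) (x : Words k A k (n + 1)) :
    actQuo M hact n ((endoIter (ModuleCat.ofHom
        (rot k (LinearMap.id : A ⊗[k] k →ₗ[k] A ⊗[k] k) n)) n).hom x) =
      (endoIter ((algebraOperators k H A M).quoT n) n).hom ∘ₗ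
        actQuo M hact n x ∘ₗ ((coalgebraOperators k H C M).quoT n).hom := by
  set y := (endoIter (ModuleCat.ofHom
    (rot k (LinearMap.id : A ⊗[k] k →ₗ[k] A ⊗[k] k) n)) n).hom x with hy
  have hx : rot k (LinearMap.id : A ⊗[k] k →ₗ[k] A ⊗[k] k) n y = x := by
    rw [hy, OperatorModule.endoIter_hom, ← Module.End.mul_apply, ← pow_succ', rot_id_pow,
      Module.End.one_apply]
  have e : (endoIter ((algebraOperators k H A M).quoT n) n).hom ∘ₗ
      ((algebraOperators k H A M).quoT n).hom = LinearMap.id := by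
    have := self_comp_endoIter _ _ ((algebraOperators k H A M).endoIter_quoT (n := n)
      fun x => Or.inr ⟨x, rfl⟩)
    exact congrArg ModuleCat.Hom.hom this
  have h := actQuo_rot M hact n y
  rw [hx] at h
  rw [h, ← LinearMap.comp_assoc, e, LinearMap.id_comp]

variable [IsModuleAlgebra k H A]

/-- The morphism `Cyc_•(A) → diag_• Hom_k(C_•(C, M), C_•(A, M))` of cyclic modules. -/
noncomputable def charMap :
    cyc k A ⟶ ((diagHom k).obj (op (hopfCocyclic k H C M))).obj (hopfCyclic k H A M) :=
  Lam.natTransMk (fun x => ModuleCat.ofHom (actQuo M hact x.as))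
    (fun n j h => by
      -- The functors were built by lifting from generators; `e₁`, `e₂`, `e₃` recover the concrete
      -- operators on the three modules.
      have e₁ : (cyc k A).map (Lam.arrow (d n j (by omega))).op =
          ModuleCat.ofHom (mulAt k A k n j) :=
        congrArg Quiver.Hom.unop ((cycData k A).toFunctor_map_d n j h)
      have e₂ : (hopfCyclic k H A M).map (Lam.arrow (d n j (by omega))).op =
          (algebraOperators k H A M).quoDown n j :=
        congrArg Quiver.Hom.unop ((hopfCyclicData k H A M).toFunctor_map_d n j h)
      have e₃ : (hopfCocyclic k H C M).map (Lam.arrow (d n j (by omega))) =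
          (coalgebraOperators k H C M).quoUp n j :=
        (hopfCocyclicData k H C M).toFunctor_map_d n j h
      rw [e₁]
      refine ModuleCat.hom_ext (LinearMap.ext fun x => ?_)
      refine (actQuo_mulAt M hact n j x).trans ?_
      rw [← e₂, ← e₃]
      rfl)
    (fun n j h => by
      have e₁ : (cyc k A).map (Lam.arrow (s n j h)).op =
          ModuleCat.ofHom (oneAt k A k (n + 1) (j + 1)) :=
        congrArg Quiver.Hom.unop ((cycData k A).toFunctor_map_s n j h)
      have e₂ : (hopfCyclic k H A M).map (Lam.arrow (s n j h)).op =
          (algebraOperators k H A M).quoUp n j :=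
        congrArg Quiver.Hom.unop ((hopfCyclicData k H A M).toFunctor_map_s n j h)
      have e₃ : (hopfCocyclic k H C M).map (Lam.arrow (s n j h)) =
          (coalgebraOperators k H C M).quoDown n j :=
        (hopfCocyclicData k H C M).toFunctor_map_s n j h
      rw [e₁]
      refine ModuleCat.hom_ext (LinearMap.ext fun x => ?_)
      refine (actQuo_oneAt M hact n j x).trans ?_
      rw [← e₂, ← e₃]
      rfl)
    (fun n => by
      have e₁ : (cyc k A).map (Lam.arrow (t n)).op = endoIter (ModuleCat.ofHom
          (rot k (LinearMap.id : A ⊗[k] k →ₗ[k] A ⊗[k] k) n)) n :=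
        (congrArg Quiver.Hom.unop ((cycData k A).toFunctor_map_t n)).trans (endoIter_unop _ _)
      have e₂ : (hopfCyclic k H A M).map (Lam.arrow (t n)).op =
          endoIter ((algebraOperators k H A M).quoT n) n :=
        (congrArg Quiver.Hom.unop ((hopfCyclicData k H A M).toFunctor_map_t n)).trans
          (endoIter_unop _ _)
      have e₃ : (hopfCocyclic k H C M).map (Lam.arrow (t n)) =
          (coalgebraOperators k H C M).quoT n :=
        (hopfCocyclicData k H C M).toFunctor_map_t n
      rw [e₁]
      refine ModuleCat.hom_ext (LinearMap.ext fun x => ?_)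
      refine (actQuo_endoIter_rot M hact n x).trans ?_
      rw [← e₂, ← e₃]
      rfl)

lemma charMap_apply (n : ℕ) (a : Fin (n + 1) → A) (c : Fin (n + 1) → C) (m : M) :
    diagHomEval (((charMap M hact).app (op (Lam.mk n))).hom (cycMk k n a))
      (hopfCocyclicMk k H n c m) = hopfCyclicMk k H n (fun i => act (c i) (a i)) m :=
  congrArg ((algebraOperators k H A M).cls n) (actWords_word act M (n + 1) a c m)

end CharacteristicMap

/-! ### The characteristic map and the cup product -/

theorem mainTheorem4 {k H A C M : Type u} [Field k] [CharZero k] [Ring H] [HopfAlgebra k H]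
    [Ring A] [Algebra k A] [Module H A] [IsScalarTower k H A] [IsModuleAlgebra k H A]
    [AddCommGroup C] [Module k C] [Coalgebra k C] [Module H C] [IsScalarTower k H C]
    [IsModuleCoalgebra k H C]
    [AddCommGroup M] [Module k M] [Module H M] [IsScalarTower k H M] [LeftComodule k H M]
    (act : C →ₗ[k] A →ₗ[k] A) (hact : IsEquivariantAction k H act) :
    ∃! φ : cyc k A ⟶ ((diagHom k).obj (op (hopfCocyclic k H C M))).obj (hopfCyclic k H A M),
      (∀ (n : ℕ) (a : Fin (n + 1) → A) (c : Fin (n + 1) → C) (m : M),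
        diagHomEval ((φ.app (op (Lam.mk n))).hom (cycMk k n a)) (hopfCocyclicMk k H n c m) =
          hopfCyclicMk k H n (fun i => act (c i) (a i)) m) ∧
      ∃! cup : ∀ p q : ℕ, hopfCohomologyCoalgebra k H M C p ⊗[k] hopfCohomologyAlgebra k H M A q
          →ₗ[k] HC k A (p + q),
        ∃ η, IsExternalPairing η ∧
          ∀ (p q : ℕ) (x : hopfCohomologyCoalgebra k H M C p)
            (y : hopfCohomologyAlgebra k H M A q),
            cup p q (x ⊗ₜ y) =
              (Abelian.Ext.mk₀ φ).comp (η p q _ _ (x ⊗ₜ y)) (zero_add (p + q)) := by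
  obtain ⟨η, hη⟩ := exists_isExternalPairing (k := k)
  refine ⟨charMap M hact, ⟨charMap_apply M hact, ?_⟩, ?_⟩
  -- The product is pulled back along the characteristic map from one external pairing; any other
  -- pairing has the same values on pure tensors, so it yields the same product.
  · refine ⟨fun p q => Abelian.Ext.precompOfLinear (Abelian.Ext.mk₀ (charMap M hact)) k _
      (zero_add (p + q)) ∘ₗ η p q _ _, ⟨η, hη, fun p q x y => rfl⟩, ?_⟩
    rintro cup ⟨η', hη', h⟩
    refine funext fun p => funext fun q => TensorProduct.ext' fun x y => ?_
    rw [h, hη'.unique hη]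
    rfl
  -- The formula on elementary tensors alone determines `φ`; the clause on products plays no role
  -- here.
  · rintro φ ⟨hφ, -⟩
    exact cyc_hom_ext fun n a c m => (hφ n a c m).trans (charMap_apply M hact n a c m).symm
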